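/- **Conventions.** Let $M$ be a complex manifold of dimension $n\ge 2$ and $1\le p\le n-1$. Forms are smooth and complex valued; $d=\partial+\bar\partial$. A real $(p,p)$-form $\Omega$ on $M$ is *transverse* (strictly weakly positive) if its restriction to every complex $p$-dimensional subspace of every tangent space is a strictly positive volume form, i.e. $\Omega_x(v_1,iv_1,\dots,v_p,iv_p)>0$ for all $x\in M$ and all complex linearly independent $v_1,\dots,v_p\in T_xM$. The manifold $M$ is * $p$K ($p$-Kähler) if it has a transverse $(p,p)$-form $\Omega$ with $d\Omega=0$; * $p$WK (weakly $p$-Kähler) if it has a transverse $(p,p)$-form $\Omega$ with $\partial\Omega=\partial\bar\partial\alpha$ for some form $\alpha$; * $p$S ($p$-symplectic) if it has a real $2p$-form $\Psi$ with $d\Psi=0$ whose $(p,p)$-component is transverse; * $p$PL ($p$-pluriclosed) if it has a transverse $(p,p)$-form $\Omega$ with $\partial\bar\partial\Omega=0$. **The manifolds.** Let $G$ be the simply connected nilpotent Lie group with left-invariant complex structure which has a basis $\varphi_1,\varphi_2,\varphi_3$ of left-invariant $(1,0)$-forms with $$d\varphi_1=d\varphi_2=0,\qquad \partial\varphi_3=\varphi_1\wedge\varphi_2,\qquad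 \bar\partial\varphi_3=\tfrac{i}{2}\left(\varphi_1\wedge\bar\varphi_1+2\,\varphi_2\wedge\bar\varphi_2\right);$$ explicitly $G=\mathbb C^3$ with $$a*z=\left(a_1+z_1,\;a_2+z_2,\;a_3+z_3-a_1z_2+\tfrac i2(\bar a_1z_1+2\bar a_2z_2)\right),$$ $\varphi_1=dz_1$, $\varphi_2=dz_2$, $\varphi_3=dz_3+z_1dz_2-\tfrac i2(\bar z_1dz_1+2\bar z_2dz_2)$. For a discrete cocompact subgroup $\Gamma\subset G$ put $I_{3,1}=\Gamma\backslash G$, a compact complex threefold. Let $\eta\beta_5=G'/\Gamma'$, where $G'$ is the group of complex $4\times4$ matrices $$\begin{pmatrix}1&X&z\\0&I_2&Y\\0&0&1\end{pmatrix},\qquad X,Y\in\mathbb C^2,\ z\in\mathbb C,$$ and $\Gamma'$ is its subgroup of matrices with entries in $\mathbb Z[i]$; it is a compact complex manifold of dimension $5$. **Statement.** Discrete cocompact subgroups $\Gamma\subset G$ exist, and for every such $\Gamma$ the $8$-dimensional complex manifold $M=I_{3,1}\times\eta\beta_5$ has the following properties: 1. $M$ is $7$PL, $6$PL and $7$S;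 2. for $s=1,2,3,4,5$, $M$ is none of $s$K, $s$WK, $s$S, $s$PL; 3. $M$ is not $6$K, not $6$WK and not $6$S, and it is neither $7$K nor $7$WK. -/

import Mathlib

open scoped Manifold ContDiff Topology

/-! ### Complex-valued differential forms on a complex manifold -/

section Forms

variable {V : Type*} [AddCommGroup V] [Module ℂ V] [TopologicalSpace V]

/-- Multiplication by a complex scalar, as a real-linear continuous map. -/
def scalarMap [ContinuousConstSMul ℂ V] (c : ℂ) : V →L[ℝ] V where
  toFun v := c • v
  map_add' := smul_add c
  map_smul' r v := smul_comm c r v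
  cont := continuous_const_smul c

/-- A real-multilinear alternating `(p+q)`-form with complex values is of type `(p,q)`, i.e. it lies
in `Λ^{p,q}`, iff multiplying all arguments by `c` multiplies the value by `c ^ p * conj c ^ q`. -/
def IsOfType (p q : ℕ) {k : ℕ} (α : V [⋀^Fin k]→L[ℝ] ℂ) : Prop :=
  p + q = k ∧ ∀ (c : ℂ) (v : Fin k → V),
    α (fun i => c • v i) = c ^ p * (starRingEnd ℂ c) ^ q * α v

/-- The component of type `(p,q)` of a complex-valued alternating `k`-form; it is zero unless
`p + q = k`. With `ζ = exp (2πi / (2k+1))`, a form of type `(p',q')`, `p' + q' = k`, is multiplied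
by `ζ ^ (j(p'-q'))` when all its arguments are multiplied by `ζ ^ j`, so averaging against
`ζ ^ (-j(p-q))`, `0 ≤ j ≤ 2k`, is the projection onto `Λ^{p,q}` along the other types. -/
noncomputable def typeComponent [ContinuousConstSMul ℂ V] (p q : ℕ) {k : ℕ}
    (α : V [⋀^Fin k]→L[ℝ] ℂ) : V [⋀^Fin k]→L[ℝ] ℂ :=
  if p + q = k then
    let ζ : ℂ := Complex.exp (2 * Real.pi * Complex.I / (2 * k + 1))
    ((2 * k + 1 : ℂ)⁻¹) • ∑ j ∈ Finset.range (2 * k + 1),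
      (ζ ^ (-((j : ℤ) * ((p : ℤ) - (q : ℤ))))) • α.compContinuousLinearMap (scalarMap (ζ ^ j))
  else 0

/-- The sequence `v₀, i v₀, v₁, i v₁, …, v_{p-1}, i v_{p-1}`. -/
noncomputable def withJ {p : ℕ} (v : Fin p → V) : Fin (2 * p) → V := fun j =>
  if j.val % 2 = 0 then v ⟨j.val / 2, by omega⟩ else Complex.I • v ⟨j.val / 2, by omega⟩

/-- A `2p`-form on a complex vector space is transverse (strictly weakly positive) iff it is a real
form of type `(p,p)` whose restriction to every complex `p`-dimensional subspace is a strictly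
positive volume form, i.e. `Ω (v₁, i v₁, …, v_p, i v_p) > 0` for all complex linearly independent
`v₁, …, v_p`. -/
def IsTransverse (p : ℕ) (Ω : V [⋀^Fin (2 * p)]→L[ℝ] ℂ) : Prop :=
  IsOfType p p Ω ∧ (∀ v, (Ω v).im = 0) ∧
    ∀ v : Fin p → V, LinearIndependent ℂ v → 0 < (Ω (withJ v)).re

end Forms

section Manifold

variable {E : Type*} [NormedAddCommGroup E] [NormedSpace ℂ E]
  {H : Type*} [TopologicalSpace H] (I : ModelWithCorners ℂ E H)
  (M : Type*) [TopologicalSpace M] [ChartedSpace H M]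

/-- Complex-valued differential `k`-forms (not necessarily smooth) on the real manifold underlying
the complex manifold `M`. -/
abbrev DForm (k : ℕ) : Type _ :=
  ∀ x : M, (TangentSpace I x) [⋀^Fin k]→L[ℝ] ℂ

variable {I M}

namespace DForm

/-- The form read in the preferred chart around `x₀`: its pull-back under the inverse chart. -/
noncomputable def inChart {k : ℕ} (η : DForm I M k) (x₀ : M) (y : E) : E [⋀^Fin k]→L[ℝ] ℂ :=
  (η ((extChartAt I x₀).symm y)).compContinuousLinearMap
    ((mfderiv 𝓘(ℂ, E) I (extChartAt I x₀).symm y).restrictScalars ℝ)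

/-- A form is smooth iff it is (real) `C^∞` in charts. -/
def IsSmooth {k : ℕ} (η : DForm I M k) : Prop :=
  ∀ x₀ : M, ContDiffOn ℝ ∞ (η.inChart x₀) (extChartAt I x₀).target

/-- The exterior derivative, computed at `x` in the chart around `x`. -/
noncomputable def d {k : ℕ} (η : DForm I M k) : DForm I M (k + 1) := fun x =>
  (extDeriv (η.inChart x) (extChartAt I x x)).compContinuousLinearMap
    ((mfderiv I 𝓘(ℂ, E) (extChartAt I x) x).restrictScalars ℝ)

/-- The component of type `(p,q)`. -/
noncomputable def component {k : ℕ} (p q : ℕ) (η : DForm I M k) : DForm I M k := fun x =>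
  typeComponent p q (η x)

/-- The operator `∂`: on forms of type `(p,q)` it is the `(p+1,q)`-component of `d`. -/
noncomputable def del {k : ℕ} (η : DForm I M k) : DForm I M (k + 1) :=
  ∑ pq ∈ Finset.HasAntidiagonal.antidiagonal k, component (pq.1 + 1) pq.2 (d (component pq.1 pq.2 η))

/-- The operator `∂̄`: on forms of type `(p,q)` it is the `(p,q+1)`-component of `d`. -/
noncomputable def delBar {k : ℕ} (η : DForm I M k) : DForm I M (k + 1) :=
  ∑ pq ∈ Finset.HasAntidiagonal.antidiagonal k, component pq.1 (pq.2 + 1) (d (component pq.1 pq.2 η))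

/-- A smooth transverse `(p,p)`-form. -/
def IsSmoothTransverse (p : ℕ) (Ω : DForm I M (2 * p)) : Prop :=
  Ω.IsSmooth ∧ ∀ x, IsTransverse p (Ω x)

end DForm

variable (I M)

/-- `p`-Kähler manifolds (`pK`): there is a closed transverse `(p,p)`-form. -/
def IsPKahler (p : ℕ) : Prop :=
  ∃ Ω : DForm I M (2 * p), Ω.IsSmoothTransverse p ∧ Ω.d = 0

/-- Weakly `p`-Kähler manifolds (`pWK`): there is a transverse `(p,p)`-form `Ω` with `∂Ω = ∂∂̄α`
for some form `α` (of degree `k = 2p - 1`). -/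
def IsWeaklyPKahler (p : ℕ) : Prop :=
  ∃ Ω : DForm I M (2 * p), Ω.IsSmoothTransverse p ∧
    ∃ (k : ℕ) (hk : k + 1 = 2 * p) (α : DForm I M k), α.IsSmooth ∧
      ∀ (x : M) (v : Fin (2 * p + 1) → TangentSpace I x),
        Ω.del x v = α.delBar.del x (fun i => v (Fin.cast (by omega) i))

/-- `p`-symplectic manifolds (`pS`): there is a closed real `2p`-form whose `(p,p)`-component is
transverse. -/
def IsPSymplectic (p : ℕ) : Prop :=
  ∃ Ψ : DForm I M (2 * p), Ψ.IsSmooth ∧ (∀ x v, (Ψ x v).im = 0) ∧ Ψ.d = 0 ∧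
    (Ψ.component p p).IsSmoothTransverse p

/-- `p`-pluriclosed manifolds (`pPL`): there is a transverse `(p,p)`-form `Ω` with `∂∂̄Ω = 0`. -/
def IsPPluriclosed (p : ℕ) : Prop :=
  ∃ Ω : DForm I M (2 * p), Ω.IsSmoothTransverse p ∧ Ω.delBar.del = 0

end Manifold

/-! ### Quotients of complex vector spaces by groups of holomorphic transformations -/

section Quotient

open MulAction

variable {E : Type*} [NormedAddCommGroup E] [NormedSpace ℂ E]
  {X : Type*} [TopologicalSpace X] {f : E → X}

/-- The base of a surjective local homeomorphism `f : E → X`, with the local inverses of `f` as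
charts. -/
noncomputable abbrev coveringChartedSpace (hf : IsLocalHomeomorph f) (hs : Function.Surjective f) :
    ChartedSpace E X where
  atlas := Set.range hf.localInverseAt
  chartAt x := hf.localInverseAt (hs x).choose
  mem_chart_source x := by
    have h := hf.apply_self_mem_localInverseAt_source (x := (hs x).choose)
    rwa [(hs x).choose_spec] at h
  chart_mem_atlas x := ⟨_, rfl⟩

theorem covering_isManifold {Γ : Type*} [Group Γ] [MulAction Γ E]
    (hf : IsQuotientCoveringMap f Γ) (hl : IsLocalHomeomorph f)
    (hΓ : ∀ γ : Γ, ContDiff ℂ ω (fun z : E => γ • z)) :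
    @IsManifold ℂ _ E _ _ E _ 𝓘(ℂ, E) ω X _ (coveringChartedSpace hl hf.surjective) := by
  let _ := coveringChartedSpace hl hf.surjective
  apply isManifold_of_contDiffOn
  rintro e e' ⟨a, rfl⟩ ⟨b, rfl⟩
  simp only [modelWithCornersSelf_coe, modelWithCornersSelf_coe_symm, Function.comp_id,
    Function.id_comp, Set.preimage_id, Set.range_id, Set.inter_univ]
  set e := hl.localInverseAt a
  set e' := hl.localInverseAt b
  have hes : ∀ z, e.symm z = f z := fun z => by
    change (hl.localInverseAt a).symm z = f z
    rw [hl.localInverseAt_symm]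
  have hes' : ∀ z, e'.symm z = f z := fun z => by
    change (hl.localInverseAt b).symm z = f z
    rw [hl.localInverseAt_symm]
  intro y hy
  have hy' : f y ∈ e'.source := by
    have h : e.symm y ∈ e'.source := hy.2
    rwa [hes] at h
  have h1 : f (e' (f y)) = f y := by rw [← hes', e'.left_inv hy']
  obtain ⟨γ, hγ⟩ := hf.apply_eq_iff_mem_orbit.1 h1
  have hγ' : γ • y = e' (f y) := hγ
  have hopen : IsOpen (e'.target) := e'.open_target
  have hcont : Continuous (fun z : E => γ • z) := (hΓ γ).continuous
  have hmem : γ • y ∈ e'.target := by rw [hγ']; exact e'.map_source hy'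
  have hev : ∀ᶠ z in 𝓝 y, γ • z ∈ e'.target :=
    hcont.continuousAt.eventually_mem (hopen.mem_nhds hmem)
  have heq : (fun z : E => γ • z) =ᶠ[𝓝 y] (e.symm.trans e') := by
    filter_upwards [hev] with z hz
    have h2 : f (γ • z) = f z := hf.map_smul γ
    rw [OpenPartialHomeomorph.trans_apply, hes, ← h2, ← hes', e'.right_inv hz]
  exact ((hΓ γ).contDiffAt.congr_of_eventuallyEq heq.symm).contDiffWithinAt

end Quotient

/-! ### The nilmanifolds `I_{3,1}` -/

/-- The simply connected nilpotent Lie group covering `I_{3,1}`: the complex manifold `ℂ³` with the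
group law `a * z = (a₁+z₁, a₂+z₂, a₃+z₃ - a₁z₂ + (i/2)(ā₁z₁ + 2ā₂z₂))`. Left translations are
holomorphic and the forms `φ₁ = dz₁`, `φ₂ = dz₂`, `φ₃ = dz₃ + z₁dz₂ - (i/2)(z̄₁dz₁ + 2z̄₂dz₂)` are
a basis of the left-invariant `(1,0)`-forms; they satisfy `dφ₁ = dφ₂ = 0`, `∂φ₃ = φ₁ ∧ φ₂`,
`∂̄φ₃ = (i/2)(φ₁ ∧ φ̄₁ + 2 φ₂ ∧ φ̄₂)`. -/
def I31Group : Type := ℂ × ℂ × ℂ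

namespace I31Group

noncomputable instance : NormedAddCommGroup I31Group := inferInstanceAs (NormedAddCommGroup (ℂ × ℂ × ℂ))
noncomputable instance : NormedSpace ℂ I31Group := inferInstanceAs (NormedSpace ℂ (ℂ × ℂ × ℂ))

/-- The term by which the group law differs from addition. -/
noncomputable def cocycle (a z : I31Group) : ℂ :=
  -(a.1 * z.2.1) +
    Complex.I / 2 * (starRingEnd ℂ a.1 * z.1 + 2 * (starRingEnd ℂ a.2.1 * z.2.1))

noncomputable instance : Mul I31Group where
  mul a z := ((a.1 + z.1, a.2.1 + z.2.1, a.2.2 + z.2.2 + cocycle a z) : ℂ × ℂ × ℂ)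

noncomputable instance : One I31Group where
  one := ((0, 0, 0) : ℂ × ℂ × ℂ)

noncomputable instance : Inv I31Group where
  inv a := ((-a.1, -a.2.1, -a.2.2 + cocycle a a) : ℂ × ℂ × ℂ)

theorem mul_fst (a z : I31Group) : (a * z).1 = a.1 + z.1 := rfl
theorem mul_snd_fst (a z : I31Group) : (a * z).2.1 = a.2.1 + z.2.1 := rfl
theorem mul_snd_snd (a z : I31Group) : (a * z).2.2 = a.2.2 + z.2.2 + cocycle a z := rfl
theorem inv_fst (a : I31Group) : (a⁻¹).1 = -a.1 := rfl
theorem inv_snd_fst (a : I31Group) : (a⁻¹).2.1 = -a.2.1 := rfl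
theorem inv_snd_snd (a : I31Group) : (a⁻¹).2.2 = -a.2.2 + cocycle a a := rfl
theorem one_fst : (1 : I31Group).1 = 0 := rfl
theorem one_snd_fst : (1 : I31Group).2.1 = 0 := rfl
theorem one_snd_snd : (1 : I31Group).2.2 = 0 := rfl

noncomputable instance : Group I31Group := Group.ofLeftAxioms
  (fun a b c => by
    refine Prod.ext ?_ (Prod.ext ?_ ?_) <;>
      simp only [mul_fst, mul_snd_fst, mul_snd_snd, cocycle, map_add] <;> ring)
  (fun a => by
    refine Prod.ext ?_ (Prod.ext ?_ ?_) <;>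
      simp only [mul_fst, mul_snd_fst, mul_snd_snd, one_fst, one_snd_fst, one_snd_snd, cocycle,
        map_zero] <;> ring)
  (fun a => by
    refine Prod.ext ?_ (Prod.ext ?_ ?_) <;>
      simp only [mul_fst, mul_snd_fst, mul_snd_snd, inv_fst, inv_snd_fst, inv_snd_snd, one_fst,
        one_snd_fst, one_snd_snd, cocycle, map_neg] <;> ring)

instance : IsTopologicalGroup I31Group where
  continuous_mul := by
    change Continuous fun p : (ℂ × ℂ × ℂ) × (ℂ × ℂ × ℂ) =>
      ((p.1.1 + p.2.1, p.1.2.1 + p.2.2.1, p.1.2.2 + p.2.2.2 + cocycle p.1 p.2) : ℂ × ℂ × ℂ)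
    unfold cocycle
    fun_prop
  continuous_inv := by
    change Continuous fun a : ℂ × ℂ × ℂ =>
      ((-a.1, -a.2.1, -a.2.2 + cocycle a a) : ℂ × ℂ × ℂ)
    unfold cocycle
    fun_prop

theorem contDiff_mul_left (a : I31Group) : ContDiff ℂ ω (fun z : I31Group => a * z) := by
  change ContDiff ℂ ω fun z : ℂ × ℂ × ℂ =>
    ((a.1 + z.1, a.2.1 + z.2.1, a.2.2 + z.2.2 + cocycle a z) : ℂ × ℂ × ℂ)
  unfold cocycle
  fun_prop

end I31Group

/-- The space `Γ \ G` of right cosets of a subgroup `Γ` of the group `G = I31Group`. For a discrete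
and cocompact `Γ` this is the complex nilmanifold `I_{3,1}`. -/
def I31 (Γ : Subgroup I31Group) : Type := MulAction.orbitRel.Quotient Γ I31Group

namespace I31

variable (Γ : Subgroup I31Group)

instance : TopologicalSpace (I31 Γ) :=
  inferInstanceAs (TopologicalSpace (MulAction.orbitRel.Quotient Γ I31Group))

/-- The projection of the group onto the coset space. -/
noncomputable def proj : I31Group → I31 Γ := Quotient.mk (MulAction.orbitRel Γ I31Group)

theorem isQuotientCoveringMap [DiscreteTopology Γ] : IsQuotientCoveringMap (proj Γ) Γ :=
  (isQuotientMap_quotient_mk' (s := MulAction.orbitRel Γ I31Group)).isQuotientCoveringMap_of_subgroup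
    Γ (isDiscrete_iff_discreteTopology.mpr inferInstance)
    (Quotient.eq''.trans QuotientGroup.rightRel_apply)

noncomputable instance [DiscreteTopology Γ] : ChartedSpace I31Group (I31 Γ) :=
  coveringChartedSpace (isQuotientCoveringMap Γ).isCoveringMap.isLocalHomeomorph
    (isQuotientCoveringMap Γ).surjective

instance [DiscreteTopology Γ] : IsManifold 𝓘(ℂ, I31Group) ω (I31 Γ) :=
  covering_isManifold (isQuotientCoveringMap Γ) _ fun γ => I31Group.contDiff_mul_left γ

end I31

/-! ### The nilmanifolds `ηβ_{2n+1}` -/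

/-- The group of complex matrices `[[1, X, z], [0, Iₙ, Y], [0, 0, 1]]` of size `n + 2`, described by
the entries `(X, Y, z) ∈ ℂⁿ × ℂⁿ × ℂ`. -/
def EtaBetaGroup (n : ℕ) : Type := (Fin n → ℂ) × (Fin n → ℂ) × ℂ

namespace EtaBetaGroup

variable (n : ℕ)

noncomputable instance : NormedAddCommGroup (EtaBetaGroup n) :=
  inferInstanceAs (NormedAddCommGroup ((Fin n → ℂ) × (Fin n → ℂ) × ℂ))
noncomputable instance : NormedSpace ℂ (EtaBetaGroup n) :=
  inferInstanceAs (NormedSpace ℂ ((Fin n → ℂ) × (Fin n → ℂ) × ℂ))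

variable {n}

noncomputable instance : Mul (EtaBetaGroup n) where
  mul g h := ((g.1 + h.1, g.2.1 + h.2.1, h.2.2 + g.1 ⬝ᵥ h.2.1 + g.2.2) :
    (Fin n → ℂ) × (Fin n → ℂ) × ℂ)

noncomputable instance : One (EtaBetaGroup n) where
  one := ((0, 0, 0) : (Fin n → ℂ) × (Fin n → ℂ) × ℂ)

noncomputable instance : Inv (EtaBetaGroup n) where
  inv g := ((-g.1, -g.2.1, -g.2.2 + g.1 ⬝ᵥ g.2.1) : (Fin n → ℂ) × (Fin n → ℂ) × ℂ)

theorem mul_fst (g h : EtaBetaGroup n) : (g * h).1 = g.1 + h.1 := rfl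
theorem mul_snd_fst (g h : EtaBetaGroup n) : (g * h).2.1 = g.2.1 + h.2.1 := rfl
theorem mul_snd_snd (g h : EtaBetaGroup n) : (g * h).2.2 = h.2.2 + g.1 ⬝ᵥ h.2.1 + g.2.2 := rfl
theorem inv_fst (g : EtaBetaGroup n) : (g⁻¹).1 = -g.1 := rfl
theorem inv_snd_fst (g : EtaBetaGroup n) : (g⁻¹).2.1 = -g.2.1 := rfl
theorem inv_snd_snd (g : EtaBetaGroup n) : (g⁻¹).2.2 = -g.2.2 + g.1 ⬝ᵥ g.2.1 := rfl
theorem one_fst : (1 : EtaBetaGroup n).1 = 0 := rfl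
theorem one_snd_fst : (1 : EtaBetaGroup n).2.1 = 0 := rfl
theorem one_snd_snd : (1 : EtaBetaGroup n).2.2 = 0 := rfl

noncomputable instance : Group (EtaBetaGroup n) := Group.ofLeftAxioms
  (fun a b c => by
    refine Prod.ext ?_ (Prod.ext ?_ ?_) <;>
      simp only [mul_fst, mul_snd_fst, mul_snd_snd, add_dotProduct, dotProduct_add] <;> abel)
  (fun a => by
    refine Prod.ext ?_ (Prod.ext ?_ ?_) <;>
      simp only [mul_fst, mul_snd_fst, mul_snd_snd, one_fst, one_snd_fst, one_snd_snd,
        zero_dotProduct] <;> abel)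
  (fun a => by
    refine Prod.ext ?_ (Prod.ext ?_ ?_) <;>
      simp only [mul_fst, mul_snd_fst, mul_snd_snd, inv_fst, inv_snd_fst, inv_snd_snd, one_fst,
        one_snd_fst, one_snd_snd, neg_dotProduct] <;> abel)

instance : IsTopologicalGroup (EtaBetaGroup n) where
  continuous_mul := by
    change Continuous fun p : ((Fin n → ℂ) × (Fin n → ℂ) × ℂ) × ((Fin n → ℂ) × (Fin n → ℂ) × ℂ) =>
      ((p.1.1 + p.2.1, p.1.2.1 + p.2.2.1, p.2.2.2 + p.1.1 ⬝ᵥ p.2.2.1 + p.1.2.2) :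
        (Fin n → ℂ) × (Fin n → ℂ) × ℂ)
    unfold dotProduct
    fun_prop
  continuous_inv := by
    change Continuous fun g : (Fin n → ℂ) × (Fin n → ℂ) × ℂ =>
      ((-g.1, -g.2.1, -g.2.2 + g.1 ⬝ᵥ g.2.1) : (Fin n → ℂ) × (Fin n → ℂ) × ℂ)
    unfold dotProduct
    fun_prop

theorem contDiff_mul_right (h : EtaBetaGroup n) :
    ContDiff ℂ ω (fun g : EtaBetaGroup n => g * h) := by
  change ContDiff ℂ ω fun g : (Fin n → ℂ) × (Fin n → ℂ) × ℂ =>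
    ((g.1 + h.1, g.2.1 + h.2.1, h.2.2 + g.1 ⬝ᵥ h.2.1 + g.2.2) : (Fin n → ℂ) × (Fin n → ℂ) × ℂ)
  unfold dotProduct
  fun_prop

/-- The subgroup of matrices with entries in `ℤ[i]`. -/
noncomputable def gaussian (n : ℕ) : Subgroup (EtaBetaGroup n) where
  carrier := {g | (∀ j, g.1 j ∈ GaussianInt.toComplex.range) ∧
    (∀ j, g.2.1 j ∈ GaussianInt.toComplex.range) ∧ g.2.2 ∈ GaussianInt.toComplex.range}
  mul_mem' {g h} hg hh := by
    refine ⟨fun j => add_mem (hg.1 j) (hh.1 j), fun j => add_mem (hg.2.1 j) (hh.2.1 j), ?_⟩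
    exact add_mem (add_mem hh.2.2 (sum_mem fun j _ => mul_mem (hg.1 j) (hh.2.1 j))) hg.2.2
  one_mem' := ⟨fun _ => zero_mem _, fun _ => zero_mem _, zero_mem _⟩
  inv_mem' {g} hg := by
    refine ⟨fun j => neg_mem (hg.1 j), fun j => neg_mem (hg.2.1 j), ?_⟩
    exact add_mem (neg_mem hg.2.2) (sum_mem fun j _ => mul_mem (hg.1 j) (hg.2.1 j))

theorem gaussianInt_eq_zero_of_norm_lt_one {z : ℂ} (hz : z ∈ GaussianInt.toComplex.range)
    (h : ‖z‖ < 1) : z = 0 := by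
  obtain ⟨w, rfl⟩ := hz
  have h1 : (Zsqrtd.norm w : ℝ) < 1 := by
    rw [GaussianInt.intCast_real_norm, Complex.normSq_eq_norm_sq]
    have := norm_nonneg (GaussianInt.toComplex w)
    nlinarith
  have h2 : Zsqrtd.norm w < 1 := by exact_mod_cast h1
  have h3 : 0 ≤ Zsqrtd.norm w := GaussianInt.norm_nonneg w
  have h4 : w = 0 := GaussianInt.norm_eq_zero.1 (by omega)
  simp [h4]

instance (n : ℕ) : DiscreteTopology (gaussian n) := by
  apply discreteTopology_of_isOpen_singleton_one
  have hopen : IsOpen {g : (Fin n → ℂ) × (Fin n → ℂ) × ℂ | ‖g‖ < 1} :=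
    isOpen_lt continuous_norm continuous_const
  have hpre : IsOpen ((fun g : gaussian n => (g.1 : (Fin n → ℂ) × (Fin n → ℂ) × ℂ)) ⁻¹'
      {g | ‖g‖ < 1}) := hopen.preimage continuous_subtype_val
  convert! hpre using 1
  ext g
  constructor
  · rintro rfl
    change ‖(0 : (Fin n → ℂ) × (Fin n → ℂ) × ℂ)‖ < 1
    simp
  · intro h0
    obtain ⟨⟨X, Y, z⟩, hX, hY, hz⟩ := g
    change ‖((X, Y, z) : (Fin n → ℂ) × (Fin n → ℂ) × ℂ)‖ < 1 at h0
    rw [Prod.norm_mk, max_lt_iff, Prod.norm_mk, max_lt_iff] at h0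
    refine Subtype.ext (Prod.ext (funext fun j => ?_) (Prod.ext (funext fun j => ?_) ?_))
    · exact gaussianInt_eq_zero_of_norm_lt_one (hX j) ((norm_le_pi_norm X j).trans_lt h0.1)
    · exact gaussianInt_eq_zero_of_norm_lt_one (hY j) ((norm_le_pi_norm Y j).trans_lt h0.2.1)
    · exact gaussianInt_eq_zero_of_norm_lt_one hz h0.2.2

end EtaBetaGroup

/-- The manifold `ηβ_{2n+1} = G / Γ`, of complex dimension `2n+1`. -/
def EtaBeta (n : ℕ) : Type := EtaBetaGroup n ⧸ EtaBetaGroup.gaussian n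

namespace EtaBeta

variable (n : ℕ)

instance : TopologicalSpace (EtaBeta n) :=
  inferInstanceAs (TopologicalSpace (EtaBetaGroup n ⧸ EtaBetaGroup.gaussian n))

/-- The projection of the group onto the coset space. -/
noncomputable def proj : EtaBetaGroup n → EtaBeta n := QuotientGroup.mk

theorem isQuotientCoveringMap :
    IsQuotientCoveringMap (proj n) (EtaBetaGroup.gaussian n).op :=
  (EtaBetaGroup.gaussian n).isQuotientCoveringMap
    (isDiscrete_iff_discreteTopology.mpr (inferInstanceAs (DiscreteTopology (EtaBetaGroup.gaussian n))))

noncomputable instance : ChartedSpace (EtaBetaGroup n) (EtaBeta n) :=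
  coveringChartedSpace (isQuotientCoveringMap n).isCoveringMap.isLocalHomeomorph
    (isQuotientCoveringMap n).surjective

instance : IsManifold 𝓘(ℂ, EtaBetaGroup n) ω (EtaBeta n) :=
  covering_isManifold (isQuotientCoveringMap n) _
    fun γ => EtaBetaGroup.contDiff_mul_right (γ : (EtaBetaGroup n)ᵐᵒᵖ).unop

end EtaBeta

/-- The model of the product manifold `I_{3,1} × ηβ₅`, of complex dimension `8`. -/
noncomputable abbrev modelM : ModelWithCorners ℂ (I31Group × EtaBetaGroup 2)
    (ModelProd I31Group (EtaBetaGroup 2)) :=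
  𝓘(ℂ, I31Group).prod 𝓘(ℂ, EtaBetaGroup 2)

/-!
The manifold `M = I_{3,1} × ηβ₅` is a compact quotient of a two-step nilpotent Lie group: `ℂ⁸` with
a group law `y * z = y + z + c y z`, where `c` is real bilinear with central values (`coverBilin`,
`isNilCover_coverProj`). Every form on `M` is given by its coefficients in the left-invariant frame.
In these terms, the exterior derivative is a sum of derivatives of the coefficients along
left-invariant vector fields and of the Chevalley–Eilenberg differential of the Lie algebra
(`frameExtDeriv_apply`, `IsNilCover.toFrame_d`).

*Reduction to the Lie algebra.* An invariant mean is a positive functional on functions which kills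
the derivatives along left-invariant vector fields. It exists on the group, as a limit of
probability densities which are rescaled by the dilations (`exists_mean`), and it induces one on `M`
which is strictly positive by compactness (`IsNilCover.exists_isInvariantMean`). The mean of the
coefficients turns a form on `M` into a form on the Lie algebra, extended to its complexification.
This is compatible with `d`, with types, hence with `∂` and `∂̄`, and with positivity
(`DForm.HasMean.d`, `DForm.HasMean.component`, `DForm.HasMean.isDiagPositive`). So a transverse form
with one of the differential properties in question yields one on the Lie algebra.

*Nonexistence.* Let `l_j` be the basis dual to the left-invariant `(1,0)`-forms, with the indices
`0, 1, 2` for `φ₁, φ₂, φ₃` and `3, …, 7` for the second factor, and `r_j` the conjugate of `l_j`.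
The nonzero brackets are given by `[l₀, l₁] = -l₂`, `[l₀, r₀] = -(i/2) (l₂ + r₂)`,
`[l₁, r₁] = -i (l₂ + r₂)`, `[l₃, l₄] = [l₅, l₆] = -l₇` and by conjugation. A transverse form is
nonzero on each tuple `l_a, r_a, l_b, r_b, …` with distinct `a, b, …`. For `s ≤ 5`, the bracket
`[l₅, l₆]` allows one to write the value on `l₇, r₇, l₄, r₄, …` as a value of the differential
(`obsTuple`), and for `s = 6` the bracket `[l₁, r₁]` does so for the value on `l₂, r₂, …, l₇, r₇`
(`obsTuple₆`). For `s = 7`, the brackets `[l₀, r₀]` and `[l₁, r₁]` give a positive combination of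
two such values as a value of the differential of a `(7,7)`-form (`obsTuple₇`). The tuples on which
these values are taken span subalgebras, and every differential vanishes on them; so `∂̄α` does, and
the argument applies to forms `Ω` with `∂Ω = ∂∂̄α` as well (`detect_eq_zero`). For `∂∂̄Ω = 0` and
`s ≤ 5`, the brackets `[l₅, l₆]` and `[r₅, r₆]` are used together
(`map_obsIdx_eq_zero_of_ceDel_ceDelBar`).

*Existence.* The transverse forms are left invariant, and are contractions of the volume form, whose
differentials are again contractions, with brackets (`IsInvariantVolume`). In degree `7`, the sum of
the contractions with `l_j, r_j` is `∂∂̄`-closed as every form of degree `15` on the Lie algebra is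
closed, and its differential is the contraction with a multiple of `l₂ + r₂ = [l₁, l₀] + [r₁, r₀]`,
which terms of types `(6,8)` and `(8,6)` compensate (`formSeven`, `closedFormSeven`). In degree `6`,
one starts with the sum of the contractions with `l_j, r_j, l_k, r_k`. Its `∂∂̄` is a sum of
contractions with `l₂, r₂`, which cancel due to the coefficient `2` in `∂̄φ₃`, and with `l₇, r₇`,
which are cancelled by the terms subtracted in `sixSum`. The corrected form is still transverse, by
a Plücker relation (`isPositiveForm_formSix`).

Compactness and the existence of a lattice result from rounding to Gaussian integers
(`I31Group.halfGaussian`).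
-/

/-! ### The Chevalley–Eilenberg differential of a two-step nilpotent Lie algebra -/

section ChevalleyEilenberg

open Function

variable {K W N : Type*} [CommRing K] [AddCommGroup W] [Module K W] [AddCommGroup N] [Module K N]

/-- The derivation of the alternating forms induced by an endomorphism `D` of the underlying module:
`D` is applied to one argument at a time. -/
def lieAct {k : ℕ} (D : W →ₗ[K] W) (Φ : W [⋀^Fin k]→ₗ[K] N) : W [⋀^Fin k]→ₗ[K] N where
  toFun w := ∑ j, Φ (update w j (D (w j)))
  map_update_add' := by
    intro hdec w i x y
    have hd : hdec = instDecidableEqFin k := Subsingleton.elim _ _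
    subst hd
    rw [← Finset.sum_add_distrib]
    refine Finset.sum_congr rfl fun j _ => ?_
    rcases eq_or_ne j i with rfl | h
    · simp
    · simp only [update_of_ne h, update_comm h.symm, Φ.map_update_add]
  map_update_smul' := by
    intro hdec w i a x
    have hd : hdec = instDecidableEqFin k := Subsingleton.elim _ _
    subst hd
    rw [Finset.smul_sum]
    refine Finset.sum_congr rfl fun j _ => ?_
    rcases eq_or_ne j i with rfl | h
    · simp
    · simp only [update_of_ne h, update_comm h.symm, Φ.map_update_smul]
  map_eq_zero_of_eq' := by
    intro w i j hw hij
    rw [Fintype.sum_eq_add i j hij]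
    · have h1 : update w j (D (w j)) = (update w i (D (w i))) ∘ Equiv.swap i j := by
        funext l
        rcases eq_or_ne l i with rfl | hl
        · simp [hij, hij.symm, hw]
        · rcases eq_or_ne l j with rfl | hl'
          · simp [hw]
          · simp [Equiv.swap_apply_of_ne_of_ne hl hl', hl, hl']
      rw [h1, Φ.map_swap _ hij, add_neg_cancel]
    · rintro l ⟨hli, hlj⟩
      exact Φ.map_eq_zero_of_eq _ (by simp [hli.symm, hlj.symm, hw]) hij

theorem lieAct_apply {k : ℕ} (D : W →ₗ[K] W) (Φ : W [⋀^Fin k]→ₗ[K] N) (w : Fin k → W) :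
    lieAct D Φ w = ∑ j, Φ (update w j (D (w j))) := rfl

/-- The linear map `v ↦ -(c v) · Φ` attached to a bilinear map `c`. -/
def negLieActHom {k : ℕ} (c : W →ₗ[K] W →ₗ[K] W) (Φ : W [⋀^Fin k]→ₗ[K] N) :
    W →ₗ[K] W [⋀^Fin k]→ₗ[K] N where
  toFun v := -lieAct (c v) Φ
  map_add' x y := by
    ext w
    simp [lieAct_apply, Finset.sum_add_distrib, add_comm]
  map_smul' a x := by
    ext w
    simp [lieAct_apply, Finset.smul_sum]

/-- The Chevalley–Eilenberg differential of the Lie bracket `[x, y] = c x y - c y x`. -/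
def ceDiff {k : ℕ} (c : W →ₗ[K] W →ₗ[K] W) (Φ : W [⋀^Fin k]→ₗ[K] N) :
    W [⋀^Fin (k + 1)]→ₗ[K] N :=
  AlternatingMap.alternatizeUncurryFin (negLieActHom c Φ)

variable (c : W →ₗ[K] W →ₗ[K] W)

/-- The Lie bracket `[x, y] = c x y - c y x`. -/
def bracket : W →ₗ[K] W →ₗ[K] W := c - c.flip

theorem bracket_apply (x y : W) : bracket c x y = c x y - c y x := rfl

theorem ceDiff_apply {k : ℕ} (Φ : W [⋀^Fin k]→ₗ[K] N) (v : Fin (k + 1) → W) :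
    ceDiff c Φ v = ∑ i : Fin (k + 1), (-1) ^ (i : ℕ) •
      -∑ j, Φ (update (i.removeNth v) j (c (v i) (i.removeNth v j))) := by
  rw [ceDiff, AlternatingMap.alternatizeUncurryFin_apply]
  rfl

theorem ceDiff_add {k : ℕ} (Φ Ψ : W [⋀^Fin k]→ₗ[K] N) :
    ceDiff c (Φ + Ψ) = ceDiff c Φ + ceDiff c Ψ := by
  ext v
  simp [ceDiff_apply, Finset.sum_add_distrib]
  abel

theorem ceDiff_smul {k : ℕ} (a : K) (Φ : W [⋀^Fin k]→ₗ[K] N) :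
    ceDiff c (a • Φ) = a • ceDiff c Φ := by
  ext v
  simp [ceDiff_apply, Finset.smul_sum, smul_comm a]

/-- `ceDiff c` as a linear map. -/
def ceDiffₗ (k : ℕ) : (W [⋀^Fin k]→ₗ[K] N) →ₗ[K] (W [⋀^Fin (k + 1)]→ₗ[K] N) where
  toFun := ceDiff c
  map_add' := ceDiff_add c
  map_smul' := ceDiff_smul c

theorem ceDiff_eq_linearMap {k : ℕ} (Φ : W [⋀^Fin k]→ₗ[K] N) : ceDiff c Φ = ceDiffₗ c k Φ := rfl

theorem AlternatingMap.update_eq_smul_cons_removeNth {k : ℕ} (Φ : W [⋀^Fin (k + 1)]→ₗ[K] N)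
    (w : Fin (k + 1) → W) (i : Fin (k + 1)) (x : W) :
    (-1) ^ (i : ℕ) • Φ (Matrix.vecCons x (i.removeNth w)) = Φ (update w i x) := by
  rw [← AlternatingMap.map_insertNth, Fin.insertNth_removeNth]

omit [AddCommGroup W] in
theorem vecCons_update_zero {k : ℕ} (x y : W) (w : Fin k → W) :
    update (Matrix.vecCons x w) 0 y = Matrix.vecCons y w :=
  Fin.update_cons_zero (α := fun _ => W) x w y

omit [AddCommGroup W] in
theorem vecCons_update_succ {k : ℕ} (x y : W) (w : Fin k → W) (j : Fin k) :
    update (Matrix.vecCons x w) j.succ y = Matrix.vecCons x (update w j y) :=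
  (Fin.cons_update (α := fun _ => W) x w j y).symm

omit [AddCommGroup W] in
theorem removeNth_succ_vecCons {k : ℕ} (x : W) (w : Fin (k + 1) → W) (i : Fin (k + 1)) :
    i.succ.removeNth (Matrix.vecCons x w) = Matrix.vecCons x (i.removeNth w) := by
  funext l
  refine Fin.cases ?_ (fun l => ?_) l
  · rfl
  · simp [Fin.removeNth, Fin.succ_succAbove_succ, Matrix.vecCons]

/-- Cartan's formula `ι_x d + d ι_x = L_x`. -/
theorem curryLeft_ceDiff {k : ℕ} (Φ : W [⋀^Fin (k + 1)]→ₗ[K] N) (x : W) :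
    (ceDiff c Φ).curryLeft x = -lieAct (bracket c x) Φ - ceDiff c (Φ.curryLeft x) := by
  ext w
  have h2 : ∀ i : Fin (k + 1),
      (-1) ^ ((i.succ : Fin (k + 2)) : ℕ) • -∑ j, Φ (update
        (i.succ.removeNth (Matrix.vecCons x w : Fin (k + 2) → W)) j
          (c (w i) (i.succ.removeNth (Matrix.vecCons x w : Fin (k + 2) → W) j))) =
      Φ (update w i (c (w i) x)) - (-1) ^ (i : ℕ) • -∑ j, Φ.curryLeft x
        (update (i.removeNth w) j (c (w i) (i.removeNth w j))) := by
    intro i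
    rw [removeNth_succ_vecCons, Fin.sum_univ_succ]
    simp only [vecCons_update_zero, vecCons_update_succ, Matrix.cons_val_zero,
      Matrix.cons_val_succ, AlternatingMap.curryLeft_apply_apply]
    rw [← AlternatingMap.update_eq_smul_cons_removeNth Φ w i, Fin.val_succ, pow_succ]
    simp only [mul_neg, mul_one, neg_smul, smul_neg, smul_add, neg_add, neg_neg, sub_neg_eq_add]
  simp only [AlternatingMap.curryLeft_apply_apply, AlternatingMap.sub_apply,
    AlternatingMap.neg_apply]
  rw [ceDiff_apply, Fin.sum_univ_succ]
  have h0 : (0 : Fin (k + 2)).removeNth (Matrix.vecCons x w : Fin (k + 2) → W) = w := rfl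
  rw [h0]
  simp only [Matrix.cons_val_succ, Matrix.cons_val_zero]
  rw [Finset.sum_congr rfl fun i _ => h2 i, Finset.sum_sub_distrib, ceDiff_apply, lieAct_apply]
  simp only [bracket_apply, AlternatingMap.map_update_sub, Finset.sum_sub_distrib]
  simp
  abel

theorem curryLeft_lieAct {k : ℕ} (D : W →ₗ[K] W) (Φ : W [⋀^Fin (k + 1)]→ₗ[K] N) (x : W) :
    (lieAct D Φ).curryLeft x = Φ.curryLeft (D x) + lieAct D (Φ.curryLeft x) := by
  ext w
  simp only [AlternatingMap.curryLeft_apply_apply, AlternatingMap.add_apply, lieAct_apply]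
  rw [Fin.sum_univ_succ]
  simp only [vecCons_update_zero, vecCons_update_succ, Matrix.cons_val_zero, Matrix.cons_val_succ]

theorem AlternatingMap.map_update_eq_zero_of_mem_span {k : ℕ} (Φ : W [⋀^Fin k]→ₗ[K] N)
    (w : Fin k → W) (j : Fin k) {x : W} (hx : x ∈ Submodule.span K (w '' {j}ᶜ)) :
    Φ (update w j x) = 0 := by
  induction hx using Submodule.span_induction with
  | mem x hx =>
    obtain ⟨l, hl, rfl⟩ := hx
    exact Φ.map_update_self w (Ne.symm hl)
  | zero => simp
  | add x y _ _ hx hy => rw [Φ.map_update_add, hx, hy, add_zero]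
  | smul a x _ hx => rw [Φ.map_update_smul, hx, smul_zero]

/-- The differential vanishes on a tuple which spans a subalgebra in the strong sense that `c` of
two of its entries lies in the span of the others. -/
theorem ceDiff_eq_zero_of_forall_mem_span {k : ℕ} (Φ : W [⋀^Fin k]→ₗ[K] N) (v : Fin (k + 1) → W)
    (h : ∀ i j, i ≠ j → c (v i) (v j) ∈ Submodule.span K (v '' {i, j}ᶜ)) : ceDiff c Φ v = 0 := by
  rw [ceDiff_apply]
  refine Finset.sum_eq_zero fun i _ => ?_
  rw [Finset.sum_eq_zero, neg_zero, smul_zero]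
  intro j _
  refine Φ.map_update_eq_zero_of_mem_span _ _ ?_
  refine Submodule.span_mono ?_ (h i (i.succAbove j) (Fin.succAbove_ne i j).symm)
  rintro _ ⟨l, hl, rfl⟩
  simp only [Set.mem_compl_iff, Set.mem_insert_iff, Set.mem_singleton_iff, not_or] at hl
  obtain ⟨m, rfl⟩ := Fin.exists_succAbove_eq hl.1
  exact ⟨m, fun hm => hl.2 (by rw [Set.mem_singleton_iff.1 hm]), rfl⟩

end ChevalleyEilenberg

/-! ### An invariant mean on a two-step nilpotent group -/

section Mean

open MeasureTheory Filter

variable {E : Type*} [NormedAddCommGroup E] [NormedSpace ℝ E]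

/-- The left-invariant vector field `y ↦ v + c y v` of the group law `y * z = y + z + c y z`,
applied to a function. -/
noncomputable def invDeriv (c : E →ₗ[ℝ] E →ₗ[ℝ] E) (v : E) (f : E → ℂ) (y : E) : ℂ :=
  fderiv ℝ f y (v + c y v)

/-- Bounded continuous functions. -/
def IsBddCont (f : E → ℂ) : Prop := Continuous f ∧ ∃ C, ∀ y, ‖f y‖ ≤ C

/-- The bilinear map `c` defines a two-step nilpotent group law `y * z = y + z + c y z`. -/
structure IsTwoStep (c : E →ₗ[ℝ] E →ₗ[ℝ] E) : Prop where
  left : ∀ a b v, c (c a b) v = 0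
  right : ∀ y a b, c y (c a b) = 0

variable {c : E →ₗ[ℝ] E →ₗ[ℝ] E}

/-- A linear projection onto the span of the values of `c`, which is central. -/
theorem IsTwoStep.exists_projection (hc : IsTwoStep c) :
    ∃ P : E →ₗ[ℝ] E, (∀ a b, P (c a b) = c a b) ∧ (∀ a b, c (P a) b = 0) ∧
      (∀ a b, c a (P b) = 0) ∧ ∀ a, P (P a) = P a := by
  set S : Submodule ℝ E := Submodule.span ℝ (Set.range fun p : E × E => c p.1 p.2) with hS
  obtain ⟨f, hf⟩ := S.subtype.exists_leftInverse_of_injective (by simp)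
  have hf' : ∀ s : S, f s = s := fun s => LinearMap.congr_fun hf s
  have hl : ∀ s ∈ S, ∀ b, c s b = 0 := by
    intro s hs b
    induction hs using Submodule.span_induction with
    | mem x hx => obtain ⟨p, rfl⟩ := hx; exact hc.left _ _ _
    | zero => simp
    | add x y _ _ hx hy => simp [hx, hy]
    | smul a x _ hx => simp [hx]
  have hr : ∀ s ∈ S, ∀ b, c b s = 0 := by
    intro s hs b
    induction hs using Submodule.span_induction with
    | mem x hx => obtain ⟨p, rfl⟩ := hx; exact hc.right _ _ _
    | zero => simp
    | add x y _ _ hx hy => simp [hx, hy]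
    | smul a x _ hx => simp [hx]
  refine ⟨S.subtype ∘ₗ f, fun a b => ?_, fun a b => hl _ (f a).2 _, fun a b => hr _ (f b).2 _,
    fun a => by simp [hf']⟩
  have := hf' ⟨c a b, Submodule.subset_span ⟨(a, b), rfl⟩⟩
  simpa using congrArg Subtype.val this

variable [FiniteDimensional ℝ E]

theorem continuous_bilin (c : E →ₗ[ℝ] E →ₗ[ℝ] E) {X : Type*} [TopologicalSpace X] {f g : X → E}
    (hf : Continuous f) (hg : Continuous g) : Continuous fun x => c (f x) (g x) := by
  have : (fun x => c (f x) (g x)) = fun x => c.toContinuousBilinearMap (f x) (g x) := by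
    funext x; simp
  rw [this]
  fun_prop

theorem contDiff_bilin (c : E →ₗ[ℝ] E →ₗ[ℝ] E) (v : E) : ContDiff ℝ ∞ fun y => c y v :=
  (c.flip v).toContinuousLinearMap.contDiff

theorem continuous_invDeriv {f : E → ℂ} (hf : ContDiff ℝ 1 f) (v : E) :
    Continuous (invDeriv c v f) := by
  unfold invDeriv
  exact (hf.continuous_fderiv one_ne_zero).clm_apply
    (continuous_const.add (continuous_bilin c continuous_id continuous_const))

variable [MeasurableSpace E] [BorelSpace E] (μ : Measure E) [μ.IsAddHaarMeasure]

theorem integral_fderiv_apply_eq_zero {h : E → ℂ} (hh : ContDiff ℝ 1 h) (hs : HasCompactSupport h)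
    (v : E) : ∫ y, fderiv ℝ h y v ∂μ = 0 := by
  have h1 : Continuous fun y => fderiv ℝ h y v :=
    (hh.continuous_fderiv one_ne_zero).clm_apply continuous_const
  have h2 : HasCompactSupport fun y => fderiv ℝ h y v := hs.fderiv_apply (𝕜 := ℝ) v
  have := integral_bilinear_hasLineDerivAt_right_eq_neg_left_of_integrable (μ := μ)
    (f := fun _ : E => (1 : ℝ)) (f' := fun _ => 0) (g := h) (g' := fun y => fderiv ℝ h y v)
    (v := v) (B := ContinuousLinearMap.lsmul ℝ ℝ) (by simp)
    (by simpa using h1.integrable_of_hasCompactSupport h2)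
    (by simpa using hh.continuous.integrable_of_hasCompactSupport hs)
    (fun x _ => (hasFDerivAt_const (1 : ℝ) x).hasLineDerivAt v)
    (fun x _ => (hh.differentiable one_ne_zero x).hasFDerivAt.hasLineDerivAt v)
  simpa using this

omit [MeasurableSpace E] [BorelSpace E] in
theorem LinearMap.exists_sum_of_sq_eq_zero (T : E →ₗ[ℝ] E) (hT : ∀ y, T (T y) = 0) :
    ∃ (n : ℕ) (ℓ : Fin n → E →L[ℝ] ℝ) (z : Fin n → E), (∀ y, T y = ∑ i, ℓ i y • z i) ∧
      ∀ i j, ℓ i (z j) = 0 := by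
  let b := Module.finBasis ℝ (LinearMap.ker T)
  let g : E →ₗ[ℝ] LinearMap.ker T := T.codRestrict (LinearMap.ker T) hT
  refine ⟨_, fun i => (b.coord i ∘ₗ g).toContinuousLinearMap, fun i => (b i : E), fun y => ?_,
    fun i j => ?_⟩
  · have h1 : ((g y : LinearMap.ker T) : E) = T y := rfl
    rw [← h1]
    conv_lhs => rw [← b.sum_repr (g y)]
    rw [Submodule.coe_sum]
    rfl
  · have h0 : g (b j : E) = 0 := Subtype.ext (b j).2
    simp [h0]

/-- Left-invariant vector fields are divergence free: the coefficients of their central part do not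
depend on the central variables. -/
theorem integral_invDeriv_eq_zero (hc : IsTwoStep c) {h : E → ℂ} (hh : ContDiff ℝ 1 h)
    (hs : HasCompactSupport h) (v : E) : ∫ y, invDeriv c v h y ∂μ = 0 := by
  obtain ⟨n, ℓ, z, hℓ, hℓ0⟩ := LinearMap.exists_sum_of_sq_eq_zero (c.flip v)
    fun y => by simp [hc.left]
  replace hℓ : ∀ y, c y v = ∑ i, ℓ i y • z i := fun y => by simpa using hℓ y
  have hd : ∀ i, ContDiff ℝ 1 fun y => ℓ i y • h y := fun i => by
    exact ContDiff.smul (f := fun y => ℓ i y) (ℓ i).contDiff hh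
  have hsup : ∀ i, HasCompactSupport fun y => ℓ i y • h y := fun i => by
    exact HasCompactSupport.smul_left (f := fun y => ℓ i y) hs
  have key : ∀ y, invDeriv c v h y =
      fderiv ℝ h y v + ∑ i, fderiv ℝ (fun y => ℓ i y • h y) y (z i) := by
    intro y
    rw [invDeriv, map_add, hℓ y, map_sum]
    congr 1
    refine Finset.sum_congr rfl fun i _ => ?_
    rw [fderiv_fun_smul (ℓ i).differentiableAt (hh.differentiable one_ne_zero y)]
    simp [hℓ0]
  have hint : ∀ (f : E → ℂ), ContDiff ℝ 1 f → HasCompactSupport f → ∀ u,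
      Integrable (fun y => fderiv ℝ f y u) μ := fun f hf hfs u =>
    ((hf.continuous_fderiv one_ne_zero).clm_apply
      continuous_const).integrable_of_hasCompactSupport (hfs.fderiv_apply (𝕜 := ℝ) u)
  have h1 := hint h hh hs v
  have h2 : ∀ i, Integrable (fun y => fderiv ℝ (fun y => ℓ i y • h y) y (z i)) μ :=
    fun i => hint _ (hd i) (hsup i) (z i)
  have h3 : ∀ i, ∫ y, fderiv ℝ (fun y => ℓ i y • h y) y (z i) ∂μ = 0 :=
    fun i => integral_fderiv_apply_eq_zero μ (hd i) (hsup i) (z i)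
  rw [integral_congr_ae (Eventually.of_forall key), integral_add h1
    (integrable_finsetSum _ fun i _ => h2 i), integral_finsetSum _ fun i _ => h2 i,
    integral_fderiv_apply_eq_zero μ hh hs, zero_add]
  exact Finset.sum_eq_zero fun i _ => h3 i

theorem integral_invDeriv_mul (hc : IsTwoStep c) {g w : E → ℂ} (hg : ContDiff ℝ 1 g)
    (hw : ContDiff ℝ 1 w) (hs : HasCompactSupport w) (v : E) :
    ∫ y, invDeriv c v g y * w y ∂μ = -∫ y, g y * invDeriv c v w y ∂μ := by
  have h0 := integral_invDeriv_eq_zero μ hc (hg.mul hw) hs.mul_left v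
  have h1 : ∀ y, invDeriv c v (fun y => g y * w y) y =
      g y * invDeriv c v w y + invDeriv c v g y * w y := by
    intro y
    rw [invDeriv, fderiv_fun_mul (hg.differentiable one_ne_zero y)
      (hw.differentiable one_ne_zero y)]
    simp [invDeriv, mul_comm]
  have hs' : HasCompactSupport (invDeriv c v w) := by
    refine hs.fderiv (𝕜 := ℝ) |>.mono fun y hy => ?_
    rw [Function.mem_support] at hy ⊢
    intro h
    exact hy (by simp [invDeriv, h])
  change ∫ y, invDeriv c v (fun y => g y * w y) y ∂μ = 0 at h0
  simp only [h1] at h0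
  rw [integral_add] at h0
  · rw [eq_neg_iff_add_eq_zero, add_comm, h0]
  · exact (hg.continuous.mul (continuous_invDeriv hw v)).integrable_of_hasCompactSupport
      hs'.mul_left
  · exact ((continuous_invDeriv hg v).mul hw.continuous).integrable_of_hasCompactSupport
      hs.mul_left

/-- There is an invariant mean on bounded continuous functions: rescale a fixed probability density
by the dilations of the group, which expand the central directions quadratically, and pass to a
limit along an ultrafilter. Integration by parts bounds the integrals of a derivative along a
left-invariant vector field by a multiple of the inverse dilation factor, so its mean vanishes. -/
theorem exists_mean (hc : IsTwoStep c) : ∃ A : (E → ℂ) → ℂ,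
    (∀ f g, IsBddCont f → IsBddCont g → A (fun y => f y + g y) = A f + A g) ∧
    (∀ (a : ℂ) f, IsBddCont f → A (fun y => a * f y) = a * A f) ∧
    (∀ (f : E → ℂ) (r : ℝ), IsBddCont f → (∀ y, (f y).im = 0 ∧ r ≤ (f y).re) →
      (A f).im = 0 ∧ r ≤ (A f).re) ∧
    (∀ (f : E → ℂ) v, ContDiff ℝ 1 f → IsBddCont f → A (invDeriv c v f) = 0) := by
  obtain ⟨P, hP1, hP2, hP3, hP4⟩ := hc.exists_projection
  let μ : Measure E := Measure.addHaar
  let φ : ContDiffBump (0 : E) := default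
  let w : E → ℝ := φ.normed μ
  have hw0 : ∀ y, 0 ≤ w y := fun y => φ.nonneg_normed y
  have hw1 : ∫ y, w y ∂μ = 1 := φ.integral_normed
  have hwi : Integrable w μ := φ.integrable_normed
  have hwc : Continuous w := φ.continuous_normed
  let wc : E → ℂ := fun y => (w y : ℂ)
  have hwcd : ContDiff ℝ 1 wc := Complex.ofRealCLM.contDiff.comp (φ.contDiff_normed (n := 1))
  have hwcs : HasCompactSupport wc := φ.hasCompactSupport_normed.comp_left Complex.ofReal_zero
  let δ : ℕ → E →L[ℝ] E := fun N =>
    (((N : ℝ) + 1) • (LinearMap.id - P) + ((N : ℝ) + 1) ^ 2 • P).toContinuousLinearMap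
  have hδ : ∀ N y, δ N y = ((N : ℝ) + 1) • (y - P y) + ((N : ℝ) + 1) ^ 2 • P y := fun N y => by
    simp [δ]
  let B : ℕ → (E → ℂ) → ℂ := fun N f => ∫ y, f (δ N y) * wc y ∂μ
  have hint : ∀ N f, IsBddCont f → Integrable (fun y => f (δ N y) * wc y) μ := fun N f hf =>
    ((hf.1.comp (δ N).continuous).mul hwcd.continuous).integrable_of_hasCompactSupport
      hwcs.mul_left
  have hbd : ∀ f, IsBddCont f → ∃ C, ∀ N, ‖B N f‖ ≤ C := by
    rintro f ⟨hf, C, hC⟩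
    refine ⟨C, fun N => ?_⟩
    calc ‖B N f‖ ≤ ∫ y, C * w y ∂μ := by
          refine norm_integral_le_of_norm_le (hwi.const_mul C) (Eventually.of_forall fun y => ?_)
          rw [norm_mul]
          refine mul_le_mul (hC _) ?_ (norm_nonneg _) ((norm_nonneg _).trans (hC 0))
          simp [wc, abs_of_nonneg (hw0 y)]
      _ = C := by rw [integral_const_mul, hw1, mul_one]
  let U : Ultrafilter ℕ := hyperfilter ℕ
  have hlim : ∀ f, IsBddCont f → Tendsto (fun N => B N f) U (𝓝 (limUnder U fun N => B N f)) := by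
    intro f hf
    obtain ⟨C, hC⟩ := hbd f hf
    obtain ⟨x, -, hx⟩ := (isCompact_closedBall (0 : ℂ) C).ultrafilter_le_nhds
      (U.map fun N => B N f) (by
        rw [le_principal_iff]
        exact Filter.mem_map.2 (Eventually.of_forall fun N => by simpa [B] using hC N))
    exact tendsto_nhds_limUnder ⟨x, hx⟩
  refine ⟨fun f => limUnder U fun N => B N f, ?_, ?_, ?_, ?_⟩
  · intro f g hf hg
    refine Tendsto.limUnder_eq ?_
    refine ((hlim f hf).add (hlim g hg)).congr fun N => ?_
    simp only [B]
    rw [← integral_add (hint N f hf) (hint N g hg)]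
    simp only [add_mul]
  · intro a f hf
    refine Tendsto.limUnder_eq ?_
    refine ((hlim f hf).const_mul a).congr fun N => ?_
    simp only [B]
    rw [← integral_const_mul]
    simp only [mul_assoc]
  · intro f r hf hr
    have key : ∀ N, (B N f).im = 0 ∧ r ≤ (B N f).re := by
      intro N
      have h1 : (fun y => f (δ N y) * wc y) = fun y => (((f (δ N y)).re * w y : ℝ) : ℂ) := by
        funext y
        apply Complex.ext <;> simp [wc, (hr _).1]
      have h2 : B N f = ((∫ y, (f (δ N y)).re * w y ∂μ : ℝ) : ℂ) := by
        simp only [B]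
        rw [h1, integral_complex_ofReal]
      have h3 : Integrable (fun y => (f (δ N y)).re * w y) μ := by
        have h4 := hint N f hf
        rw [h1] at h4
        exact h4.re.congr (Eventually.of_forall fun y => by simp)
      refine ⟨by rw [h2, Complex.ofReal_im], ?_⟩
      rw [h2, Complex.ofReal_re]
      calc r = ∫ y, r * w y ∂μ := by rw [integral_const_mul, hw1, mul_one]
        _ ≤ _ := integral_mono (hwi.const_mul r) h3 fun y =>
          mul_le_mul_of_nonneg_right (hr _).2 (hw0 y)
    constructor
    · have := (Complex.continuous_im.tendsto _).comp (hlim f hf)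
      refine tendsto_nhds_unique this ?_
      exact tendsto_const_nhds.congr fun N => ((key N).1).symm
    · have := (Complex.continuous_re.tendsto _).comp (hlim f hf)
      exact ge_of_tendsto this (Eventually.of_forall fun N => (key N).2)
  · intro f v hf hb
    obtain ⟨-, C, hC⟩ := hb
    set v₁ := v - P v with hv₁
    have hwd : ∀ u, Continuous (invDeriv c u wc) := fun u => continuous_invDeriv hwcd u
    have hws : ∀ u, HasCompactSupport (invDeriv c u wc) := fun u => by
      refine hwcs.fderiv (𝕜 := ℝ) |>.mono fun y hy => ?_
      rw [Function.mem_support] at hy ⊢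
      intro h
      exact hy (by simp [invDeriv, h])
    set K : E → ℝ := fun u => ∫ y, ‖invDeriv c u wc y‖ ∂μ with hK
    have hKi : ∀ u, Integrable (fun y => ‖invDeriv c u wc y‖) μ := fun u =>
      ((hwd u).integrable_of_hasCompactSupport (hws u)).norm
    -- transport along the dilation, then integrate by parts against the fixed density
    have hB : ∀ N : ℕ, ∀ u : E, ‖∫ y, invDeriv c u (fun y => f (δ N y)) y * wc y ∂μ‖ ≤ C * K u := by
      intro N u
      rw [integral_invDeriv_mul μ hc (g := fun y => f (δ N y)) (hf.comp (δ N).contDiff) hwcd hwcs,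
        norm_neg]
      calc _ ≤ ∫ y, C * ‖invDeriv c u wc y‖ ∂μ := by
            refine norm_integral_le_of_norm_le ((hKi u).const_mul C)
              (Eventually.of_forall fun y => ?_)
            rw [norm_mul]
            exact mul_le_mul_of_nonneg_right (hC _) (norm_nonneg _)
        _ = C * K u := integral_const_mul _ _
    have hscale : ∀ (N : ℕ) (y : E), invDeriv c v f (δ N y) =
        (((N : ℝ) + 1)⁻¹ : ℝ) * invDeriv c v₁ (fun y => f (δ N y)) y +
        ((((N : ℝ) + 1) ^ 2)⁻¹ : ℝ) * invDeriv c (P v) (fun y => f (δ N y)) y := by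
      intro N y
      have hN : ((N : ℝ) + 1) ≠ 0 := by positivity
      have hfd : ∀ u, invDeriv c u (fun y => f (δ N y)) y =
          fderiv ℝ f (δ N y) (δ N (u + c y u)) := by
        intro u
        have : HasFDerivAt (fun y => f (δ N y)) ((fderiv ℝ f (δ N y)).comp (δ N)) y :=
          (hf.differentiable one_ne_zero (δ N y)).hasFDerivAt.comp y (δ N).hasFDerivAt
        rw [invDeriv, this.fderiv]
        rfl
      rw [hfd, hfd, invDeriv]
      simp only [← Complex.real_smul]
      rw [← map_smul, ← map_smul, ← map_smul, ← map_smul, ← map_add]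
      congr 1
      simp only [hδ, map_add, map_sub, map_smul, LinearMap.add_apply, LinearMap.sub_apply,
        LinearMap.smul_apply, hP1, hP2, hP3, hP4, hv₁, sub_self, smul_zero, sub_zero, add_zero,
        zero_add]
      match_scalars <;> field_simp <;> ring
    have hBN : ∀ N : ℕ, ‖B N (invDeriv c v f)‖ ≤
        ((N : ℝ) + 1)⁻¹ * (C * K v₁) + (((N : ℝ) + 1) ^ 2)⁻¹ * (C * K (P v)) := by
      intro N
      have hi : ∀ u, Integrable (fun y => invDeriv c u (fun y => f (δ N y)) y * wc y) μ := fun u =>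
        ((continuous_invDeriv (hf.comp (δ N).contDiff) u).mul
          hwcd.continuous).integrable_of_hasCompactSupport hwcs.mul_left
      have : B N (invDeriv c v f) = (((N : ℝ) + 1)⁻¹ : ℝ) *
          ∫ y, invDeriv c v₁ (fun y => f (δ N y)) y * wc y ∂μ +
          ((((N : ℝ) + 1) ^ 2)⁻¹ : ℝ) * ∫ y, invDeriv c (P v) (fun y => f (δ N y)) y * wc y ∂μ := by
        simp only [B, hscale]
        rw [← integral_const_mul, ← integral_const_mul, ← integral_add ((hi _).const_mul _)
          ((hi _).const_mul _)]
        simp only [add_mul, mul_assoc]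
      rw [this]
      refine (norm_add_le _ _).trans (add_le_add ?_ ?_)
      · rw [norm_mul, Complex.norm_real, Real.norm_of_nonneg (by positivity)]
        exact mul_le_mul_of_nonneg_left (hB N _) (by positivity)
      · rw [norm_mul, Complex.norm_real, Real.norm_of_nonneg (by positivity)]
        exact mul_le_mul_of_nonneg_left (hB N _) (by positivity)
    refine Tendsto.limUnder_eq ?_
    refine Tendsto.mono_left ?_ (Nat.hyperfilter_le_atTop : (U : Filter ℕ) ≤ atTop)
    refine squeeze_zero_norm hBN ?_
    have t1 : Tendsto (fun N : ℕ => ((N : ℝ) + 1)⁻¹) atTop (𝓝 0) := by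
      simpa [one_div] using tendsto_one_div_add_atTop_nhds_zero_nat (𝕜 := ℝ)
    have t2 : Tendsto (fun N : ℕ => (((N : ℝ) + 1) ^ 2)⁻¹) atTop (𝓝 0) := by
      simpa using t1.pow 2
    simpa using (t1.mul_const (C * K v₁)).add (t2.mul_const (C * K (P v)))

end Mean

/-! ### Differential forms in the left-invariant frame -/

section Frame

open Function

variable {E : Type*} [NormedAddCommGroup E] [NormedSpace ℝ E] [FiniteDimensional ℝ E]

/-- Evaluation of forms on the tuples of vectors of a fixed basis. -/
noncomputable def evalOnBasis (E : Type*) [NormedAddCommGroup E] [NormedSpace ℝ E]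
    [FiniteDimensional ℝ E] (k : ℕ) :
    (E [⋀^Fin k]→L[ℝ] ℂ) →ₗ[ℝ] (Fin k → Fin (Module.finrank ℝ E)) → ℂ where
  toFun θ r := θ fun i => Module.finBasis ℝ E (r i)
  map_add' _ _ := rfl
  map_smul' _ _ := rfl

theorem evalOnBasis_injective (k : ℕ) : Injective (evalOnBasis E k) := by
  intro θ θ' h
  have : θ.toAlternatingMap = θ'.toAlternatingMap :=
    Module.Basis.ext_alternating (Module.finBasis ℝ E) fun v _ => congrFun h v
  ext v
  exact DFunLike.congr_fun this v

instance finiteDimensional_continuousAlternatingMap (k : ℕ) :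
    FiniteDimensional ℝ (E [⋀^Fin k]→L[ℝ] ℂ) :=
  FiniteDimensional.of_injective (evalOnBasis E k) (evalOnBasis_injective k)

theorem exists_leftInverse_evalOnBasis (k : ℕ) :
    ∃ g : ((Fin k → Fin (Module.finrank ℝ E)) → ℂ) →L[ℝ] (E [⋀^Fin k]→L[ℝ] ℂ),
      ∀ θ, g (evalOnBasis E k θ) = θ := by
  obtain ⟨g, hg⟩ := (evalOnBasis E k).exists_leftInverse_of_injective
    (LinearMap.ker_eq_bot.2 (evalOnBasis_injective k))
  exact ⟨g.toContinuousLinearMap, fun θ => LinearMap.congr_fun hg θ⟩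

theorem contDiffAt_altForm_of_forall {X : Type*} [NormedAddCommGroup X] [NormedSpace ℝ X] {k : ℕ}
    {G : X → E [⋀^Fin k]→L[ℝ] ℂ} {y : X} {n : WithTop ℕ∞}
    (h : ∀ v, ContDiffAt ℝ n (fun y => G y v) y) : ContDiffAt ℝ n G y := by
  obtain ⟨g, hg⟩ := exists_leftInverse_evalOnBasis (E := E) k
  have h1 : G = fun y => g (evalOnBasis E k (G y)) := funext fun y => (hg _).symm
  rw [h1]
  refine g.contDiff.contDiffAt.comp y (contDiffAt_pi.2 fun r => ?_)
  exact h fun i => Module.finBasis ℝ E (r i)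

theorem ContDiffAt.altForm_apply {X : Type*} [NormedAddCommGroup X] [NormedSpace ℝ X] {k : ℕ}
    {G : X → E [⋀^Fin k]→L[ℝ] ℂ} {y : X} {n : WithTop ℕ∞} {u : X → Fin k → E}
    (hG : ContDiffAt ℝ n G y) (hu : ∀ j, ContDiffAt ℝ n (fun y => u y j) y) :
    ContDiffAt ℝ n (fun y => G y (u y)) y := by
  obtain ⟨g, hg⟩ := exists_leftInverse_evalOnBasis (E := E) k
  have h1 : ∀ (θ : E [⋀^Fin k]→L[ℝ] ℂ) v, θ v = ∑ r, ((evalOnBasis E k θ r).re • g (Pi.single r 1) v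
      + (evalOnBasis E k θ r).im • g (Pi.single r Complex.I) v) := by
    intro θ v
    have h2 : evalOnBasis E k θ = ∑ r, ((evalOnBasis E k θ r).re •
        (Pi.single r (1 : ℂ) : (Fin k → Fin (Module.finrank ℝ E)) → ℂ)
      + (evalOnBasis E k θ r).im • (Pi.single r Complex.I : _ → ℂ)) := by
      funext s
      simp only [Finset.sum_apply, Pi.add_apply, Pi.smul_apply, Pi.single_apply]
      simp [Finset.sum_add_distrib, Complex.re_add_im]
    have h6 := congrArg (fun t => g t v) h2
    simp only [hg, map_sum, map_add, map_smul, ContinuousAlternatingMap.sum_apply,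
      ContinuousAlternatingMap.add_apply, ContinuousAlternatingMap.smul_apply] at h6
    exact h6
  have h3 : ∀ (r : Fin k → Fin (Module.finrank ℝ E)), ContDiffAt ℝ n
      (fun y => evalOnBasis E k (G y) r) y := fun r => by
    have := (LinearMap.toContinuousLinearMap ((LinearMap.proj r : (_ → ℂ) →ₗ[ℝ] ℂ) ∘ₗ
      evalOnBasis E k)).contDiff.contDiffAt.comp (n := n) y hG
    exact this
  have hu' : ContDiffAt ℝ n u y := contDiffAt_pi.2 hu
  have h4 : ∀ θ : E [⋀^Fin k]→L[ℝ] ℂ, ContDiffAt ℝ n (fun y => θ (u y)) y := fun θ =>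
    θ.toContinuousMultilinearMap.contDiff.contDiffAt.comp y hu'
  have h5 : (fun y => G y (u y)) = fun y => ∑ r, ((evalOnBasis E k (G y) r).re •
      g (Pi.single r 1) (u y) + (evalOnBasis E k (G y) r).im • g (Pi.single r Complex.I) (u y)) :=
    funext fun y => h1 _ _
  rw [h5]
  refine ContDiffAt.sum fun r _ => ContDiffAt.add ?_ ?_
  · exact (Complex.reCLM.contDiff.contDiffAt.comp y (h3 r)).smul (h4 _)
  · exact (Complex.imCLM.contDiff.contDiffAt.comp y (h3 r)).smul (h4 _)

variable (c : E →ₗ[ℝ] E →ₗ[ℝ] E)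

/-- The left-invariant frame `v ↦ v + c y v` at the point `y`. -/
noncomputable def frameMap (y : E) : E →L[ℝ] E := (LinearMap.id + c y).toContinuousLinearMap

/-- The inverse of the left-invariant frame. -/
noncomputable def coframeMap (y : E) : E →L[ℝ] E := (LinearMap.id - c y).toContinuousLinearMap

theorem frameMap_apply (y v : E) : frameMap c y v = v + c y v := rfl
theorem coframeMap_apply (y v : E) : coframeMap c y v = v - c y v := rfl

variable {c}

theorem coframeMap_frameMap (hc : IsTwoStep c) (y v : E) :
    coframeMap c y (frameMap c y v) = v := by
  simp [frameMap_apply, coframeMap_apply, hc.right]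

theorem frameMap_coframeMap (hc : IsTwoStep c) (y v : E) :
    frameMap c y (coframeMap c y v) = v := by
  simp [frameMap_apply, coframeMap_apply, hc.right]

/-- The coefficients of a form in the left-invariant frame are smooth. -/
def SmoothFrame {k : ℕ} (F : E → E [⋀^Fin k]→L[ℝ] ℂ) : Prop :=
  ∀ v, ContDiff ℝ ∞ fun y => F y v

theorem SmoothFrame.contDiff {k : ℕ} {F : E → E [⋀^Fin k]→L[ℝ] ℂ} (hF : SmoothFrame F) :
    ContDiff ℝ ∞ F :=
  contDiff_iff_contDiffAt.2 fun _ => contDiffAt_altForm_of_forall fun v => (hF v).contDiffAt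

variable (c)

/-- The form with the given coefficients in the left-invariant frame. -/
noncomputable def ofFrame {k : ℕ} (F : E → E [⋀^Fin k]→L[ℝ] ℂ) (y : E) : E [⋀^Fin k]→L[ℝ] ℂ :=
  (F y).compContinuousLinearMap (coframeMap c y)

theorem SmoothFrame.contDiff_ofFrame {k : ℕ} {F : E → E [⋀^Fin k]→L[ℝ] ℂ} (hF : SmoothFrame F) :
    ContDiff ℝ ∞ (ofFrame c F) := by
  refine contDiff_iff_contDiffAt.2 fun y => contDiffAt_altForm_of_forall fun v => ?_
  refine ContDiffAt.altForm_apply (u := fun y j => coframeMap c y (v j)) hF.contDiff.contDiffAt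
    fun j => ?_
  exact (contDiff_const.sub (contDiff_bilin c (v j))).contDiffAt

/-- The coefficients of `dω` in the left-invariant frame, `F` being those of `ω`. -/
noncomputable def frameExtDeriv {k : ℕ} (F : E → E [⋀^Fin k]→L[ℝ] ℂ) (y : E) :
    E [⋀^Fin (k + 1)]→L[ℝ] ℂ :=
  (extDeriv (ofFrame c F) y).compContinuousLinearMap (frameMap c y)

variable {c}

/-- The exterior derivative in the left-invariant frame: derivatives of the coefficients along the
left-invariant vector fields, and the Chevalley–Eilenberg differential. -/
theorem frameExtDeriv_apply (hc : IsTwoStep c) {k : ℕ} {F : E → E [⋀^Fin k]→L[ℝ] ℂ}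
    (hF : SmoothFrame F) (y : E) (v : Fin (k + 1) → E) :
    frameExtDeriv c F y v =
      (∑ i : Fin (k + 1), (-1) ^ (i : ℕ) • invDeriv c (v i) (fun y => F y (i.removeNth v)) y) +
        ceDiff c (F y).toAlternatingMap v := by
  have hd : DifferentiableAt ℝ (ofFrame c F) y :=
    (hF.contDiff_ofFrame c).differentiable (by simp) y
  have hFd : DifferentiableAt ℝ F y := hF.contDiff.differentiable (by simp) y
  have h0 : frameExtDeriv c F y v = extDeriv (ofFrame c F) y fun i => frameMap c y (v i) := rfl
  rw [h0, extDeriv_apply hd, ceDiff_apply, ← Finset.sum_add_distrib]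
  refine Finset.sum_congr rfl fun i _ => ?_
  rw [← smul_add]
  congr 1
  set u : Fin k → E := i.removeNth v with hu
  have h1 : (fun z => ofFrame c F z (i.removeNth fun i => frameMap c y (v i))) =
      fun z => F z fun j => coframeMap c z (frameMap c y (u j)) := rfl
  have hg : ∀ j, HasFDerivAt (fun z => coframeMap c z (frameMap c y (u j)))
      (-(c.flip (frameMap c y (u j))).toContinuousLinearMap) y := fun j => by
    have := ((c.flip (frameMap c y (u j))).toContinuousLinearMap.hasFDerivAt (x := y)).const_sub
      (frameMap c y (u j))
    exact this
  rw [h1, fderiv_continuousAlternatingMap_apply_apply hFd fun j => (hg j).differentiableAt]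
  have h2 : ∀ j, coframeMap c y (frameMap c y (u j)) = u j := fun j => coframeMap_frameMap hc y _
  simp only [(hg _).fderiv, h2]
  congr 1
  · rw [invDeriv]
    have : (fun z => F z u) = fun z => F z fun j => u j := rfl
    rw [this, fderiv_continuousAlternatingMap_apply_apply hFd fun j => differentiableAt_const _]
    simp [frameMap_apply]
  · rw [← Finset.sum_neg_distrib]
    refine Finset.sum_congr rfl fun j _ => ?_
    have : (-(c.flip (frameMap c y (u j))).toContinuousLinearMap) (frameMap c y (v i)) =
        -(c (v i) (u j)) := by
      simp [frameMap_apply, hc.left, hc.right]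
    rw [this]
    exact (F y).toAlternatingMap.map_update_neg u j _

end Frame

/-! ### Forms on a quotient of a two-step nilpotent group -/

section Cover

variable {E : Type*} [NormedAddCommGroup E] [NormedSpace ℂ E]
  {H : Type*} [TopologicalSpace H] {I : ModelWithCorners ℂ E H}
  {M : Type*} [TopologicalSpace M] [ChartedSpace H M]

/-- The map `π : E → M` presents the complex manifold `M` as the quotient of `E`, with the group law
`y * z = y + z + c y z`, by a group of left translations; the charts of `M` are local inverses
of `π`. -/
structure IsNilCover (I : ModelWithCorners ℂ E H) (c : E →ₗ[ℝ] E →ₗ[ℝ] E) (π : E → M) : Prop where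
  twoStep : IsTwoStep c
  smul_right : ∀ (y : E) (a : ℂ) (v : E), c y (a • v) = a • c y v
  symm_eq : ∀ x : M, ⇑(extChartAt I x).symm = π
  deck : ∀ y y', π y = π y' → ∃ γ, y' = γ + y + c γ y ∧ ∀ z, π (γ + z + c γ z) = π z
  quotient : Topology.IsQuotientMap π

variable (c : E →ₗ[ℝ] E →ₗ[ℝ] E) {π : E → M}

variable (I) in
/-- The distinguished lift of a point of `M`: its image in its preferred chart. -/
noncomputable def chartPoint (x : M) : E := extChartAt I x x

theorem IsNilCover.apply_chartPoint {c : E →ₗ[ℝ] E →ₗ[ℝ] E} (h : IsNilCover I c π) (x : M) :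
    π (chartPoint I x) = x := by
  rw [← h.symm_eq x]
  exact extChartAt_to_inv x

theorem IsNilCover.contDiff_translation {c : E →ₗ[ℝ] E →ₗ[ℝ] E} [FiniteDimensional ℝ E] (γ : E) :
    ContDiff ℝ ∞ fun z => γ + z + c γ z :=
  (contDiff_const.add contDiff_id).add (c γ).toContinuousLinearMap.contDiff

variable [FiniteDimensional ℝ E]

/-- The coefficients of a form in the left-invariant frame; they depend on the point of `M` only. -/
noncomputable def DForm.toFrame {k : ℕ} (η : DForm I M k) (x : M) : E [⋀^Fin k]→L[ℝ] ℂ :=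
  ContinuousAlternatingMap.compContinuousLinearMap (η x) (frameMap c (chartPoint I x))

variable (I) in
/-- The form with given coefficients in the left-invariant frame. -/
noncomputable def DForm.fromFrame {k : ℕ} (F : M → E [⋀^Fin k]→L[ℝ] ℂ) : DForm I M k := fun x =>
  ContinuousAlternatingMap.compContinuousLinearMap (F x) (coframeMap c (chartPoint I x))

variable {c}

theorem DForm.toFrame_apply {k : ℕ} (η : DForm I M k) (x : M) (v : Fin k → E) :
    η.toFrame c x v = η x fun i => frameMap c (chartPoint I x) (v i) := rfl

theorem IsNilCover.apply_eq_toFrame (h : IsNilCover I c π) {k : ℕ} (η : DForm I M k) (x : M)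
    (v : Fin k → E) :
    η x v = η.toFrame c x fun i => coframeMap c (chartPoint I x) (v i) := by
  rw [DForm.toFrame_apply]
  simp only [frameMap_coframeMap h.twoStep]

theorem IsNilCover.toFrame_fromFrame (h : IsNilCover I c π) {k : ℕ}
    (F : M → E [⋀^Fin k]→L[ℝ] ℂ) : (DForm.fromFrame I c F).toFrame c = F := by
  funext x
  ext v
  rw [DForm.toFrame_apply]
  change F x (fun i => coframeMap c _ (frameMap c _ (v i))) = F x v
  simp only [coframeMap_frameMap h.twoStep]

/-- The derivative along a left-invariant vector field of a function invariant under a left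
translation is invariant under this translation. -/
theorem invDeriv_translation {c : E →ₗ[ℝ] E →ₗ[ℝ] E} (hc : IsTwoStep c) {f : E → ℂ}
    (hf : ContDiff ℝ ∞ f) {γ : E} (hinv : ∀ z, f (γ + z + c γ z) = f z) (v y : E) :
    invDeriv c v f (γ + y + c γ y) = invDeriv c v f y := by
  have hτ : HasFDerivAt (𝕜 := ℝ) (fun z => γ + z + c γ z)
      (ContinuousLinearMap.id ℝ E + (c γ).toContinuousLinearMap) y := by
    have := ((ContinuousLinearMap.id ℝ E +
      (c γ).toContinuousLinearMap).hasFDerivAt (x := y)).const_add γ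
    refine this.congr_of_eventuallyEq (Filter.Eventually.of_forall fun z => ?_)
    simp [add_assoc]
  have h6 : HasFDerivAt f ((fderiv ℝ f (γ + y + c γ y)).comp
      (ContinuousLinearMap.id ℝ E + (c γ).toContinuousLinearMap)) y := by
    have h7 : HasFDerivAt f (fderiv ℝ f (γ + y + c γ y)) (γ + y + c γ y) :=
      (hf.differentiable (by simp) _).hasFDerivAt
    exact (h7.comp y hτ).congr_of_eventuallyEq
      (Filter.Eventually.of_forall fun z => (hinv z).symm)
  rw [invDeriv, invDeriv, h6.fderiv]
  simp only [ContinuousLinearMap.comp_apply, add_apply,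
    ContinuousLinearMap.id_apply, LinearMap.coe_toContinuousLinearMap']
  congr 1
  simp only [map_add, LinearMap.add_apply, hc.left, hc.right]
  abel

variable [IsManifold I 1 M] [I.Boundaryless]

/-- The covering map identifies the left-invariant frame at `y` with the one at the distinguished
lift of `π y`, as a left translation takes the one point to the other. -/
theorem IsNilCover.mfderiv_eq (h : IsNilCover I c π) (y v : E) :
    mfderiv 𝓘(ℂ, E) I π y v =
      frameMap c (chartPoint I (π y)) (coframeMap c y v) := by
  set x := π y with hx
  set σ := chartPoint I x with hσ
  obtain ⟨γ, hγ, hπ⟩ := h.deck y σ (by rw [h.apply_chartPoint])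
  have hopen : IsOpen (extChartAt I x).target := isOpen_extChartAt_target x
  have hσm : σ ∈ (extChartAt I x).target := mem_extChartAt_target x
  have hdσ : MDifferentiableAt 𝓘(ℂ, E) I π σ := by
    have := mdifferentiableWithinAt_extChartAt_symm (I := I) hσm
    rw [h.symm_eq, I.range_eq_univ, mdifferentiableWithinAt_univ] at this
    exact this
  have hid : mfderiv 𝓘(ℂ, E) I π σ = ContinuousLinearMap.id ℂ E := by
    have := mfderivWithin_range_extChartAt_symm (I := I) (x := x)
    rw [I.range_eq_univ, mfderivWithin_univ, h.symm_eq] at this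
    exact this
  let Tγ : E →ₗ[ℂ] E := { toFun := c γ, map_add' := map_add _, map_smul' := h.smul_right γ }
  let Tc : E →L[ℂ] E := ⟨Tγ, (c γ).toContinuousLinearMap.continuous⟩
  let T : E →L[ℂ] E := ContinuousLinearMap.id ℂ E + Tc
  have hT : ∀ z, T z = z + c γ z := fun z => rfl
  have hτ : HasFDerivAt (𝕜 := ℂ) (fun z => γ + z + c γ z) T y := by
    have h1 : (fun z => γ + z + c γ z) = fun z => γ + T z := by
      funext z; rw [hT, add_assoc]
    rw [h1]
    exact T.hasFDerivAt.const_add γ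
  have hcomp : π ∘ (fun z => γ + z + c γ z) = π := funext hπ
  have hτσ : (fun z => γ + z + c γ z) y = σ := hγ.symm
  have h2 := mfderiv_comp_of_eq (I := 𝓘(ℂ, E)) (I' := 𝓘(ℂ, E)) (I'' := I) (x := y) (g := π)
    (f := fun z => γ + z + c γ z) hdσ hτ.differentiableAt.mdifferentiableAt hτσ
  have h3 : mfderiv 𝓘(ℂ, E) I π y v =
      mfderiv 𝓘(ℂ, E) I π ((fun z => γ + z + c γ z) y) (T v) := by
    have h4 : mfderiv 𝓘(ℂ, E) I (π ∘ (fun z => γ + z + c γ z)) y v =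
      mfderiv 𝓘(ℂ, E) I π ((fun z => γ + z + c γ z) y) (T v) := by
      rw [h2, mfderiv_eq_fderiv, hτ.fderiv]
      rfl
    rw [← h4, hcomp]
  rw [h3]
  have h5 : ∀ σ', σ' = σ → ∀ u, mfderiv 𝓘(ℂ, E) I π σ' u = (u : E) := by
    rintro _ rfl u
    rw [hid]
    rfl
  refine (h5 _ hτσ _).trans ?_
  rw [hT, hγ, frameMap_apply, coframeMap_apply]
  simp only [map_sub, map_add, LinearMap.add_apply, h.twoStep.left, h.twoStep.right]
  simp
  rfl

/-- Read in any chart, a form is the form on `E` with the same coefficients in the frame. -/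
theorem IsNilCover.inChart_eq (h : IsNilCover I c π) {k : ℕ} (η : DForm I M k) (x₀ : M) :
    η.inChart x₀ = ofFrame c fun y => η.toFrame c (π y) := by
  funext y
  have h1 : ∀ f : E → M, f = π → (η (f y)).compContinuousLinearMap
      ((mfderiv 𝓘(ℂ, E) I f y).restrictScalars ℝ) =
      ofFrame c (fun y => η.toFrame c (π y)) y := by
    intro f hf
    subst hf
    ext v
    change η (f y) (fun i => mfderiv 𝓘(ℂ, E) I f y (v i)) =
      η (f y) (fun i => frameMap c (chartPoint I (f y)) (coframeMap c y (v i)))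
    congr 1
    funext i
    exact h.mfderiv_eq y (v i)
  exact h1 _ (h.symm_eq x₀)

/-- A form has smooth coefficients in the left-invariant frame. -/
def DForm.IsSmoothFrame (c : E →ₗ[ℝ] E →ₗ[ℝ] E) (π : E → M) {k : ℕ} (η : DForm I M k) : Prop :=
  SmoothFrame fun y => η.toFrame c (π y)

theorem IsNilCover.isSmooth_iff (h : IsNilCover I c π) {k : ℕ} (η : DForm I M k) :
    η.IsSmooth ↔ η.IsSmoothFrame c π := by
  constructor
  · intro hη v
    refine contDiff_iff_contDiffAt.2 fun y => ?_
    set x := π y with hx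
    set σ := chartPoint I x with hσ
    obtain ⟨γ, hγ, hπ⟩ := h.deck y σ (by rw [h.apply_chartPoint])
    have h1 : ContDiffAt ℝ ∞ (ofFrame c fun y => η.toFrame c (π y)) σ := by
      rw [← h.inChart_eq η x]
      exact (hη x).contDiffAt ((isOpen_extChartAt_target x).mem_nhds (mem_extChartAt_target x))
    have h2 : ContDiffAt ℝ ∞ (fun y => η.toFrame c (π y) v) σ := by
      have h3 := ContDiffAt.altForm_apply (u := fun y j => frameMap c y (v j)) h1 fun j =>
        (contDiff_const.add (contDiff_bilin c (v j))).contDiffAt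
      refine h3.congr_of_eventuallyEq (Filter.Eventually.of_forall fun z => ?_)
      change η.toFrame c (π z) v =
        η.toFrame c (π z) fun i => coframeMap c z (frameMap c z (v i))
      simp only [coframeMap_frameMap h.twoStep]
    have h4 : (fun y => η.toFrame c (π y) v) =
        (fun y => η.toFrame c (π y) v) ∘ fun z => γ + z + c γ z := by
      funext z
      simp only [Function.comp_apply, hπ]
    rw [h4]
    rw [hγ] at h2
    exact h2.comp y (IsNilCover.contDiff_translation (c := c) γ).contDiffAt
  · intro hη x₀
    rw [h.inChart_eq]
    exact (SmoothFrame.contDiff_ofFrame c hη).contDiffOn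

/-- The exterior derivative on `M`, in the left-invariant frame: it may be computed at any lift of a
point, and not only at the distinguished one. -/
theorem IsNilCover.toFrame_d (h : IsNilCover I c π) {k : ℕ} {η : DForm I M k}
    (hη : η.IsSmoothFrame c π) (y : E) :
    η.d.toFrame c (π y) = frameExtDeriv c (fun y => η.toFrame c (π y)) y := by
  set x := π y with hx
  set σ := chartPoint I x with hσ
  obtain ⟨γ, hγ, hπ⟩ := h.deck y σ (by rw [h.apply_chartPoint])
  have h1 : η.d.toFrame c x = frameExtDeriv c (fun y => η.toFrame c (π y)) σ := by
    have h2 : ∀ v : Fin (k + 1) → E, η.d x v =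
        extDeriv (ofFrame c fun y => η.toFrame c (π y)) σ v := by
      intro v
      rw [← h.inChart_eq η x]
      change extDeriv (η.inChart x) (extChartAt I x x)
        (fun i => mfderiv I 𝓘(ℂ, E) (extChartAt I x) x (v i)) = _
      rw [mfderiv_extChartAt_self]
      rfl
    ext v
    exact h2 _
  rw [h1]
  -- both sides are invariant under the deck transformation
  ext v
  rw [frameExtDeriv_apply h.twoStep hη, frameExtDeriv_apply h.twoStep hη]
  congr 1
  · refine Finset.sum_congr rfl fun i _ => ?_
    rw [hγ, invDeriv_translation h.twoStep (hη (i.removeNth v)) (fun z => by simp only [hπ])]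
  · rw [h.apply_chartPoint]

end Cover

/-! ### Algebraic models of forms -/

section TypeProj

variable {W : Type*} [AddCommGroup W] [Module ℂ W]

/-- The projection onto the forms of type `(p,q)` on a complex vector space `W` on which a complex
number `a` acts by the `ℂ`-linear map `S a`, as in `typeComponent`. -/
noncomputable def typeProj (S : ℂ → W →ₗ[ℂ] W) (p q : ℕ) {k : ℕ} (Φ : W [⋀^Fin k]→ₗ[ℂ] ℂ) :
    W [⋀^Fin k]→ₗ[ℂ] ℂ :=
  if p + q = k then
    let ζ : ℂ := Complex.exp (2 * Real.pi * Complex.I / (2 * k + 1))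
    ((2 * k + 1 : ℂ)⁻¹) • ∑ j ∈ Finset.range (2 * k + 1),
      (ζ ^ (-((j : ℤ) * ((p : ℤ) - (q : ℤ))))) • Φ.compLinearMap (S (ζ ^ j))
  else 0

theorem typeProj_apply (S : ℂ → W →ₗ[ℂ] W) {p q k : ℕ} (h : p + q = k) (Φ : W [⋀^Fin k]→ₗ[ℂ] ℂ)
    (w : Fin k → W) : typeProj S p q Φ w =
      (2 * k + 1 : ℂ)⁻¹ * ∑ j ∈ Finset.range (2 * k + 1),
        Complex.exp (2 * Real.pi * Complex.I / (2 * k + 1)) ^ (-((j : ℤ) * ((p : ℤ) - (q : ℤ)))) *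
          Φ (fun l => S (Complex.exp (2 * Real.pi * Complex.I / (2 * k + 1)) ^ j) (w l)) := by
  rw [typeProj, if_pos h, AlternatingMap.smul_apply]
  congr 1
  have h1 : ∀ (s : Finset ℕ) (g : ℕ → W [⋀^Fin k]→ₗ[ℂ] ℂ), (∑ j ∈ s, g j) w = ∑ j ∈ s, g j w := by
    intro s g
    exact map_sum ({ toFun := fun f => f w, map_zero' := rfl, map_add' := fun _ _ => rfl } :
      (W [⋀^Fin k]→ₗ[ℂ] ℂ) →+ ℂ) g s
  rw [h1]
  rfl

theorem typeComponent_apply {V : Type*} [AddCommGroup V] [Module ℂ V] [TopologicalSpace V]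
    [ContinuousConstSMul ℂ V] {p q k : ℕ} (h : p + q = k) (α : V [⋀^Fin k]→L[ℝ] ℂ)
    (v : Fin k → V) : typeComponent p q α v =
      (2 * k + 1 : ℂ)⁻¹ * ∑ j ∈ Finset.range (2 * k + 1),
        Complex.exp (2 * Real.pi * Complex.I / (2 * k + 1)) ^ (-((j : ℤ) * ((p : ℤ) - (q : ℤ)))) *
          α (fun l => Complex.exp (2 * Real.pi * Complex.I / (2 * k + 1)) ^ j • v l) := by
  rw [typeComponent, if_pos h, ContinuousAlternatingMap.smul_apply,
    ContinuousAlternatingMap.sum_apply]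
  rfl

/-- The algebraic counterpart of `∂`. -/
noncomputable def ceDel (S : ℂ → W →ₗ[ℂ] W) (cW : W →ₗ[ℂ] W →ₗ[ℂ] W) {k : ℕ}
    (Φ : W [⋀^Fin k]→ₗ[ℂ] ℂ) : W [⋀^Fin (k + 1)]→ₗ[ℂ] ℂ :=
  ∑ pq ∈ Finset.HasAntidiagonal.antidiagonal k,
    typeProj S (pq.1 + 1) pq.2 (ceDiff cW (typeProj S pq.1 pq.2 Φ))

/-- The algebraic counterpart of `∂̄`. -/
noncomputable def ceDelBar (S : ℂ → W →ₗ[ℂ] W) (cW : W →ₗ[ℂ] W →ₗ[ℂ] W) {k : ℕ}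
    (Φ : W [⋀^Fin k]→ₗ[ℂ] ℂ) : W [⋀^Fin (k + 1)]→ₗ[ℂ] ℂ :=
  ∑ pq ∈ Finset.HasAntidiagonal.antidiagonal k,
    typeProj S pq.1 (pq.2 + 1) (ceDiff cW (typeProj S pq.1 pq.2 Φ))

end TypeProj

section Mean

variable {E : Type*} [NormedAddCommGroup E] [NormedSpace ℂ E]

/-- A linear functional `A` on functions on `E` together with a space `P` of smooth functions,
stable under the left-invariant vector fields, such that `A` kills the left-invariant derivatives of
the functions in `P`. -/
structure IsInvariantMean (c : E →ₗ[ℝ] E →ₗ[ℝ] E) (P : Submodule ℂ (E → ℂ))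
    (A : (E → ℂ) →ₗ[ℂ] ℂ) : Prop where
  smooth : ∀ f ∈ P, ContDiff ℝ ∞ f
  invDeriv_mem : ∀ f ∈ P, ∀ v, invDeriv c v f ∈ P
  map_invDeriv : ∀ f ∈ P, ∀ v, A (invDeriv c v f) = 0

/-- A `ℂ`-linear model `(W, cW, S)` of the bilinear map `c`, along a map `j` from `E` to the complex
vector space `W`; the operator `S a` of `W` extends the multiplication by `a` on `E`. -/
structure IsComplexModel {W : Type*} [AddCommGroup W] [Module ℂ W] (c : E →ₗ[ℝ] E →ₗ[ℝ] E)
    (j : E →ₗ[ℝ] W) (cW : W →ₗ[ℂ] W →ₗ[ℂ] W) (S : ℂ → W →ₗ[ℂ] W) : Prop where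
  map_c : ∀ x y, j (c x y) = cW (j x) (j y)
  map_smul : ∀ (a : ℂ) (x : E), j (a • x) = S a (j x)

end Mean

section Rep

variable {E : Type*} [NormedAddCommGroup E] [NormedSpace ℂ E] [FiniteDimensional ℝ E]
  {H : Type*} [TopologicalSpace H] {I : ModelWithCorners ℂ E H}
  {M : Type*} [TopologicalSpace M] [ChartedSpace H M]
  {W : Type*} [AddCommGroup W] [Module ℂ W]

/-- The mean value under `A` of the coefficients of `η` in the left-invariant frame is the complex
multilinear form `Θ`, restricted along `j`. -/
def DForm.HasMean (c : E →ₗ[ℝ] E →ₗ[ℝ] E) (π : E → M) (P : Submodule ℂ (E → ℂ))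
    (A : (E → ℂ) →ₗ[ℂ] ℂ) (j : E →ₗ[ℝ] W) {k : ℕ} (η : DForm I M k)
    (Θ : W [⋀^Fin k]→ₗ[ℂ] ℂ) : Prop :=
  (∀ v, (fun y => η.toFrame c (π y) v) ∈ P) ∧
    ∀ v, A (fun y => η.toFrame c (π y) v) = Θ fun i => j (v i)

namespace DForm.HasMean

variable {c : E →ₗ[ℝ] E →ₗ[ℝ] E} {π : E → M} {P : Submodule ℂ (E → ℂ)}
    {A : (E → ℂ) →ₗ[ℂ] ℂ} {j : E →ₗ[ℝ] W} {cW : W →ₗ[ℂ] W →ₗ[ℂ] W} {S : ℂ → W →ₗ[ℂ] W} {k : ℕ}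

theorem zero : HasMean (I := I) c π P A j (0 : DForm I M k) 0 :=
  ⟨fun _ => P.zero_mem, fun _ => map_zero A⟩

theorem add {η η' : DForm I M k} {Θ Θ' : W [⋀^Fin k]→ₗ[ℂ] ℂ} (h : HasMean c π P A j η Θ)
    (h' : HasMean c π P A j η' Θ') : HasMean c π P A j (η + η') (Θ + Θ') := by
  have key : ∀ v, (fun y => (η + η').toFrame c (π y) v) =
      (fun y => η.toFrame c (π y) v) + fun y => η'.toFrame c (π y) v := fun v => rfl
  refine ⟨fun v => ?_, fun v => ?_⟩
  · rw [key]
    exact P.add_mem (h.1 v) (h'.1 v)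
  · rw [key, map_add, h.2, h'.2]
    rfl

theorem sum {ι : Type*} (s : Finset ι) {η : ι → DForm I M k} {Θ : ι → W [⋀^Fin k]→ₗ[ℂ] ℂ}
    (h : ∀ i ∈ s, HasMean c π P A j (η i) (Θ i)) :
    HasMean c π P A j (∑ i ∈ s, η i) (∑ i ∈ s, Θ i) := by
  classical
  induction s using Finset.induction_on with
  | empty => exact zero
  | insert a s ha ih =>
    rw [Finset.sum_insert ha, Finset.sum_insert ha]
    exact (h a (Finset.mem_insert_self a s)).add
      (ih fun i hi => h i (Finset.mem_insert_of_mem hi))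

/-- Means are compatible with the decomposition into types, as this is formed pointwise. -/
theorem component (hj : IsComplexModel c j cW S) {η : DForm I M k} {Θ : W [⋀^Fin k]→ₗ[ℂ] ℂ}
    (hπ : IsNilCover I c π) (h : HasMean c π P A j η Θ) (p q : ℕ) :
    HasMean c π P A j (η.component p q) (typeProj S p q Θ) := by
  by_cases hpq : p + q = k
  · let ζ : ℂ := Complex.exp (2 * Real.pi * Complex.I / (2 * k + 1))
    have key : ∀ v, (fun y => (η.component p q).toFrame c (π y) v) =
        ((2 * k + 1 : ℂ)⁻¹) • ∑ i ∈ Finset.range (2 * k + 1),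
          (ζ ^ (-((i : ℤ) * ((p : ℤ) - (q : ℤ))))) •
            fun y => η.toFrame c (π y) (fun l => ζ ^ i • v l) := by
      intro v
      funext y
      have h1 : (η.component p q).toFrame c (π y) v =
        typeComponent p q (η (π y)) (fun l => frameMap c (chartPoint I (π y)) (v l)) := rfl
      have h2 : ∀ (a : ℂ) (u : E), frameMap c (chartPoint I (π y)) (a • u) =
          a • frameMap c (chartPoint I (π y)) u := fun a u => by
        rw [frameMap_apply, frameMap_apply, hπ.smul_right, smul_add]
      refine h1.trans ((typeComponent_apply hpq (V := TangentSpace I (π y)) (η (π y)) _).trans ?_)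
      simp only [Pi.smul_apply, Finset.sum_apply, DForm.toFrame_apply, h2]
      rfl
    refine ⟨fun v => ?_, fun v => ?_⟩
    · rw [key]
      exact P.smul_mem _ (P.sum_mem fun i _ => P.smul_mem _ (h.1 _))
    · rw [key, map_smul, map_sum, typeProj_apply S hpq]
      simp only [map_smul, h.2, hj.map_smul, smul_eq_mul, ζ]
  · have h1 : η.component p q = 0 := by
      funext x
      exact if_neg hpq
    have h2 : typeProj S p q Θ = 0 := if_neg hpq
    rw [h1, h2]
    exact zero

variable [IsManifold I 1 M] [I.Boundaryless]

omit [IsManifold I 1 M] [I.Boundaryless] in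
theorem isSmoothFrame (hA : IsInvariantMean c P A) {η : DForm I M k} {Θ : W [⋀^Fin k]→ₗ[ℂ] ℂ}
    (h : HasMean c π P A j η Θ) : η.IsSmoothFrame c π := fun v => hA.smooth _ (h.1 v)

/-- Means take the exterior derivative to the Chevalley–Eilenberg differential: the derivatives of
the coefficients along left-invariant vector fields have mean zero. -/
theorem d (hj : IsComplexModel c j cW S) (hA : IsInvariantMean c P A) {η : DForm I M k}
    {Θ : W [⋀^Fin k]→ₗ[ℂ] ℂ} (hπ : IsNilCover I c π) (h : HasMean c π P A j η Θ) :
    HasMean c π P A j η.d (ceDiff cW Θ) := by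
  have key : ∀ v : Fin (k + 1) → E, (fun y => η.d.toFrame c (π y) v) =
      (∑ i : Fin (k + 1), ((-1 : ℂ) ^ (i : ℕ)) •
        invDeriv c (v i) (fun y => η.toFrame c (π y) (i.removeNth v))) +
      ∑ i : Fin (k + 1), ((-1 : ℂ) ^ (i : ℕ)) • -∑ l, fun y => η.toFrame c (π y)
        (Function.update (i.removeNth v) l (c (v i) (i.removeNth v l))) := by
    intro v
    funext y
    rw [hπ.toFrame_d (h.isSmoothFrame hA), frameExtDeriv_apply hπ.twoStep (h.isSmoothFrame hA),
      ceDiff_apply]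
    simp only [Pi.add_apply, Finset.sum_apply, Pi.smul_apply, Pi.neg_apply, smul_eq_mul,
      Int.reduceNeg, zsmul_eq_mul, Int.cast_pow, Int.cast_neg, Int.cast_one]
    congr 1
  refine ⟨fun v => ?_, fun v => ?_⟩
  · rw [key]
    exact P.add_mem (P.sum_mem fun i _ => P.smul_mem _ (hA.invDeriv_mem _ (h.1 _) _))
      (P.sum_mem fun i _ => P.smul_mem _ (P.neg_mem (P.sum_mem fun l _ => h.1 _)))
  · rw [key, map_add, map_sum, map_sum, ceDiff_apply]
    simp only [map_smul, map_neg, map_sum, hA.map_invDeriv _ (h.1 _), smul_zero,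
      Finset.sum_const_zero, zero_add, h.2]
    refine Finset.sum_congr rfl fun i _ => ?_
    have h3 : ∀ l : Fin k, (fun m => j (Function.update (i.removeNth v) l
        (c (v i) (i.removeNth v l)) m)) = Function.update (i.removeNth fun m => j (v m)) l
          (cW (j (v i)) (i.removeNth (fun m => j (v m)) l)) := by
      intro l
      funext m
      by_cases hm : m = l
      · subst hm
        simp [hj.map_c, Fin.removeNth]
      · simp [hm, Fin.removeNth]
    simp only [h3]
    simp

theorem del (hj : IsComplexModel c j cW S) (hA : IsInvariantMean c P A) {η : DForm I M k}
    {Θ : W [⋀^Fin k]→ₗ[ℂ] ℂ} (hπ : IsNilCover I c π) (h : HasMean c π P A j η Θ) :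
    HasMean c π P A j η.del (ceDel S cW Θ) :=
  sum _ fun pq _ => ((h.component hj hπ pq.1 pq.2).d hj hA hπ).component hj hπ _ _

theorem delBar (hj : IsComplexModel c j cW S) (hA : IsInvariantMean c P A) {η : DForm I M k}
    {Θ : W [⋀^Fin k]→ₗ[ℂ] ℂ} (hπ : IsNilCover I c π) (h : HasMean c π P A j η Θ) :
    HasMean c π P A j η.delBar (ceDelBar S cW Θ) :=
  sum _ fun pq _ => ((h.component hj hπ pq.1 pq.2).d hj hA hπ).component hj hπ _ _

end DForm.HasMean

end Rep

/-! ### Invariant means -/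

section EvalMean

variable {E : Type*} [NormedAddCommGroup E] [NormedSpace ℂ E]

/-- The space of constant functions. -/
def constFun (E : Type*) : Submodule ℂ (E → ℂ) where
  carrier := {f | ∃ a, f = fun _ => a}
  add_mem' := by rintro _ _ ⟨a, rfl⟩ ⟨b, rfl⟩; exact ⟨a + b, rfl⟩
  zero_mem' := ⟨0, rfl⟩
  smul_mem' := by rintro r _ ⟨a, rfl⟩; exact ⟨r • a, rfl⟩

/-- On forms with constant coefficients in the left-invariant frame, the evaluation at a point is an
invariant mean; so the statements on means apply to left-invariant forms. -/
theorem isInvariantMean_eval (c : E →ₗ[ℝ] E →ₗ[ℝ] E) (y : E) :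
    IsInvariantMean c (constFun E) (LinearMap.proj y) := by
  have h : ∀ f ∈ constFun E, ∀ v, invDeriv c v f = 0 := by
    rintro _ ⟨a, rfl⟩ v
    funext z
    simp [invDeriv]
  refine ⟨?_, fun f hf v => ?_, fun f hf v => ?_⟩
  · rintro _ ⟨a, rfl⟩
    exact contDiff_const
  · rw [h f hf]
    exact zero_mem _
  · rw [h f hf, map_zero]

end EvalMean

section CompactMean

variable {E : Type*} [NormedAddCommGroup E] [NormedSpace ℂ E] [FiniteDimensional ℝ E] {M : Type*}

/-- The space of smooth functions which factor through `π`. -/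
def pullbackFun (π : E → M) : Submodule ℂ (E → ℂ) where
  carrier := {f | ContDiff ℝ ∞ f ∧ ∀ y y', π y = π y' → f y = f y'}
  add_mem' hf hg :=
    ⟨hf.1.add hg.1, fun y y' h => congrArg₂ (· + ·) (hf.2 y y' h) (hg.2 y y' h)⟩
  zero_mem' := ⟨contDiff_const, fun _ _ _ => rfl⟩
  smul_mem' r _ hf := ⟨contDiff_const.smul hf.1, fun y y' h => congrArg (r • ·) (hf.2 y y' h)⟩

variable {H : Type*} [TopologicalSpace H] {I : ModelWithCorners ℂ E H}
  [TopologicalSpace M] [ChartedSpace H M] {c : E →ₗ[ℝ] E →ₗ[ℝ] E} {π : E → M}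

theorem IsNilCover.invDeriv_mem_pullbackFun (h : IsNilCover I c π) {f : E → ℂ}
    (hf : f ∈ pullbackFun π) (v : E) : invDeriv c v f ∈ pullbackFun π := by
  refine ⟨?_, fun y y' hy => ?_⟩
  · unfold invDeriv
    exact (hf.1.fderiv_right (m := ∞) (by simp)).clm_apply
      (contDiff_const.add (contDiff_bilin c v))
  · obtain ⟨γ, rfl, hγ⟩ := h.deck y y' hy
    exact (invDeriv_translation h.twoStep hf.1 (fun z => hf.2 _ _ (hγ z)) v y).symm

omit [FiniteDimensional ℝ E] in
theorem IsNilCover.exists_continuous_factor (h : IsNilCover I c π) {f : E → ℂ}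
    (hf : Continuous f) (hπ : ∀ y y', π y = π y' → f y = f y') :
    ∃ g : M → ℂ, Continuous g ∧ ∀ y, g (π y) = f y := by
  have hg : ∀ y, f (Function.surjInv h.quotient.surjective (π y)) = f y := fun y =>
    hπ _ _ (Function.surjInv_eq h.quotient.surjective _)
  refine ⟨fun x => f (Function.surjInv h.quotient.surjective x), ?_, hg⟩
  rw [h.quotient.continuous_iff]
  convert hf using 1
  exact funext hg

/-- On a compact quotient, averaging provides an invariant mean which is strictly positive. -/
theorem IsNilCover.exists_isInvariantMean (h : IsNilCover I c π) [CompactSpace M] :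
    ∃ A : (E → ℂ) →ₗ[ℂ] ℂ, IsInvariantMean c (pullbackFun π) A ∧
      ∀ f ∈ pullbackFun π, (∀ y, (f y).im = 0) → (A f).im = 0 ∧
        ((∀ y, 0 < (f y).re) → 0 < (A f).re) := by
  let _ : MeasurableSpace E := borel E
  have _ : BorelSpace E := ⟨rfl⟩
  obtain ⟨A₀, hadd, hsmul, hpos, hinv⟩ := exists_mean h.twoStep
  let B : Submodule ℂ (E → ℂ) :=
    { carrier := {f | IsBddCont f}
      add_mem' := by
        rintro f g ⟨hf, C, hC⟩ ⟨hg, D, hD⟩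
        exact ⟨hf.add hg, C + D, fun y => (norm_add_le _ _).trans (add_le_add (hC y) (hD y))⟩
      zero_mem' := ⟨continuous_const, 0, fun y => by simp⟩
      smul_mem' := by
        rintro r f ⟨hf, C, hC⟩
        refine ⟨continuous_const.smul hf, ‖r‖ * C, fun y => ?_⟩
        exact (norm_smul_le _ _).trans (mul_le_mul_of_nonneg_left (hC y) (norm_nonneg r)) }
  let A₁ : B →ₗ[ℂ] ℂ :=
    { toFun := fun f => A₀ f.1
      map_add' := fun f g => hadd f.1 g.1 f.2 g.2
      map_smul' := fun r f => hsmul r f.1 f.2 }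
  obtain ⟨A, hA⟩ := A₁.exists_extend
  have hA' : ∀ f, IsBddCont f → A f = A₀ f := fun f hf => LinearMap.congr_fun hA ⟨f, hf⟩
  have hbdd : ∀ f ∈ pullbackFun π, IsBddCont f := by
    intro f hf
    obtain ⟨g, hg, hgf⟩ := h.exists_continuous_factor hf.1.continuous hf.2
    refine ⟨hf.1.continuous, ?_⟩
    obtain ⟨C, hC⟩ := (isCompact_range hg).isBounded.exists_norm_le
    exact ⟨C, fun y => hgf y ▸ hC _ ⟨π y, rfl⟩⟩
  refine ⟨A, ⟨fun f hf => hf.1, fun f hf v => h.invDeriv_mem_pullbackFun hf v, fun f hf v => ?_⟩,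
    fun f hf him => ⟨?_, fun hre => ?_⟩⟩
  · rw [hA' _ (hbdd _ (h.invDeriv_mem_pullbackFun hf v))]
    exact hinv f v (hf.1.of_le (by simp)) (hbdd f hf)
  · obtain ⟨C, hC⟩ := (hbdd f hf).2
    rw [hA' _ (hbdd f hf)]
    exact (hpos f (-C) (hbdd f hf) fun y => ⟨him y, by
      have := Complex.abs_re_le_norm (f y)
      have := neg_abs_le (f y).re
      linarith [hC y]⟩).1
  · obtain ⟨g, hg, hgf⟩ := h.exists_continuous_factor hf.1.continuous hf.2
    -- the minimum over the compact quotient bounds the function from below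
    have : ∃ r : ℝ, 0 < r ∧ ∀ y, r ≤ (f y).re := by
      obtain ⟨x, -, hx⟩ := isCompact_univ.exists_isMinOn (s := (Set.univ : Set M))
        ⟨π 0, trivial⟩ (Complex.continuous_re.comp hg).continuousOn
      obtain ⟨y₀, rfl⟩ := h.quotient.surjective x
      refine ⟨(f y₀).re, hre y₀, fun y => ?_⟩
      have := hx (Set.mem_univ (π y))
      simpa [hgf] using this
    obtain ⟨r, hr, hle⟩ := this
    rw [hA' _ (hbdd f hf)]
    exact hr.trans_le (hpos f r (hbdd f hf) fun y => ⟨him y, hle y⟩).2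

end CompactMean

/-! ### Complexification of forms -/

section Complexify

variable {E : Type*} [AddCommGroup E] [Module ℝ E] {W : Type*} [AddCommGroup W] [Module ℂ W]
  {ι : Type*} [Finite ι]

/-- Restriction of a complex multilinear form along a real-linear map. -/
def restrictForm (j : E →ₗ[ℝ] W) {k : ℕ} (Θ : W [⋀^Fin k]→ₗ[ℂ] ℂ) : E [⋀^Fin k]→ₗ[ℝ] ℂ where
  toFun v := Θ fun i => j (v i)
  map_update_add' := by
    intro hdec v i x y
    have h : ∀ z, (fun l => j (Function.update v i z l)) =
        Function.update (fun l => j (v l)) i (j z) := fun z => by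
      funext l
      by_cases hl : l = i
      · subst hl; simp
      · simp [hl]
    rw [h, h, h, map_add, Θ.map_update_add]
  map_update_smul' := by
    intro hdec v i r x
    have h : ∀ z, (fun l => j (Function.update v i z l)) =
        Function.update (fun l => j (v l)) i (j z) := fun z => by
      funext l
      by_cases hl : l = i
      · subst hl; simp
      · simp [hl]
    have h2 : j (r • x) = (r : ℂ) • j x := by
      rw [Complex.coe_smul]
      exact map_smul j r x
    rw [h, h, h2, Θ.map_update_smul]
    rfl
  map_eq_zero_of_eq' v i i' h hne := Θ.map_eq_zero_of_eq _ (congrArg j h) hne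

variable (j : E →ₗ[ℝ] W) (b : Module.Basis ι ℝ E) (B : Module.Basis ι ℂ W)
  (hb : ∀ i, j (b i) = B i)
include hb

/-- A real multilinear form extends to a complex multilinear form on the complexification. -/
theorem exists_restrictForm_eq {k : ℕ} (θ : E [⋀^Fin k]→ₗ[ℝ] ℂ) :
    ∃ Θ : W [⋀^Fin k]→ₗ[ℂ] ℂ, ∀ v, θ v = Θ fun i => j (v i) := by
  let _ := Fintype.ofFinite ι
  let _ : LinearOrder ι := LinearOrder.lift' (Fintype.equivFin ι) (Fintype.equivFin ι).injective
  let Θ : W [⋀^Fin k]→ₗ[ℂ] ℂ := exteriorPower.alternatingMapLinearEquiv.symm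
    ((B.exteriorPower k).constr ℂ fun s => θ fun i => b (Set.powersetCard.ofFinEmbEquiv.symm s i))
  refine ⟨Θ, fun v => ?_⟩
  suffices h : θ = restrictForm j Θ from DFunLike.congr_fun h v
  apply exteriorPower.alternatingMapLinearEquiv.injective
  refine (b.exteriorPower k).ext fun s => ?_
  rw [exteriorPower.basis_apply, exteriorPower.ιMulti_family,
    exteriorPower.alternatingMapLinearEquiv_apply_ιMulti,
    exteriorPower.alternatingMapLinearEquiv_apply_ιMulti]
  change _ = Θ fun i => j (b _)
  simp only [hb]
  have h1 : (fun i => B (Set.powersetCard.ofFinEmbEquiv.symm s i)) =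
    B ∘ Set.powersetCard.ofFinEmbEquiv.symm s := rfl
  rw [exteriorPower.alternatingMapLinearEquiv_symm_apply, h1]
  have h2 := (B.exteriorPower k).constr_basis ℂ
    (fun s => θ fun i => b (Set.powersetCard.ofFinEmbEquiv.symm s i)) s
  rw [exteriorPower.basis_apply, exteriorPower.ιMulti_family] at h2
  exact h2.symm

omit [Finite ι] in
theorem eq_of_restrictForm_eq {k : ℕ} {Θ Θ' : W [⋀^Fin k]→ₗ[ℂ] ℂ}
    (h : ∀ v : Fin k → E, (Θ fun i => j (v i)) = Θ' fun i => j (v i)) : Θ = Θ' := by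
  refine B.ext_alternating fun f _ => ?_
  simp only [← hb]
  exact h _

end Complexify

/-! ### The complexification of a complex vector space -/

section Weight

variable {W : Type*} [AddCommGroup W] [Module ℂ W]

theorem sum_zpow_exp_two_pi_div {N : ℕ} (hN : 0 < N) (m : ℤ) (hm : |m| < N) :
    ∑ j ∈ Finset.range N, Complex.exp (2 * Real.pi * Complex.I / N) ^ ((j : ℤ) * m) =
      if m = 0 then (N : ℂ) else 0 := by
  have hprim := Complex.isPrimitiveRoot_exp N hN.ne'
  set ζ := Complex.exp (2 * Real.pi * Complex.I / N) with hζ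
  split_ifs with h
  · simp [h]
  · have h1 : ∀ j : ℕ, ζ ^ ((j : ℤ) * m) = (ζ ^ m) ^ j := fun j => by
      rw [mul_comm, zpow_mul, zpow_natCast]
    simp only [h1]
    have h2 : ζ ^ m ≠ 1 := by
      rw [Ne, hprim.zpow_eq_one_iff_dvd]
      exact fun hd => h (Int.eq_zero_of_abs_lt_dvd hd hm)
    have h3 : (ζ ^ m) ^ N = 1 := by
      rw [← zpow_natCast, ← zpow_mul, mul_comm, zpow_mul, zpow_natCast, hprim.pow_eq_one, one_zpow]
    rw [geom_sum_eq h2, h3, sub_self, zero_div]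

/-- The projection to type `(p,q)`, on an argument which is an eigenvector for the action of the
circle. -/
theorem typeProj_apply_of_weight {S : ℂ → W →ₗ[ℂ] W} {k : ℕ} {Φ : W [⋀^Fin k]→ₗ[ℂ] ℂ}
    {w : Fin k → W} {n : ℤ} (hn : |n| ≤ k)
    (h : ∀ a : ℂ, ‖a‖ = 1 → Φ (fun l => S a (w l)) = a ^ n * Φ w) (p q : ℕ) :
    typeProj S p q Φ w = if p + q = k ∧ (p : ℤ) - q = n then Φ w else 0 := by
  by_cases hpq : p + q = k
  swap
  · rw [if_neg fun h => hpq h.1, typeProj, if_neg hpq]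
    rfl
  rw [typeProj_apply S hpq]
  have hc : (2 * k + 1 : ℂ) = ((2 * k + 1 : ℕ) : ℂ) := by push_cast; ring
  set ζ := Complex.exp (2 * Real.pi * Complex.I / (2 * k + 1)) with hζ
  have hζ0 : ζ ≠ 0 := Complex.exp_ne_zero _
  have hζ1 : ‖ζ‖ = 1 := by
    rw [hζ, hc]
    exact Complex.norm_eq_one_of_pow_eq_one
      (Complex.isPrimitiveRoot_exp (2 * k + 1) (by omega)).pow_eq_one (by omega)
  have h1 : ∀ j ∈ Finset.range (2 * k + 1), ζ ^ (-((j : ℤ) * ((p : ℤ) - (q : ℤ)))) *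
      Φ (fun l => S (ζ ^ j) (w l)) = ζ ^ ((j : ℤ) * (n - (p - q))) * Φ w := by
    intro j _
    rw [h (ζ ^ j) (by rw [norm_pow, hζ1, one_pow]), ← mul_assoc, ← zpow_natCast, ← zpow_mul,
      ← zpow_add₀ hζ0]
    congr 2
    ring
  rw [Finset.sum_congr rfl h1, ← Finset.sum_mul, hζ, hc, sum_zpow_exp_two_pi_div (by omega)]
  · by_cases h2 : (p : ℤ) - q = n
    · rw [if_pos (by omega), if_pos ⟨hpq, h2⟩, inv_mul_cancel_left₀]
      exact Nat.cast_ne_zero.2 (by omega)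
    · rw [if_neg (by omega), if_neg (by tauto), zero_mul, mul_zero]
  · rw [abs_lt]
    rw [abs_le] at hn
    constructor <;> push_cast <;> omega

end Weight

section Interleave

/-- The sequence `x₀, y₀, x₁, y₁, …`. -/
def interleave {X : Type*} {p : ℕ} (x y : Fin p → X) : Fin (2 * p) → X := fun i =>
  if i.val % 2 = 0 then x ⟨i.val / 2, by omega⟩ else y ⟨i.val / 2, by omega⟩

variable {X Y : Type*} {p : ℕ}

theorem interleave_cons (a b : X) (x y : Fin p → X) :
    interleave (Matrix.vecCons a x) (Matrix.vecCons b y) =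
      (Matrix.vecCons a (Matrix.vecCons b (interleave x y)) : Fin (2 * p + 2) → X) := by
  funext ⟨i, hi⟩
  match i, hi with
  | 0, hi =>
    have h2 : ∀ h, (⟨0 / 2, h⟩ : Fin (p + 1)) = 0 := fun h => Fin.ext (by simp)
    change interleave (Matrix.vecCons a x) (Matrix.vecCons b y) ⟨0, hi⟩ = a
    simp only [interleave, h2, Nat.zero_mod, if_true, Matrix.cons_val_zero]
  | 1, hi =>
    have h2 : ∀ h, (⟨1 / 2, h⟩ : Fin (p + 1)) = 0 := fun h => Fin.ext (by simp)
    change interleave (Matrix.vecCons a x) (Matrix.vecCons b y) ⟨1, hi⟩ = b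
    simp only [interleave, h2, Nat.one_mod, one_ne_zero, if_false, Matrix.cons_val_zero]
  | i + 2, hi =>
    have h2 : ∀ h, (⟨(i + 2) / 2, h⟩ : Fin (p + 1)) = Fin.succ ⟨i / 2, by omega⟩ := fun h =>
      Fin.ext (by simp)
    change interleave (Matrix.vecCons a x) (Matrix.vecCons b y) ⟨i + 2, hi⟩ =
      interleave x y ⟨i, by omega⟩
    simp only [interleave, h2, Nat.add_mod_right, Matrix.cons_val_succ]

theorem comp_interleave (g : X → Y) (x y : Fin p → X) :
    (fun i => g (interleave x y i)) = interleave (fun i => g (x i)) fun i => g (y i) := by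
  funext i
  simp only [interleave]
  split_ifs <;> rfl

theorem withJ_eq_interleave {V : Type*} [AddCommGroup V] [Module ℂ V] (v : Fin p → V) :
    withJ v = interleave v fun i => Complex.I • v i := rfl

variable {W : Type*} [AddCommGroup W] [Module ℂ W]

theorem AlternatingMap.map_vecCons_neg {k : ℕ} (Φ : W [⋀^Fin (k + 1)]→ₗ[ℂ] ℂ) (x : W)
    (w : Fin k → W) : Φ (Matrix.vecCons (-x) w) = -Φ (Matrix.vecCons x w) := by
  rw [← neg_one_smul ℂ x, AlternatingMap.map_vecCons_smul, neg_one_smul]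

theorem AlternatingMap.map_vecCons_zero {k : ℕ} (Φ : W [⋀^Fin (k + 1)]→ₗ[ℂ] ℂ)
    (w : Fin k → W) : Φ (Matrix.vecCons 0 w) = 0 :=
  Φ.map_coord_zero (0 : Fin (k + 1)) rfl

theorem AlternatingMap.map_vecCons_self {k : ℕ} (Φ : W [⋀^Fin (k + 2)]→ₗ[ℂ] ℂ) (x : W)
    (w : Fin k → W) : Φ (Matrix.vecCons x (Matrix.vecCons x w)) = 0 :=
  Φ.map_eq_zero_of_eq (i := 0) (j := 1) _ rfl (by simp)

theorem AlternatingMap.map_vecCons_swap {k : ℕ} (Φ : W [⋀^Fin (k + 2)]→ₗ[ℂ] ℂ) (x y : W)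
    (w : Fin k → W) :
    Φ (Matrix.vecCons y (Matrix.vecCons x w)) = -Φ (Matrix.vecCons x (Matrix.vecCons y w)) := by
  have h := Φ.map_vecCons_self (x + y) w
  have h1 : ∀ a b c : W, Φ (Matrix.vecCons a (Matrix.vecCons (b + c) w)) =
      Φ (Matrix.vecCons a (Matrix.vecCons b w)) + Φ (Matrix.vecCons a (Matrix.vecCons c w)) :=
    fun a b c => (Φ.curryLeft a).map_vecCons_add w b c
  rw [AlternatingMap.map_vecCons_add, h1, h1, AlternatingMap.map_vecCons_self,
    AlternatingMap.map_vecCons_self, zero_add, add_zero] at h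
  exact eq_neg_of_add_eq_zero_right h

/-- Each pair of arguments `x + y, i x - i y` contributes `-2i x ∧ y`. -/
theorem AlternatingMap.map_interleave_add_sub (Θ : W [⋀^Fin (2 * p)]→ₗ[ℂ] ℂ) (x y : Fin p → W) :
    Θ (interleave (fun i => x i + y i) fun i => Complex.I • x i - Complex.I • y i) =
      (-2 * Complex.I) ^ p * Θ (interleave x y) := by
  induction p with
  | zero =>
    rw [pow_zero, one_mul]
    exact congrArg Θ (funext fun i => i.elim0)
  | succ p ih =>
    obtain ⟨x0, x, rfl⟩ : ∃ a u, x = Matrix.vecCons a u := ⟨x 0, fun i => x i.succ, by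
      funext i; exact Fin.cases rfl (fun _ => rfl) i⟩
    obtain ⟨y0, y, rfl⟩ : ∃ a u, y = Matrix.vecCons a u := ⟨y 0, fun i => y i.succ, by
      funext i; exact Fin.cases rfl (fun _ => rfl) i⟩
    have h1 : (fun i => Matrix.vecCons x0 x i + Matrix.vecCons y0 y i) =
        Matrix.vecCons (x0 + y0) fun i => x i + y i := by
      funext i; exact Fin.cases rfl (fun _ => rfl) i
    have h2 : (fun i => Complex.I • Matrix.vecCons x0 x i - Complex.I • Matrix.vecCons y0 y i) =
        Matrix.vecCons (Complex.I • x0 - Complex.I • y0)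
          fun i => Complex.I • x i - Complex.I • y i := by
      funext i; exact Fin.cases rfl (fun _ => rfl) i
    rw [h1, h2, interleave_cons, interleave_cons]
    set rest := interleave (fun i => x i + y i) fun i => Complex.I • x i - Complex.I • y i
    have h3 : ∀ a b : W, ∀ u, Θ (Matrix.vecCons a (Matrix.vecCons b u)) =
      (AlternatingMap.curryLeft (n := 2 * p) (AlternatingMap.curryLeft (n := 2 * p + 1) Θ a) b) u :=
        fun a b u => rfl
    have h4 := ih (AlternatingMap.curryLeft (n := 2 * p)
      (AlternatingMap.curryLeft (n := 2 * p + 1) Θ x0) y0) x y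
    rw [← h3, ← h3] at h4
    have h5 : Θ (Matrix.vecCons (x0 + y0) (Matrix.vecCons (Complex.I • x0 - Complex.I • y0) rest)) =
        -2 * Complex.I * Θ (Matrix.vecCons x0 (Matrix.vecCons y0 rest)) := by
      have ha := AlternatingMap.map_vecCons_self (k := 2 * p) Θ x0 rest
      have hb := AlternatingMap.map_vecCons_self (k := 2 * p) Θ y0 rest
      have hc := AlternatingMap.map_vecCons_swap (k := 2 * p) Θ x0 y0 rest
      simp only [h3, map_add, map_sub, map_smul, AlternatingMap.curryLeft_add,
        LinearMap.add_apply, AlternatingMap.add_apply, AlternatingMap.sub_apply,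
        AlternatingMap.smul_apply, smul_eq_mul] at ha hb hc ⊢
      linear_combination Complex.I * ha - Complex.I * hb + Complex.I * hc
    rw [h5, h4, pow_succ]
    ring

end Interleave

section Model

variable {n : ℕ}

/-- The action of `a : ℂ` on the complexification `ℂⁿ ⊕ ℂⁿ` of `ℂⁿ`: multiplication by `a` on the
first summand and by its conjugate on the second one. -/
noncomputable def biScale (n : ℕ) (a : ℂ) : (Fin n ⊕ Fin n → ℂ) →ₗ[ℂ] (Fin n ⊕ Fin n → ℂ) where
  toFun w := Sum.elim (fun i => a * w (.inl i)) fun i => starRingEnd ℂ a * w (.inr i)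
  map_add' x y := by
    funext i
    cases i <;> simp [mul_add]
  map_smul' r x := by
    funext i
    cases i <;> simp [mul_left_comm]

variable {E : Type*} [AddCommGroup E] [Module ℂ E] (crd : E ≃ₗ[ℂ] (Fin n → ℂ))

/-- The embedding `v ↦ (v, conj v)` of `ℂⁿ` into its complexification. -/
noncomputable def biEmb : E →ₗ[ℝ] (Fin n ⊕ Fin n → ℂ) where
  toFun v := Sum.elim (crd v) fun i => starRingEnd ℂ (crd v i)
  map_add' x y := by
    funext i
    cases i <;> simp
  map_smul' r x := by
    have : crd (r • x) = r • crd x := by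
      rw [← Complex.coe_smul, ← Complex.coe_smul, map_smul]
    funext i
    cases i <;> simp [this]

theorem biEmb_apply (v : E) :
    biEmb crd v = Sum.elim (crd v) fun i => starRingEnd ℂ (crd v i) := rfl

theorem biEmb_smul (a : ℂ) (v : E) : biEmb crd (a • v) = biScale n a (biEmb crd v) := by
  funext i
  cases i <;> simp [biEmb_apply, biScale]

/-- The standard basis vectors of the complexification. In comments, `l_j` stands for
`biVec (.inl j)` and `r_j` for `biVec (.inr j)`; these are the vectors dual to the `j`-th
`(1,0)`-covector and to its conjugate. -/
noncomputable def biVec (i : Fin n ⊕ Fin n) : Fin n ⊕ Fin n → ℂ := Pi.single i 1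

/-- The real basis of `E` consisting of the complex basis vectors and their multiples by `i`. -/
noncomputable def realBasis : Module.Basis (Fin n ⊕ Fin n) ℝ E :=
  .ofEquivFun
    { toFun := fun v => Sum.elim (fun i => (crd v i).re) fun i => (crd v i).im
      map_add' := fun x y => by funext i; cases i <;> simp
      map_smul' := fun r x => by
        have : crd (r • x) = r • crd x := by
          rw [← Complex.coe_smul, ← Complex.coe_smul, map_smul]
        funext i; cases i <;> simp [this]
      invFun := fun u => crd.symm fun i => ⟨u (.inl i), u (.inr i)⟩
      left_inv := fun v => by
        rw [LinearEquiv.symm_apply_eq]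
        funext i
        exact Complex.ext rfl rfl
      right_inv := fun u => by
        funext i
        cases i <;> simp }

/-- The complex basis of the complexification corresponding to `realBasis`. -/
noncomputable def biBasis (n : ℕ) : Module.Basis (Fin n ⊕ Fin n) ℂ (Fin n ⊕ Fin n → ℂ) :=
  .ofEquivFun
    { toFun := fun w => Sum.elim (fun i => (w (.inl i) + w (.inr i)) / 2)
        fun i => (w (.inl i) - w (.inr i)) / (2 * Complex.I)
      map_add' := fun x y => by funext i; cases i <;> (simp; ring)
      map_smul' := fun r x => by funext i; cases i <;> (simp; ring)
      invFun := fun u => Sum.elim (fun i => u (.inl i) + Complex.I * u (.inr i))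
        fun i => u (.inl i) - Complex.I * u (.inr i)
      left_inv := fun w => by
        funext i
        have := Complex.I_ne_zero
        cases i <;> simp <;> field_simp <;> ring
      right_inv := fun u => by
        funext i
        have := Complex.I_ne_zero
        cases i <;> simp <;> field_simp <;> ring }

theorem biEmb_realBasis (i : Fin n ⊕ Fin n) : biEmb crd (realBasis crd i) = biBasis n i := by
  have h1 : realBasis crd i = crd.symm fun l =>
      ⟨(Pi.single i 1 : Fin n ⊕ Fin n → ℝ) (.inl l),
        (Pi.single i 1 : Fin n ⊕ Fin n → ℝ) (.inr l)⟩ := by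
    rw [realBasis, Module.Basis.coe_ofEquivFun]
    rfl
  have h2 : biBasis n i = Sum.elim (fun l => (Pi.single i 1 : Fin n ⊕ Fin n → ℂ) (.inl l) +
      Complex.I * (Pi.single i 1 : Fin n ⊕ Fin n → ℂ) (.inr l))
        fun l => (Pi.single i 1 : Fin n ⊕ Fin n → ℂ) (.inl l) -
          Complex.I * (Pi.single i 1 : Fin n ⊕ Fin n → ℂ) (.inr l) := by
    rw [biBasis, Module.Basis.coe_ofEquivFun]
    rfl
  rw [h2, biEmb_apply, h1, LinearEquiv.apply_symm_apply]
  funext l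
  cases l <;> cases i <;>
    · simp only [Sum.elim_inl, Sum.elim_inr, Pi.single_apply, Sum.inl.injEq, Sum.inr.injEq,
        reduceCtorEq, if_false]
      split_ifs <;> apply Complex.ext <;> simp

/-- The vector of `E` with all coordinates zero but one, which is `1`. -/
noncomputable def crdVec (a : Fin n) : E := crd.symm (Pi.single a 1)

theorem biEmb_crdVec (a : Fin n) : biEmb crd (crdVec crd a) = biVec (.inl a) + biVec (.inr a) := by
  rw [biEmb_apply, crdVec, LinearEquiv.apply_symm_apply]
  funext l
  cases l <;> simp [biVec, Pi.single_apply, apply_ite (starRingEnd ℂ)]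

theorem biEmb_I_smul_crdVec (a : Fin n) : biEmb crd (Complex.I • crdVec crd a) =
    Complex.I • biVec (.inl a) - Complex.I • biVec (.inr a) := by
  rw [biEmb_smul, biEmb_crdVec]
  funext l
  cases l <;> simp [biVec, biScale, Pi.single_apply]

theorem linearIndependent_crdVec {p : ℕ} {g : Fin p → Fin n} (hg : Function.Injective g) :
    LinearIndependent ℂ fun i => crdVec crd (g i) := by
  have h1 : LinearIndependent ℂ fun a : Fin n => crdVec crd a := by
    have := ((Pi.basisFun ℂ (Fin n)).map crd.symm).linearIndependent
    convert this using 1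
    funext a
    simp [crdVec]
  exact h1.comp g hg

/-- The interleaved tuple of indices `inl g₀, inr g₀, inl g₁, inr g₁, …`. -/
def biIdx {p : ℕ} (g : Fin p → Fin n) : Fin (2 * p) → Fin n ⊕ Fin n :=
  interleave (fun i => .inl (g i)) fun i => .inr (g i)

theorem map_biEmb_withJ_crdVec {p : ℕ} (Θ : (Fin n ⊕ Fin n → ℂ) [⋀^Fin (2 * p)]→ₗ[ℂ] ℂ)
    (g : Fin p → Fin n) : Θ (fun i => biEmb crd (withJ (fun i => crdVec crd (g i)) i)) =
      (-2 * Complex.I) ^ p * Θ (fun i => biVec (biIdx g i)) := by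
  rw [withJ_eq_interleave, comp_interleave, biIdx, comp_interleave,
    ← AlternatingMap.map_interleave_add_sub]
  simp only [biEmb_crdVec, biEmb_I_smul_crdVec]

/-- The difference between the numbers of indices of the two kinds. -/
def biWeight {k : ℕ} (f : Fin k → Fin n ⊕ Fin n) : ℤ :=
  ∑ i, if (f i).isLeft then 1 else -1

theorem abs_biWeight_le {k : ℕ} (f : Fin k → Fin n ⊕ Fin n) : |biWeight f| ≤ k := by
  refine (Finset.abs_sum_le_sum_abs _ _).trans ?_
  refine (Finset.sum_le_card_nsmul _ _ 1 fun i _ => ?_).trans (by simp)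
  split_ifs <;> simp

theorem biScale_biVec (a : ℂ) (ha : ‖a‖ = 1) (i : Fin n ⊕ Fin n) :
    biScale n a (biVec i) = a ^ (if i.isLeft then 1 else -1 : ℤ) • biVec i := by
  have h1 : starRingEnd ℂ a = a⁻¹ := (Complex.inv_eq_conj ha).symm
  funext l
  cases i <;> cases l <;> simp [biScale, biVec, Pi.single_apply, h1]

theorem map_biScale_biVec {k : ℕ} (Φ : (Fin n ⊕ Fin n → ℂ) [⋀^Fin k]→ₗ[ℂ] ℂ)
    (f : Fin k → Fin n ⊕ Fin n) (a : ℂ) (ha : ‖a‖ = 1) :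
    Φ (fun i => biScale n a (biVec (f i))) = a ^ biWeight f * Φ fun i => biVec (f i) := by
  have ha0 : a ≠ 0 := by
    rintro rfl
    simp at ha
  simp only [biScale_biVec a ha]
  have := Φ.toMultilinearMap.map_smul_univ
    (fun i => a ^ (if (f i).isLeft then 1 else -1 : ℤ)) (fun i => biVec (f i))
  refine this.trans ?_
  rw [biWeight, smul_eq_mul]
  congr 1
  induction (Finset.univ : Finset (Fin k)) using Finset.cons_induction with
  | empty => simp
  | cons i s hi ih => rw [Finset.prod_cons, Finset.sum_cons, zpow_add₀ ha0, ih]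

theorem typeProj_apply_biVec {k : ℕ} (Φ : (Fin n ⊕ Fin n → ℂ) [⋀^Fin k]→ₗ[ℂ] ℂ)
    (f : Fin k → Fin n ⊕ Fin n) (p q : ℕ) :
    typeProj (biScale n) p q Φ (fun i => biVec (f i)) =
      if p + q = k ∧ (p : ℤ) - q = biWeight f then Φ fun i => biVec (f i) else 0 :=
  typeProj_apply_of_weight (abs_biWeight_le f) (map_biScale_biVec Φ f) p q

variable (cW : (Fin n ⊕ Fin n → ℂ) →ₗ[ℂ] (Fin n ⊕ Fin n → ℂ) →ₗ[ℂ] (Fin n ⊕ Fin n → ℂ))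

theorem AlternatingMap.finset_sum_apply {ι V : Type*} [AddCommGroup V] [Module ℂ V] {k : ℕ}
    (s : Finset ι) (g : ι → V [⋀^Fin k]→ₗ[ℂ] ℂ) (w : Fin k → V) :
    (∑ j ∈ s, g j) w = ∑ j ∈ s, g j w :=
  map_sum ({ toFun := fun f => f w, map_zero' := rfl, map_add' := fun _ _ => rfl } :
    (V [⋀^Fin k]→ₗ[ℂ] ℂ) →+ ℂ) g s

theorem ceDel_apply_biVec {p q k : ℕ} (hpq : p + q = k)
    (Φ : (Fin n ⊕ Fin n → ℂ) [⋀^Fin k]→ₗ[ℂ] ℂ) (f : Fin (k + 1) → Fin n ⊕ Fin n)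
    (hf : biWeight f = p + 1 - q) :
    ceDel (biScale n) cW Φ (fun i => biVec (f i)) =
      ceDiff cW (typeProj (biScale n) p q Φ) fun i => biVec (f i) := by
  rw [ceDel, AlternatingMap.finset_sum_apply, Finset.sum_eq_single (p, q)]
  · rw [typeProj_apply_biVec, if_pos]
    constructor
    · simp only; omega
    · rw [hf]; push_cast; ring
  · rintro ⟨a, b⟩ hab hne
    rw [Finset.HasAntidiagonal.mem_antidiagonal] at hab
    rw [typeProj_apply_biVec, if_neg]
    rintro ⟨-, h⟩
    rw [hf] at h
    push_cast at h
    simp only at hab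
    exact hne (Prod.ext (by simp only; omega) (by simp only; omega))
  · intro h
    exact absurd (Finset.HasAntidiagonal.mem_antidiagonal.2 hpq) h

theorem ceDelBar_apply_biVec {p q k : ℕ} (hpq : p + q = k)
    (Φ : (Fin n ⊕ Fin n → ℂ) [⋀^Fin k]→ₗ[ℂ] ℂ) (f : Fin (k + 1) → Fin n ⊕ Fin n)
    (hf : biWeight f = p - (q + 1)) :
    ceDelBar (biScale n) cW Φ (fun i => biVec (f i)) =
      ceDiff cW (typeProj (biScale n) p q Φ) fun i => biVec (f i) := by
  rw [ceDelBar, AlternatingMap.finset_sum_apply, Finset.sum_eq_single (p, q)]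
  · rw [typeProj_apply_biVec, if_pos]
    constructor
    · simp only; omega
    · rw [hf]; push_cast; ring
  · rintro ⟨a, b⟩ hab hne
    rw [Finset.HasAntidiagonal.mem_antidiagonal] at hab
    rw [typeProj_apply_biVec, if_neg]
    rintro ⟨-, h⟩
    rw [hf] at h
    push_cast at h
    simp only at hab
    exact hne (Prod.ext (by simp only; omega) (by simp only; omega))
  · intro h
    exact absurd (Finset.HasAntidiagonal.mem_antidiagonal.2 hpq) h

end Model

/-! ### The structure constants -/

section Structure

/-- The triples `(a, b, e)` of indices such that `e` occurs in the product of `a` and `b`. -/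
def scIdx : Fin 10 → (Fin 8 ⊕ Fin 8) × (Fin 8 ⊕ Fin 8) × (Fin 8 ⊕ Fin 8) :=
  ![(.inl 0, .inl 1, .inl 2), (.inr 0, .inr 1, .inr 2), (.inr 0, .inl 0, .inl 2),
    (.inl 0, .inr 0, .inr 2), (.inr 1, .inl 1, .inl 2), (.inl 1, .inr 1, .inr 2),
    (.inl 4, .inl 3, .inl 7), (.inr 4, .inr 3, .inr 7), (.inl 6, .inl 5, .inl 7),
    (.inr 6, .inr 5, .inr 7)]

/-- The coefficients belonging to the triples in `scIdx`. -/
noncomputable def scCoef : Fin 10 → ℂ :=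
  ![-1, -1, Complex.I / 2, -(Complex.I / 2), Complex.I, -Complex.I, 1, 1, 1, 1]

/-- The complexification of the bilinear map defining the group law of the universal covering. The
coordinates `0, 1, 2` are those of the first factor, and `X, Y, z` have the coordinates `3, 5`, the
coordinates `4, 6` and the coordinate `7`. -/
noncomputable def structBilin :
    (Fin 8 ⊕ Fin 8 → ℂ) →ₗ[ℂ] (Fin 8 ⊕ Fin 8 → ℂ) →ₗ[ℂ] (Fin 8 ⊕ Fin 8 → ℂ) :=
  LinearMap.mk₂ ℂ
    (fun x y => ∑ t, (scCoef t * x (scIdx t).1 * y (scIdx t).2.1) • biVec (scIdx t).2.2)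
    (fun x x' y => by
      rw [← Finset.sum_add_distrib]
      refine Finset.sum_congr rfl fun t _ => ?_
      rw [← add_smul, Pi.add_apply]
      ring_nf)
    (fun r x y => by
      rw [Finset.smul_sum]
      refine Finset.sum_congr rfl fun t _ => ?_
      rw [smul_smul, Pi.smul_apply, smul_eq_mul]
      ring_nf)
    (fun x y y' => by
      rw [← Finset.sum_add_distrib]
      refine Finset.sum_congr rfl fun t _ => ?_
      rw [← add_smul, Pi.add_apply]
      ring_nf)
    (fun r x y => by
      rw [Finset.smul_sum]
      refine Finset.sum_congr rfl fun t _ => ?_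
      rw [smul_smul, Pi.smul_apply, smul_eq_mul]
      ring_nf)

theorem structBilin_apply (x y : Fin 8 ⊕ Fin 8 → ℂ) : structBilin x y =
    ∑ t, (scCoef t * x (scIdx t).1 * y (scIdx t).2.1) • biVec (scIdx t).2.2 := rfl

theorem structBilin_biVec (a b : Fin 8 ⊕ Fin 8) : structBilin (biVec a) (biVec b) =
    ∑ t, (if (scIdx t).1 = a ∧ (scIdx t).2.1 = b then scCoef t else 0) • biVec (scIdx t).2.2 := by
  rw [structBilin_apply]
  refine Finset.sum_congr rfl fun t _ => ?_
  congr 1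
  simp only [biVec, Pi.single_apply]
  by_cases h1 : (scIdx t).1 = a <;> by_cases h2 : (scIdx t).2.1 = b <;> simp [h1, h2]

/-- The two basis vectors have product zero under `structBilin` in either order. -/
def Commute₀ (a b : Fin 8 ⊕ Fin 8) : Prop :=
  ∀ t, ¬((scIdx t).1 = a ∧ (scIdx t).2.1 = b) ∧ ¬((scIdx t).1 = b ∧ (scIdx t).2.1 = a)

instance (a b : Fin 8 ⊕ Fin 8) : Decidable (Commute₀ a b) := by
  unfold Commute₀; infer_instance

theorem Commute₀.bracket_eq_zero {a b : Fin 8 ⊕ Fin 8} (h : Commute₀ a b) :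
    bracket structBilin (biVec a) (biVec b) = 0 := by
  rw [bracket_apply, structBilin_biVec, structBilin_biVec, Finset.sum_eq_zero, Finset.sum_eq_zero,
    sub_zero]
  · intro t _
    rw [if_neg (h t).2, zero_smul]
  · intro t _
    rw [if_neg (h t).1, zero_smul]

theorem bracket_biVec_eq (a b : Fin 8 ⊕ Fin 8) : bracket structBilin (biVec a) (biVec b) =
    ∑ t, ((if (scIdx t).1 = a ∧ (scIdx t).2.1 = b then scCoef t else 0) -
      if (scIdx t).1 = b ∧ (scIdx t).2.1 = a then scCoef t else 0) • biVec (scIdx t).2.2 := by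
  rw [bracket_apply, structBilin_biVec, structBilin_biVec, ← Finset.sum_sub_distrib]
  simp only [sub_smul]

theorem bracket_l0_l1 : bracket structBilin (biVec (.inl 0)) (biVec (.inl 1)) =
    -biVec (.inl 2) := by
  rw [bracket_biVec_eq]
  simp [Fin.sum_univ_succ, scIdx, scCoef]

theorem bracket_r0_r1 : bracket structBilin (biVec (.inr 0)) (biVec (.inr 1)) =
    -biVec (.inr 2) := by
  rw [bracket_biVec_eq]
  simp [Fin.sum_univ_succ, scIdx, scCoef]

theorem bracket_l0_r0 : bracket structBilin (biVec (.inl 0)) (biVec (.inr 0)) =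
    -(Complex.I / 2) • (biVec (.inl 2) + biVec (.inr 2)) := by
  rw [bracket_biVec_eq]
  simp [Fin.sum_univ_succ, scIdx, scCoef]

theorem bracket_l1_r1 : bracket structBilin (biVec (.inl 1)) (biVec (.inr 1)) =
    -Complex.I • (biVec (.inl 2) + biVec (.inr 2)) := by
  rw [bracket_biVec_eq]
  simp [Fin.sum_univ_succ, scIdx, scCoef]

theorem bracket_l3_l4 : bracket structBilin (biVec (.inl 3)) (biVec (.inl 4)) =
    -biVec (.inl 7) := by
  rw [bracket_biVec_eq]
  simp [Fin.sum_univ_succ, scIdx, scCoef]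

theorem bracket_r3_r4 : bracket structBilin (biVec (.inr 3)) (biVec (.inr 4)) =
    -biVec (.inr 7) := by
  rw [bracket_biVec_eq]
  simp [Fin.sum_univ_succ, scIdx, scCoef]

theorem bracket_l5_l6 : bracket structBilin (biVec (.inl 5)) (biVec (.inl 6)) =
    -biVec (.inl 7) := by
  rw [bracket_biVec_eq]
  simp [Fin.sum_univ_succ, scIdx, scCoef]

theorem bracket_r5_r6 : bracket structBilin (biVec (.inr 5)) (biVec (.inr 6)) =
    -biVec (.inr 7) := by
  rw [bracket_biVec_eq]
  simp [Fin.sum_univ_succ, scIdx, scCoef]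

/-- The set of these indices contains `e` for every triple `(a, b, e)` in `scIdx` with `a` and `b`
in it, so that the span of the corresponding basis vectors is closed under `structBilin`. -/
def IsClosedTuple {k : ℕ} (f : Fin k → Fin 8 ⊕ Fin 8) : Prop :=
  ∀ t i, f i = (scIdx t).1 → ∀ j, f j = (scIdx t).2.1 → ∃ m, f m = (scIdx t).2.2

instance {k : ℕ} (f : Fin k → Fin 8 ⊕ Fin 8) : Decidable (IsClosedTuple f) := by
  unfold IsClosedTuple; infer_instance

theorem IsClosedTuple.ceDiff_eq_zero {k : ℕ} {f : Fin (k + 1) → Fin 8 ⊕ Fin 8}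
    (hf : IsClosedTuple f) (Φ : (Fin 8 ⊕ Fin 8 → ℂ) [⋀^Fin k]→ₗ[ℂ] ℂ) :
    ceDiff structBilin Φ (fun i => biVec (f i)) = 0 := by
  refine ceDiff_eq_zero_of_forall_mem_span _ _ _ fun i j hij => ?_
  rw [structBilin_biVec]
  refine Submodule.sum_mem _ fun t _ => ?_
  split_ifs with h
  · obtain ⟨m, hm⟩ := hf t i h.1.symm j h.2.symm
    have h1 : ∀ t, (scIdx t).2.2 ≠ (scIdx t).1 ∧ (scIdx t).2.2 ≠ (scIdx t).2.1 := by decide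
    refine Submodule.smul_mem _ _ (Submodule.subset_span ⟨m, ?_, congrArg biVec hm⟩)
    rintro (rfl | rfl)
    · exact (h1 t).1 (hm.symm.trans h.1.symm)
    · exact (h1 t).2 (hm.symm.trans h.2.symm)
  · rw [zero_smul]
    exact zero_mem _

theorem vecCons_biVec {n k : ℕ} (x : Fin n ⊕ Fin n) (g : Fin k → Fin n ⊕ Fin n) :
    (fun i => (biVec (Matrix.vecCons x g i) : Fin n ⊕ Fin n → ℂ)) =
      Matrix.vecCons (biVec x) fun i => biVec (g i) := by
  funext i
  exact Fin.cases rfl (fun _ => rfl) i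

theorem ceDiff_cons_biVec_of_forall {k : ℕ} (Φ : (Fin 8 ⊕ Fin 8 → ℂ) [⋀^Fin (k + 1)]→ₗ[ℂ] ℂ)
    (a b : Fin 8 ⊕ Fin 8) (f : Fin k → Fin 8 ⊕ Fin 8)
    (h : ∀ j, Φ (Matrix.vecCons (biVec b) (Function.update (fun i => biVec (f i)) j
      (bracket structBilin (biVec a) (biVec (f j))))) = 0) :
    ceDiff structBilin Φ (fun i => biVec (Matrix.vecCons a (Matrix.vecCons b f) i)) =
      -Φ (Matrix.vecCons (bracket structBilin (biVec a) (biVec b)) fun i => biVec (f i)) -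
        ceDiff structBilin (Φ.curryLeft (biVec a)) fun i => biVec (Matrix.vecCons b f i) := by
  have h1 := DFunLike.congr_fun (curryLeft_ceDiff structBilin Φ (biVec a))
    (fun i => biVec (Matrix.vecCons b f i))
  rw [AlternatingMap.curryLeft_apply_apply, ← vecCons_biVec] at h1
  rw [h1, AlternatingMap.sub_apply, AlternatingMap.neg_apply, lieAct_apply, Fin.sum_univ_succ,
    Finset.sum_eq_zero, add_zero]
  · rw [vecCons_biVec, vecCons_update_zero]
    rfl
  · intro j _
    rw [vecCons_biVec, vecCons_update_succ]
    exact h j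

/-- The differential on a tuple whose first vector commutes with all but the second one. -/
theorem ceDiff_cons_biVec {k : ℕ} (Φ : (Fin 8 ⊕ Fin 8 → ℂ) [⋀^Fin (k + 1)]→ₗ[ℂ] ℂ)
    (a b : Fin 8 ⊕ Fin 8) (f : Fin k → Fin 8 ⊕ Fin 8) (h : ∀ j, Commute₀ a (f j)) :
    ceDiff structBilin Φ (fun i => biVec (Matrix.vecCons a (Matrix.vecCons b f) i)) =
      -Φ (Matrix.vecCons (bracket structBilin (biVec a) (biVec b)) fun i => biVec (f i)) -
        ceDiff structBilin (Φ.curryLeft (biVec a)) fun i => biVec (Matrix.vecCons b f i) := by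
  refine ceDiff_cons_biVec_of_forall Φ a b f fun j => ?_
  rw [(h j).bracket_eq_zero, ← vecCons_update_succ]
  exact Φ.map_update_zero _ _

theorem biWeight_cons {n k : ℕ} (a : Fin n ⊕ Fin n) (f : Fin k → Fin n ⊕ Fin n) :
    biWeight (Matrix.vecCons a f) = (if a.isLeft then 1 else -1) + biWeight f := by
  rw [biWeight, Fin.sum_univ_succ]
  rfl

theorem biIdx_cons {n p : ℕ} (a : Fin n) (g : Fin p → Fin n) :
    biIdx (Matrix.vecCons a g) =
      (Matrix.vecCons (.inl a) (Matrix.vecCons (.inr a) (biIdx g)) :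
        Fin (2 * p + 2) → Fin n ⊕ Fin n) := by
  rw [biIdx, biIdx, ← interleave_cons]
  congr 1 <;>
  · funext i
    exact Fin.cases rfl (fun _ => rfl) i

theorem biWeight_biIdx {n p : ℕ} (g : Fin p → Fin n) : biWeight (biIdx g) = 0 := by
  induction p with
  | zero => rfl
  | succ p ih =>
    obtain ⟨a, g, rfl⟩ : ∃ a u, g = Matrix.vecCons a u := ⟨g 0, fun i => g i.succ, by
      funext i; exact Fin.cases rfl (fun _ => rfl) i⟩
    rw [biIdx_cons]
    refine (biWeight_cons (k := 2 * p + 1) (.inl a) _).trans ?_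
    rw [biWeight_cons (k := 2 * p) (.inr a), ih]
    rfl

end Structure

/-! ### Diagonal coefficients which closedness forces to vanish -/

section Obstruction

/-- An initial segment of the sequence `4, 2, 1, 0`. It avoids `5` and `6`, so that `l₅`, `l₆` and
their conjugates commute with the vectors it indexes, and it avoids `3`, as `[l₃, l₄] = -l₇`. -/
def obsIdx (m : ℕ) : Fin m → Fin 8 := fun i =>
  if i.val = 0 then 4 else if i.val = 1 then 2 else if i.val = 2 then 1 else 0

variable {m : ℕ}

/-- The tuple `l₅, l₆, r₇, l₄, r₄, l₂, r₂, …`. As `[l₅, l₆] = -l₇`, and as the other brackets lie in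
the span of the vectors not bracketed, the differential of a form takes on it the value of the form
on `l₇, r₇, l₄, r₄, l₂, r₂, …`. -/
def obsTuple (m : ℕ) : Fin (2 * m + 3) → Fin 8 ⊕ Fin 8 :=
  Matrix.vecCons (.inl 5) (Matrix.vecCons (.inl 6) (Matrix.vecCons (.inr 7) (biIdx (obsIdx m))))

theorem ceDiff_obsTuple (hm : m ≤ 4) (Φ : (Fin 8 ⊕ Fin 8 → ℂ) [⋀^Fin (2 * m + 2)]→ₗ[ℂ] ℂ) :
    ceDiff structBilin Φ (fun i => biVec (obsTuple m i)) =
      Φ fun i => biVec (biIdx (Matrix.vecCons 7 (obsIdx m)) i) := by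
  have h1 : IsClosedTuple
      (Matrix.vecCons (.inl 6) (Matrix.vecCons (.inr 7) (biIdx (obsIdx m)))) := by
    interval_cases m <;> decide
  have h2 : ∀ j, Commute₀ (.inl 5) (Matrix.vecCons (.inr 7) (biIdx (obsIdx m)) j) := by
    interval_cases m <;> decide
  rw [obsTuple, ceDiff_cons_biVec Φ _ _ _ h2, h1.ceDiff_eq_zero, bracket_l5_l6, sub_zero]
  have h3 := Φ.map_update_neg
    (Matrix.vecCons (biVec (.inl 7)) fun i => biVec (Matrix.vecCons (.inr 7) (biIdx (obsIdx m)) i))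
    0 (biVec (.inl 7))
  rw [vecCons_update_zero, vecCons_update_zero] at h3
  rw [h3, neg_neg, ← vecCons_biVec]
  exact congrArg Φ (funext fun i => by rw [biIdx_cons])

theorem typeProj_ceDelBar_biIdx (α : (Fin 8 ⊕ Fin 8 → ℂ) [⋀^Fin (2 * m + 1)]→ₗ[ℂ] ℂ)
    (g : Fin (m + 1) → Fin 8) (hg : IsClosedTuple (biIdx g)) :
    typeProj (biScale 8) (m + 1) (m + 1) (ceDelBar (biScale 8) structBilin α)
      (fun i => biVec (biIdx g i)) = 0 := by
  rw [typeProj_apply_biVec]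
  split_ifs
  · have h1 := ceDelBar_apply_biVec structBilin (p := m + 1) (q := m) (by ring) α (biIdx g)
      (by rw [biWeight_biIdx]; push_cast; ring)
    exact h1.trans (hg.ceDiff_eq_zero _)
  · rfl

theorem ceDiff_eq_of_ceDel_eq {Φ : (Fin 8 ⊕ Fin 8 → ℂ) [⋀^Fin (2 * m + 2)]→ₗ[ℂ] ℂ}
    (hΦ : typeProj (biScale 8) (m + 1) (m + 1) Φ = Φ)
    {β : (Fin 8 ⊕ Fin 8 → ℂ) [⋀^Fin (2 * m + 2)]→ₗ[ℂ] ℂ}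
    (h : ceDel (biScale 8) structBilin Φ = ceDel (biScale 8) structBilin β)
    {T : Fin (2 * m + 3) → Fin 8 ⊕ Fin 8} (hT : biWeight T = 1) :
    ceDiff structBilin Φ (fun i => biVec (T i)) =
      ceDiff structBilin (typeProj (biScale 8) (m + 1) (m + 1) β) fun i => biVec (T i) := by
  have h1 : biWeight T = ((m + 1 : ℕ) : ℤ) + 1 - ((m + 1 : ℕ) : ℤ) := by rw [hT]; ring
  rw [← ceDel_apply_biVec structBilin (by ring) β T h1, ← h,
    ceDel_apply_biVec structBilin (by ring) Φ T h1, hΦ]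

/-- If `d` of a form of type `(p,p)` on a tuple of basis vectors is given by values on tuples closed
under multiplication, then this combination of values vanishes on a form `Φ` with `∂Φ = ∂∂̄α`, since
`∂̄α`, on such a tuple, is a value of a differential and vanishes. -/
theorem detect_eq_zero {Φ : (Fin 8 ⊕ Fin 8 → ℂ) [⋀^Fin (2 * m + 2)]→ₗ[ℂ] ℂ}
    (hΦ : typeProj (biScale 8) (m + 1) (m + 1) Φ = Φ)
    {α : (Fin 8 ⊕ Fin 8 → ℂ) [⋀^Fin (2 * m + 1)]→ₗ[ℂ] ℂ}
    (h : ceDel (biScale 8) structBilin Φ =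
      ceDel (biScale 8) structBilin (ceDelBar (biScale 8) structBilin α))
    (T : Fin (2 * m + 3) → Fin 8 ⊕ Fin 8) (hT : biWeight T = 1) (g g' : Fin (m + 1) → Fin 8)
    (hg : IsClosedTuple (biIdx g)) (hg' : IsClosedTuple (biIdx g')) (a b : ℂ)
    (hd : ∀ Ψ : (Fin 8 ⊕ Fin 8 → ℂ) [⋀^Fin (2 * m + 2)]→ₗ[ℂ] ℂ,
      (∀ f, biWeight f ≠ 0 → Ψ (fun i => biVec (f i)) = 0) →
        ceDiff structBilin Ψ (fun i => biVec (T i)) =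
          a * Ψ (fun i => biVec (biIdx g i)) + b * Ψ (fun i => biVec (biIdx g' i))) :
    a * Φ (fun i => biVec (biIdx g i)) + b * Φ (fun i => biVec (biIdx g' i)) = 0 := by
  have hw : ∀ (Ψ : (Fin 8 ⊕ Fin 8 → ℂ) [⋀^Fin (2 * m + 2)]→ₗ[ℂ] ℂ) (f), biWeight f ≠ 0 →
      typeProj (biScale 8) (m + 1) (m + 1) Ψ (fun i => biVec (f i)) = 0 := by
    intro Ψ f hf
    rw [typeProj_apply_biVec, if_neg]
    rintro ⟨-, h⟩
    exact hf (by rw [← h, sub_self])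
  have h1 := ceDiff_eq_of_ceDel_eq hΦ h hT
  rw [hd Φ fun f hf => by rw [← hΦ]; exact hw Φ f hf, hd _ (hw _),
    typeProj_ceDelBar_biIdx α g hg, typeProj_ceDelBar_biIdx α g' hg', mul_zero, mul_zero,
    add_zero] at h1
  exact h1

theorem biWeight_obsTuple (m : ℕ) : biWeight (obsTuple m) = 1 := by
  rw [obsTuple, biWeight_cons, biWeight_cons, biWeight_cons, biWeight_biIdx]
  rfl

/-- A form `Φ` of type `(s,s)`, `s = m + 1 ≤ 5`, with `∂Φ = ∂∂̄α` vanishes on a tuple on which a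
transverse form is nonzero. -/
theorem map_obsIdx_eq_zero_of_ceDel_eq (hm : m ≤ 4)
    {Φ : (Fin 8 ⊕ Fin 8 → ℂ) [⋀^Fin (2 * m + 2)]→ₗ[ℂ] ℂ}
    (hΦ : typeProj (biScale 8) (m + 1) (m + 1) Φ = Φ)
    {α : (Fin 8 ⊕ Fin 8 → ℂ) [⋀^Fin (2 * m + 1)]→ₗ[ℂ] ℂ}
    (h : ceDel (biScale 8) structBilin Φ =
      ceDel (biScale 8) structBilin (ceDelBar (biScale 8) structBilin α)) :
    Φ (fun i => biVec (biIdx (Matrix.vecCons 7 (obsIdx m)) i)) = 0 := by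
  have hg : IsClosedTuple (biIdx (Matrix.vecCons 7 (obsIdx m))) := by interval_cases m <;> decide
  have h1 := detect_eq_zero hΦ h (obsTuple m) (biWeight_obsTuple m) _ _ hg hg 1 0
    fun Ψ _ => (ceDiff_obsTuple hm Ψ).trans (by rw [one_mul, zero_mul, add_zero])
  simpa using h1

/-- A form `Φ` of type `(s,s)`, `s = m + 1 ≤ 5`, with `∂∂̄Φ = 0` vanishes on a tuple on which a
transverse form is nonzero: by `[l₅, l₆] = -l₇` and `[r₅, r₆] = -r₇`, the value of `∂∂̄Φ` on
`l₅, l₆, r₅, r₆, l₄, r₄, …` is that of `∂̄Φ` on `l₇, r₅, r₆, l₄, r₄, …`, and this is, up to sign,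
that of `Φ` on `l₇, r₇, l₄, r₄, …`. -/
theorem map_obsIdx_eq_zero_of_ceDel_ceDelBar (hm : m ≤ 4)
    {Φ : (Fin 8 ⊕ Fin 8 → ℂ) [⋀^Fin (2 * m + 2)]→ₗ[ℂ] ℂ}
    (hΦ : typeProj (biScale 8) (m + 1) (m + 1) Φ = Φ)
    (h : ceDel (biScale 8) structBilin (ceDelBar (biScale 8) structBilin Φ) = 0) :
    Φ (fun i => biVec (biIdx (Matrix.vecCons 7 (obsIdx m)) i)) = 0 := by
  set R := biIdx (obsIdx m) with hR
  set β := ceDelBar (biScale 8) structBilin Φ with hβ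
  set β' := typeProj (biScale 8) (m + 1) (m + 2) β with hβ'
  let T₃ : Fin (2 * m + 2) → Fin 8 ⊕ Fin 8 := Matrix.vecCons (.inr 5) (Matrix.vecCons (.inr 6) R)
  let T : Fin (2 * m + 4) → Fin 8 ⊕ Fin 8 :=
    Matrix.vecCons (.inl 5) (Matrix.vecCons (.inl 6) T₃)
  have hT : biWeight T = 0 := by
    rw [biWeight_cons, biWeight_cons, biWeight_cons, biWeight_cons, hR, biWeight_biIdx]
    rfl
  have h1 : ceDiff structBilin β' (fun i => biVec (T i)) = 0 := by
    rw [hβ', ← ceDel_apply_biVec structBilin (by ring) β T (by rw [hT]; push_cast; ring), h]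
    rfl
  -- the differential of `β'` on `T` has two terms, of which one vanishes for reasons of type
  have c1 : ∀ j, Commute₀ (.inl 5) (T₃ j) := by interval_cases m <;> decide
  have c2 : ∀ j, Commute₀ (.inl 6) (Matrix.vecCons (.inr 6) R j) := by interval_cases m <;> decide
  have c2' : Commute₀ (.inl 6) (.inr 5) := by decide
  have c3 : ∀ j, Commute₀ (.inr 5) (R j) := by interval_cases m <;> decide
  have k3 : IsClosedTuple (Matrix.vecCons (.inr 6) R) := by interval_cases m <;> decide
  have h2 : ceDiff structBilin ((β'.curryLeft (biVec (.inl 5))).curryLeft (biVec (.inl 6)))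
      (fun i => biVec (T₃ i)) = 0 := by
    rw [ceDiff_cons_biVec _ _ _ _ c3, k3.ceDiff_eq_zero, bracket_r5_r6, sub_zero, neg_eq_zero]
    have h3 : β' (fun i => biVec (Matrix.vecCons (.inl 5) (Matrix.vecCons (.inl 6)
        (Matrix.vecCons (.inr 7) R)) i)) = 0 := by
      rw [hβ', typeProj_apply_biVec, if_neg]
      rw [biWeight_cons, biWeight_cons, biWeight_cons, hR, biWeight_biIdx]
      rintro ⟨-, h⟩
      push_cast at h
      simp at h
    rw [vecCons_biVec, vecCons_biVec, vecCons_biVec] at h3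
    have h4 := ((β'.curryLeft (biVec (.inl 5))).curryLeft (biVec (.inl 6))).map_update_neg
      (Matrix.vecCons (biVec (.inr 7)) fun i => biVec (R i)) 0 (biVec (.inr 7))
    rw [vecCons_update_zero, vecCons_update_zero] at h4
    rw [h4, neg_eq_zero]
    exact h3
  have h5 : β' (fun i => biVec (Matrix.vecCons (.inl 7) T₃ i)) = 0 := by
    rw [ceDiff_cons_biVec β' _ _ _ c1, ceDiff_cons_biVec _ _ _ _ c2, h2, c2'.bracket_eq_zero,
      bracket_l5_l6] at h1
    have h4 := β'.map_update_neg
      (Matrix.vecCons (biVec (.inl 7)) fun i => biVec (T₃ i)) 0 (biVec (.inl 7))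
    rw [vecCons_update_zero, vecCons_update_zero] at h4
    have h6 := (β'.curryLeft (biVec (.inl 5))).map_update_zero
      (Matrix.vecCons (biVec (.inl 7)) fun i => biVec (Matrix.vecCons (.inr 6) R i)) 0
    rw [vecCons_update_zero] at h6
    rw [h4, h6, ← vecCons_biVec] at h1
    simpa using h1
  -- evaluate `β'` as a differential
  have h7 : ceDiff structBilin Φ (fun i => biVec (Matrix.vecCons (.inl 7) T₃ i)) = 0 := by
    have hw : biWeight (Matrix.vecCons (.inl 7) T₃) = -1 := by
      rw [biWeight_cons, biWeight_cons, biWeight_cons, hR, biWeight_biIdx]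
      rfl
    rw [hβ', typeProj_apply_biVec, if_pos ⟨by ring, by rw [hw]; push_cast; ring⟩, hβ,
      ceDelBar_apply_biVec structBilin (p := m + 1) (q := m + 1) (by ring) Φ _
        (by rw [hw]; push_cast; ring), hΦ] at h5
    exact h5
  have c4 : ∀ j, Commute₀ (.inl 7) (Matrix.vecCons (.inr 6) R j) := by
    interval_cases m <;> decide
  have c4' : Commute₀ (.inl 7) (.inr 5) := by decide
  rw [ceDiff_cons_biVec Φ _ _ _ c4, ceDiff_cons_biVec _ _ _ _ c3, k3.ceDiff_eq_zero,
    c4'.bracket_eq_zero, bracket_r5_r6] at h7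
  have h4 := (Φ.curryLeft (biVec (.inl 7))).map_update_neg
    (Matrix.vecCons (biVec (.inr 7)) fun i => biVec (R i)) 0 (biVec (.inr 7))
  rw [vecCons_update_zero, vecCons_update_zero] at h4
  have h6 := Φ.map_update_zero
    (Matrix.vecCons (biVec (.inl 7)) fun i => biVec (Matrix.vecCons (.inr 6) R i)) 0
  rw [vecCons_update_zero] at h6
  rw [h4, h6, AlternatingMap.curryLeft_apply_apply, ← vecCons_biVec, ← vecCons_biVec] at h7
  rw [biIdx_cons]
  simpa using h7

/-- The tuple `l₁, r₁, l₂, l₃, r₃, …, l₇, r₇`. As `[l₁, r₁] = -i (l₂ + r₂)`, the differential of a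
form takes on it `-i` times the value of the form on `l₂, r₂, …, l₇, r₇`. -/
def obsTuple₆ : Fin (2 * 5 + 3) → Fin 8 ⊕ Fin 8 :=
  Matrix.vecCons (.inl 1) (Matrix.vecCons (.inr 1) (Matrix.vecCons (.inl 2)
    (biIdx (![3, 4, 5, 6, 7] : Fin 5 → Fin 8))))

theorem ceDiff_obsTuple₆ (Φ : (Fin 8 ⊕ Fin 8 → ℂ) [⋀^Fin (2 * 5 + 2)]→ₗ[ℂ] ℂ) :
    ceDiff structBilin Φ (fun i => biVec (obsTuple₆ i)) =
      -Complex.I * Φ fun i => biVec (biIdx (![2, 3, 4, 5, 6, 7] : Fin (5 + 1) → Fin 8) i) := by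
  have h1 : IsClosedTuple (Matrix.vecCons (.inr 1) (Matrix.vecCons (.inl 2)
      (biIdx (![3, 4, 5, 6, 7] : Fin 5 → Fin 8)))) := by decide
  have h2 : ∀ j, Commute₀ (.inl 1) (Matrix.vecCons (.inl 2)
      (biIdx (![3, 4, 5, 6, 7] : Fin 5 → Fin 8)) j) := by decide
  rw [obsTuple₆, ceDiff_cons_biVec (k := 11) Φ _ _ _ h2, h1.ceDiff_eq_zero, bracket_l1_r1, sub_zero,
    AlternatingMap.map_vecCons_smul, AlternatingMap.map_vecCons_add, vecCons_biVec,
    AlternatingMap.map_vecCons_self, AlternatingMap.map_vecCons_swap, ← vecCons_biVec,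
    ← vecCons_biVec, biIdx_cons (p := 5), smul_eq_mul]
  ring

/-- The tuple `l₀, r₀, l₁, r₁, l₂, l₃, r₃, …, l₇, r₇`. As `[l₀, r₀]` and `[l₁, r₁]` are multiples of
`l₂ + r₂` with coefficients of the same sign, the differential of a form of type `(7,7)` takes on it
a positive combination, up to a constant factor, of two diagonal coefficients. The bracket
`[l₀, l₁]` contributes nothing as `l₂` occurs in the tuple, and `[r₀, r₁]` nothing for reasons of
type. -/
def obsTuple₇ : Fin (2 * 6 + 3) → Fin 8 ⊕ Fin 8 :=
  Matrix.vecCons (.inl 0) (Matrix.vecCons (.inr 0) (Matrix.vecCons (.inl 1)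
    (Matrix.vecCons (.inr 1) (Matrix.vecCons (.inl 2)
      (biIdx (![3, 4, 5, 6, 7] : Fin 5 → Fin 8))))))

theorem ceDiff_obsTuple₇ {Φ : (Fin 8 ⊕ Fin 8 → ℂ) [⋀^Fin (2 * 6 + 2)]→ₗ[ℂ] ℂ}
    (hΦ : ∀ f, biWeight f ≠ 0 → Φ (fun i => biVec (f i)) = 0) :
    ceDiff structBilin Φ (fun i => biVec (obsTuple₇ i)) =
      -(Complex.I / 2) *
          Φ (fun i => biVec (biIdx (![1, 2, 3, 4, 5, 6, 7] : Fin (6 + 1) → Fin 8) i)) -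
        Complex.I *
          Φ (fun i => biVec (biIdx (![0, 2, 3, 4, 5, 6, 7] : Fin (6 + 1) → Fin 8) i)) := by
  set R : Fin 10 → Fin 8 ⊕ Fin 8 := biIdx (![3, 4, 5, 6, 7] : Fin 5 → Fin 8) with hR
  have hw : biWeight R = 0 := biWeight_biIdx _
  have c0 : ∀ j : Fin 12, Commute₀ (.inl 0)
      (Matrix.vecCons (.inr 1) (Matrix.vecCons (.inl 2) R) j) := by decide
  have c1 : ∀ j : Fin 11, Commute₀ (.inr 0) (Matrix.vecCons (.inl 2) R j) := by decide
  have c1' : Commute₀ (.inr 0) (.inl 1) := by decide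
  have c2 : ∀ j : Fin 11, Commute₀ (.inl 1) (Matrix.vecCons (.inl 2) R j) := by decide
  have k : IsClosedTuple (Matrix.vecCons (.inr 1) (Matrix.vecCons (.inl 2) R)) := by decide
  have e1 : biIdx (![1, 2, 3, 4, 5, 6, 7] : Fin (6 + 1) → Fin 8) = Matrix.vecCons (.inl 1)
      (Matrix.vecCons (.inr 1) (Matrix.vecCons (.inl 2) (Matrix.vecCons (.inr 2) R))) := by
    rw [biIdx_cons (p := 6), biIdx_cons (p := 5)]
  have e2 : biIdx (![0, 2, 3, 4, 5, 6, 7] : Fin (6 + 1) → Fin 8) = Matrix.vecCons (.inl 0)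
      (Matrix.vecCons (.inr 0) (Matrix.vecCons (.inl 2) (Matrix.vecCons (.inr 2) R))) := by
    rw [biIdx_cons (p := 6), biIdx_cons (p := 5)]
  change ceDiff structBilin Φ (fun i => biVec ((Matrix.vecCons (.inl 0) (Matrix.vecCons (.inr 0)
    (Matrix.vecCons (.inl 1) (Matrix.vecCons (.inr 1) (Matrix.vecCons (.inl 2) R)))) :
      Fin 15 → Fin 8 ⊕ Fin 8) i)) = _
  rw [ceDiff_cons_biVec_of_forall (k := 13) Φ, ceDiff_cons_biVec_of_forall (k := 12),
    ceDiff_cons_biVec (k := 11) _ _ _ _ c2, k.ceDiff_eq_zero, c1'.bracket_eq_zero,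
    bracket_l0_r0, bracket_l1_r1, AlternatingMap.map_vecCons_zero, e1, e2]
  · rw [AlternatingMap.map_vecCons_smul, AlternatingMap.map_vecCons_add,
      AlternatingMap.map_vecCons_smul, AlternatingMap.map_vecCons_add]
    have a1 : Φ (Matrix.vecCons (biVec (.inl 2)) fun i => biVec ((Matrix.vecCons (.inl 1)
        (Matrix.vecCons (.inr 1) (Matrix.vecCons (.inl 2) R)) : Fin 13 → Fin 8 ⊕ Fin 8) i)) = 0 :=
      Φ.map_eq_zero_of_eq (i := (0 : Fin 14)) (j := (3 : Fin 14)) _ rfl (by decide)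
    rw [a1]
    simp only [vecCons_biVec]
    set ρ : Fin 10 → Fin 8 ⊕ Fin 8 → ℂ := fun i => biVec (R i)
    have a2 := AlternatingMap.map_vecCons_swap (k := 12) Φ (biVec (.inl 1)) (biVec (.inr 2))
      (Matrix.vecCons (biVec (.inr 1)) (Matrix.vecCons (biVec (.inl 2)) ρ))
    have a3 := AlternatingMap.map_vecCons_swap (k := 11) (Φ.curryLeft (biVec (.inl 1)))
      (biVec (.inr 1)) (biVec (.inr 2)) (Matrix.vecCons (biVec (.inl 2)) ρ)
    have a4 := AlternatingMap.map_vecCons_swap (k := 10) ((Φ.curryLeft (biVec (.inl 1))).curryLeft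
      (biVec (.inr 1))) (biVec (.inl 2)) (biVec (.inr 2)) ρ
    have a5 := AlternatingMap.map_vecCons_swap (k := 10) ((Φ.curryLeft (biVec (.inl 0))).curryLeft
      (biVec (.inr 0))) (biVec (.inl 2)) (biVec (.inr 2)) ρ
    have a6 := AlternatingMap.map_vecCons_self (k := 10) ((Φ.curryLeft (biVec (.inl 0))).curryLeft
      (biVec (.inr 0))) (biVec (.inl 2)) ρ
    simp only [AlternatingMap.curryLeft_apply_apply] at a3 a4 a5 a6 ⊢
    rw [a2, a3, a4, a5, a6]
    simp only [smul_eq_mul]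
    ring
  · intro j
    by_cases hj : j = 0
    · subst hj
      have b0 : bracket structBilin (biVec (.inr 0)) (biVec (.inr 1)) = _ := bracket_r0_r1
      have h3 : Φ (fun i => biVec ((Matrix.vecCons (.inl 0) (Matrix.vecCons (.inl 1)
          (Matrix.vecCons (.inr 2) (Matrix.vecCons (.inl 2) R))) :
            Fin 14 → Fin 8 ⊕ Fin 8) i)) = 0 := by
        refine hΦ _ ?_
        decide
      simp only [vecCons_biVec] at h3
      have h4 := AlternatingMap.map_vecCons_neg (k := 11) ((Φ.curryLeft (biVec (.inl 0))).curryLeft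
        (biVec (.inl 1))) (biVec (.inr 2))
        (fun i => biVec ((Matrix.vecCons (.inl 2) R : Fin 11 → Fin 8 ⊕ Fin 8) i))
      simp only [AlternatingMap.curryLeft_apply_apply, vecCons_biVec] at h4
      rw [h3, neg_zero] at h4
      rw [vecCons_biVec, vecCons_update_zero, AlternatingMap.curryLeft_apply_apply,
        Matrix.cons_val_zero, b0, vecCons_biVec]
      exact h4
    · have : Commute₀ (.inr 0) ((Matrix.vecCons (.inr 1) (Matrix.vecCons (.inl 2) R) :
          Fin 12 → Fin 8 ⊕ Fin 8) j) := by
        obtain ⟨i, rfl⟩ := Fin.exists_succ_eq.2 hj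
        exact c1 i
      rw [this.bracket_eq_zero, ← vecCons_update_succ]
      exact AlternatingMap.map_update_zero _ _ _
  · intro j
    by_cases hj : j = 0
    · subst hj
      have b0 : bracket structBilin (biVec (.inl 0)) (biVec (.inl 1)) = _ := bracket_l0_l1
      rw [vecCons_biVec, vecCons_update_zero, Matrix.cons_val_zero, b0]
      have h4 := AlternatingMap.map_vecCons_neg (k := 12) (Φ.curryLeft (biVec (.inr 0)))
        (biVec (.inl 2)) (fun i => biVec ((Matrix.vecCons (.inr 1) (Matrix.vecCons (.inl 2) R) :
          Fin 12 → Fin 8 ⊕ Fin 8) i))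
      rw [AlternatingMap.curryLeft_apply_apply, AlternatingMap.curryLeft_apply_apply] at h4
      rw [h4, neg_eq_zero]
      exact Φ.map_eq_zero_of_eq (i := (1 : Fin 14)) (j := (3 : Fin 14)) _ rfl (by decide)
    · have : Commute₀ (.inl 0) ((Matrix.vecCons (.inl 1) (Matrix.vecCons (.inr 1)
          (Matrix.vecCons (.inl 2) R)) : Fin 13 → Fin 8 ⊕ Fin 8) j) := by
        obtain ⟨i, rfl⟩ := Fin.exists_succ_eq.2 hj
        exact c0 i
      rw [this.bracket_eq_zero, ← vecCons_update_succ]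
      exact AlternatingMap.map_update_zero _ _ _

theorem map_biIdx₆_eq_zero_of_ceDel_eq {Φ : (Fin 8 ⊕ Fin 8 → ℂ) [⋀^Fin (2 * 5 + 2)]→ₗ[ℂ] ℂ}
    (hΦ : typeProj (biScale 8) (5 + 1) (5 + 1) Φ = Φ)
    {α : (Fin 8 ⊕ Fin 8 → ℂ) [⋀^Fin (2 * 5 + 1)]→ₗ[ℂ] ℂ}
    (h : ceDel (biScale 8) structBilin Φ =
      ceDel (biScale 8) structBilin (ceDelBar (biScale 8) structBilin α)) :
    Φ (fun i => biVec (biIdx (![2, 3, 4, 5, 6, 7] : Fin (5 + 1) → Fin 8) i)) = 0 := by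
  have h1 := detect_eq_zero hΦ h obsTuple₆ (by decide) (![2, 3, 4, 5, 6, 7] : Fin (5 + 1) → Fin 8)
    (![2, 3, 4, 5, 6, 7] : Fin (5 + 1) → Fin 8) (by decide) (by decide) (-Complex.I) 0
    (fun Ψ _ => (ceDiff_obsTuple₆ Ψ).trans (by rw [zero_mul, add_zero]))
  simpa using h1

theorem map_biIdx₇_eq_zero_of_ceDel_eq {Φ : (Fin 8 ⊕ Fin 8 → ℂ) [⋀^Fin (2 * 6 + 2)]→ₗ[ℂ] ℂ}
    (hΦ : typeProj (biScale 8) (6 + 1) (6 + 1) Φ = Φ)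
    {α : (Fin 8 ⊕ Fin 8 → ℂ) [⋀^Fin (2 * 6 + 1)]→ₗ[ℂ] ℂ}
    (h : ceDel (biScale 8) structBilin Φ =
      ceDel (biScale 8) structBilin (ceDelBar (biScale 8) structBilin α)) :
    -(Complex.I / 2) *
        Φ (fun i => biVec (biIdx (![1, 2, 3, 4, 5, 6, 7] : Fin (6 + 1) → Fin 8) i)) +
      -Complex.I *
        Φ (fun i => biVec (biIdx (![0, 2, 3, 4, 5, 6, 7] : Fin (6 + 1) → Fin 8) i)) = 0 :=
  detect_eq_zero hΦ h obsTuple₇ (by decide) (![1, 2, 3, 4, 5, 6, 7] : Fin (6 + 1) → Fin 8)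
    (![0, 2, 3, 4, 5, 6, 7] : Fin (6 + 1) → Fin 8) (by decide) (by decide) _ _
    (fun Ψ hΨ => (ceDiff_obsTuple₇ hΨ).trans (by rw [neg_mul Complex.I, ← sub_eq_add_neg]))

end Obstruction

/-! ### Averages of transverse forms -/

section Negative

variable {E : Type*} [NormedAddCommGroup E] [NormedSpace ℂ E] [FiniteDimensional ℝ E]
  {H : Type*} [TopologicalSpace H] {I : ModelWithCorners ℂ E H}
  {M : Type*} [TopologicalSpace M] [ChartedSpace H M]
  [IsManifold I 1 M] [I.Boundaryless]
  {c : E →ₗ[ℝ] E →ₗ[ℝ] E} {π : E → M} {A : (E → ℂ) →ₗ[ℂ] ℂ}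
  {n : ℕ} {crd : E ≃ₗ[ℂ] (Fin n → ℂ)}
  {cW : (Fin n ⊕ Fin n → ℂ) →ₗ[ℂ] (Fin n ⊕ Fin n → ℂ) →ₗ[ℂ] (Fin n ⊕ Fin n → ℂ)}

theorem IsNilCover.exists_hasMean (h : IsNilCover I c π) (A : (E → ℂ) →ₗ[ℂ] ℂ)
    (crd : E ≃ₗ[ℂ] (Fin n → ℂ)) {k : ℕ} {η : DForm I M k} (hη : η.IsSmooth) :
    ∃ Θ, η.HasMean c π (pullbackFun π) A (biEmb crd) Θ := by
  let θ : E [⋀^Fin k]→ₗ[ℝ] ℂ :=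
    { toFun := fun v => A fun y => η.toFrame c (π y) v
      map_update_add' := by
        intro hdec v i x y
        rw [← map_add]
        congr 1
        funext z
        exact (η.toFrame c (π z)).toAlternatingMap.map_update_add v i x y
      map_update_smul' := by
        intro hdec v i r x
        have : (fun y => η.toFrame c (π y) (Function.update v i (r • x))) =
            (r : ℂ) • fun y => η.toFrame c (π y) (Function.update v i x) := by
          funext z
          exact (η.toFrame c (π z)).toAlternatingMap.map_update_smul v i r x
        rw [this, map_smul]
        rfl
      map_eq_zero_of_eq' := by
        intro v i j hij hne
        have : (fun y => η.toFrame c (π y) v) = 0 := by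
          funext z
          exact (η.toFrame c (π z)).toAlternatingMap.map_eq_zero_of_eq v hij hne
        rw [this, map_zero] }
  obtain ⟨Θ, hΘ⟩ := exists_restrictForm_eq (biEmb crd) (realBasis crd) (biBasis n)
    (biEmb_realBasis crd) θ
  exact ⟨Θ, fun v => ⟨(h.isSmooth_iff η).1 hη v, fun y y' hy => by simp only [hy]⟩, hΘ⟩

omit [FiniteDimensional ℝ E] [IsManifold I 1 M] [I.Boundaryless] in
theorem eq_of_biEmb_eq {k : ℕ} {Θ Θ' : (Fin n ⊕ Fin n → ℂ) [⋀^Fin k]→ₗ[ℂ] ℂ}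
    (h : ∀ v : Fin k → E, (Θ fun i => biEmb crd (v i)) = Θ' fun i => biEmb crd (v i)) : Θ = Θ' :=
  eq_of_restrictForm_eq (biEmb crd) (realBasis crd) (biBasis n) (biEmb_realBasis crd) h

omit [IsManifold I 1 M] [I.Boundaryless] in
theorem DForm.HasMean.unique {P : Submodule ℂ (E → ℂ)} {k : ℕ} {η : DForm I M k}
    {Θ Θ' : (Fin n ⊕ Fin n → ℂ) [⋀^Fin k]→ₗ[ℂ] ℂ}
    (h : η.HasMean c π P A (biEmb crd) Θ) (h' : η.HasMean c π P A (biEmb crd) Θ') : Θ = Θ' :=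
  eq_of_biEmb_eq (crd := crd) fun v => (h.2 v).symm.trans (h'.2 v)

/-- `Θ` is the complex multilinear extension of a form of type `(p,p)` which is positive on the
subspaces spanned by basis vectors. -/
structure IsDiagPositive (p : ℕ) (Θ : (Fin n ⊕ Fin n → ℂ) [⋀^Fin (2 * p)]→ₗ[ℂ] ℂ) : Prop where
  typeProj_eq : typeProj (biScale n) p p Θ = Θ
  pos : ∀ g : Fin p → Fin n, Function.Injective g →
    0 < ((-2 * Complex.I) ^ p * Θ fun i => biVec (biIdx g i)).re

omit [IsManifold I 1 M] [I.Boundaryless] in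
theorem DForm.HasMean.isDiagPositive (h : IsNilCover I c π)
    (hA : ∀ f ∈ pullbackFun π, (∀ y, (f y).im = 0) → (A f).im = 0 ∧
      ((∀ y, 0 < (f y).re) → 0 < (A f).re))
    {p : ℕ} {Ω : DForm I M (2 * p)} (hΩ : Ω.IsSmoothTransverse p)
    {Θ : (Fin n ⊕ Fin n → ℂ) [⋀^Fin (2 * p)]→ₗ[ℂ] ℂ}
    (hΘ : Ω.HasMean c π (pullbackFun π) A (biEmb crd) Θ) : IsDiagPositive p Θ := by
  have hfr : ∀ (x : M) (a : ℂ) (u : E), frameMap c (chartPoint I x) (a • u) =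
      a • frameMap c (chartPoint I x) u := fun x a u => by
    rw [frameMap_apply, frameMap_apply, h.smul_right, smul_add]
  refine ⟨eq_of_biEmb_eq (crd := crd) fun v => ?_, fun g hg => ?_⟩
  · rw [typeProj_apply_of_weight (n := 0) (by simp), if_pos ⟨by ring, by ring⟩]
    intro a ha
    rw [zpow_zero, one_mul]
    simp only [← biEmb_smul]
    rw [← hΘ.2, ← hΘ.2]
    congr 1
    funext y
    have h1 := ((hΩ.2 (π y)).1).2 a fun i => frameMap c (chartPoint I (π y)) (v i)
    rw [DForm.toFrame_apply, DForm.toFrame_apply]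
    simp only [hfr]
    refine h1.trans ?_
    rw [← mul_pow, Complex.mul_conj, Complex.normSq_eq_norm_sq, ha]
    simp
  · rw [← map_biEmb_withJ_crdVec crd, ← hΘ.2]
    refine (hA _ (hΘ.1 _) fun y => (hΩ.2 (π y)).2.1 _).2 fun y => ?_
    have hli : LinearIndependent ℂ fun i => frameMap c (chartPoint I (π y)) (crdVec crd (g i)) := by
      let T : E →ₗ[ℂ] E :=
        { toFun := frameMap c (chartPoint I (π y))
          map_add' := map_add _
          map_smul' := fun a u => hfr (π y) a u }
      refine (linearIndependent_crdVec crd hg).map' T (LinearMap.ker_eq_bot.2 fun u u' huu => ?_)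
      have h2 := congrArg (coframeMap c (chartPoint I (π y))) huu
      change coframeMap c _ (frameMap c _ u) = coframeMap c _ (frameMap c _ u') at h2
      rwa [coframeMap_frameMap h.twoStep, coframeMap_frameMap h.twoStep] at h2
    have h1 := (hΩ.2 (π y)).2.2 _ hli
    rw [DForm.toFrame_apply]
    have h3 : (fun i => frameMap c (chartPoint I (π y)) (withJ (fun i => crdVec crd (g i)) i)) =
        withJ (fun i => frameMap c (chartPoint I (π y)) (crdVec crd (g i))) := by
      rw [withJ_eq_interleave, comp_interleave, withJ_eq_interleave]
      simp only [hfr]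
    have h4 : (Ω (π y)) (fun i => frameMap c (chartPoint I (π y))
        (withJ (fun i => crdVec crd (g i)) i)) = Ω (π y)
          (withJ (fun i => frameMap c (chartPoint I (π y)) (crdVec crd (g i)))) :=
      congrArg (Ω (π y)) h3
    rw [h4]
    exact h1

variable [CompactSpace M] (h : IsNilCover I c π) (hj : IsComplexModel c (biEmb crd) cW (biScale n))
include h hj

theorem IsNilCover.exists_of_isPKahler {p : ℕ} (hM : IsPKahler I M p) :
    ∃ Θ, IsDiagPositive p Θ ∧ ceDiff cW Θ = 0 := by
  obtain ⟨A, hA, hpos⟩ := h.exists_isInvariantMean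
  obtain ⟨Ω, hΩ, hd⟩ := hM
  obtain ⟨Θ, hΘ⟩ := h.exists_hasMean A crd hΩ.1
  refine ⟨Θ, hΘ.isDiagPositive h hpos hΩ, (hΘ.d hj hA h).unique (crd := crd) ?_⟩
  rw [hd]
  exact DForm.HasMean.zero

theorem IsNilCover.exists_of_isPSymplectic {p : ℕ} (hM : IsPSymplectic I M p) :
    ∃ Θ, IsDiagPositive p (typeProj (biScale n) p p Θ) ∧ ceDiff cW Θ = 0 := by
  obtain ⟨A, hA, hpos⟩ := h.exists_isInvariantMean
  obtain ⟨Ψ, hΨ, -, hd, hΩ⟩ := hM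
  obtain ⟨Θ, hΘ⟩ := h.exists_hasMean A crd hΨ
  refine ⟨Θ, (hΘ.component hj h p p).isDiagPositive h hpos hΩ,
    (hΘ.d hj hA h).unique (crd := crd) ?_⟩
  rw [hd]
  exact DForm.HasMean.zero

theorem IsNilCover.exists_of_isWeaklyPKahler {m : ℕ} (hM : IsWeaklyPKahler I M (m + 1)) :
    ∃ (Θ : (Fin n ⊕ Fin n → ℂ) [⋀^Fin (2 * (m + 1))]→ₗ[ℂ] ℂ)
      (Α : (Fin n ⊕ Fin n → ℂ) [⋀^Fin (2 * m + 1)]→ₗ[ℂ] ℂ), IsDiagPositive (m + 1) Θ ∧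
        ceDel (biScale n) cW Θ = ceDel (biScale n) cW (ceDelBar (biScale n) cW Α) := by
  obtain ⟨A, hA, hpos⟩ := h.exists_isInvariantMean
  obtain ⟨Ω, hΩ, k, hk, α, hα, heq⟩ := hM
  obtain rfl : k = 2 * m + 1 := by omega
  obtain ⟨Θ, hΘ⟩ := h.exists_hasMean A crd hΩ.1
  obtain ⟨Α, hΑ⟩ := h.exists_hasMean A crd hα
  have h1 : Ω.del = α.delBar.del := by
    funext x
    ext v
    exact heq x v
  refine ⟨Θ, Α, hΘ.isDiagPositive h hpos hΩ, (hΘ.del hj hA h).unique (crd := crd) ?_⟩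
  rw [h1]
  exact (hΑ.delBar hj hA h).del hj hA h

theorem IsNilCover.exists_of_isPPluriclosed {p : ℕ} (hM : IsPPluriclosed I M p) :
    ∃ Θ, IsDiagPositive p Θ ∧ ceDel (biScale n) cW (ceDelBar (biScale n) cW Θ) = 0 := by
  obtain ⟨A, hA, hpos⟩ := h.exists_isInvariantMean
  obtain ⟨Ω, hΩ, hd⟩ := hM
  obtain ⟨Θ, hΘ⟩ := h.exists_hasMean A crd hΩ.1
  refine ⟨Θ, hΘ.isDiagPositive h hpos hΩ,
    ((hΘ.delBar hj hA h).del hj hA h).unique (crd := crd) ?_⟩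
  rw [hd]
  exact DForm.HasMean.zero

end Negative

/-! ### Nonexistence of transverse forms -/

section Nonexistence

variable {E : Type*} [NormedAddCommGroup E] [NormedSpace ℂ E] [FiniteDimensional ℝ E]
  {H : Type*} [TopologicalSpace H] {I : ModelWithCorners ℂ E H}
  {M : Type*} [TopologicalSpace M] [ChartedSpace H M]
  [IsManifold I 1 M] [I.Boundaryless]
  {c : E →ₗ[ℝ] E →ₗ[ℝ] E} {π : E → M} {crd : E ≃ₗ[ℂ] (Fin 8 → ℂ)}
  [CompactSpace M] (h : IsNilCover I c π)
  (hj : IsComplexModel c (biEmb crd) structBilin (biScale 8))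

theorem IsDiagPositive.ne_zero {n p : ℕ} {Θ : (Fin n ⊕ Fin n → ℂ) [⋀^Fin (2 * p)]→ₗ[ℂ] ℂ}
    (h : IsDiagPositive p Θ) {g : Fin p → Fin n} (hg : Function.Injective g) :
    Θ (fun i => biVec (biIdx g i)) ≠ 0 := by
  intro h0
  have := h.pos g hg
  rw [h0] at this
  simp at this

theorem typeProj_biIdx {n p : ℕ} (Θ : (Fin n ⊕ Fin n → ℂ) [⋀^Fin (2 * p)]→ₗ[ℂ] ℂ)
    (g : Fin p → Fin n) : typeProj (biScale n) p p Θ (fun i => biVec (biIdx g i)) =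
      Θ fun i => biVec (biIdx g i) := by
  rw [typeProj_apply_biVec, if_pos]
  rw [biWeight_biIdx]
  exact ⟨by ring, by ring⟩

theorem injective_cons_obsIdx {m : ℕ} (hm : m ≤ 4) :
    Function.Injective (Matrix.vecCons 7 (obsIdx m)) := by
  interval_cases m <;> decide

include h hj

theorem IsNilCover.not_isPSymplectic_le {m : ℕ} (hm : m ≤ 4) : ¬ IsPSymplectic I M (m + 1) := by
  intro hM
  obtain ⟨Θ, hpos, hd⟩ := h.exists_of_isPSymplectic hj hM
  have h1 := ceDiff_obsTuple hm Θ
  refine hpos.ne_zero (injective_cons_obsIdx hm) ?_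
  rw [typeProj_biIdx]
  refine h1.symm.trans ?_
  rw [hd]
  rfl

theorem IsNilCover.not_isPKahler_le {m : ℕ} (hm : m ≤ 4) : ¬ IsPKahler I M (m + 1) := by
  intro hM
  obtain ⟨Θ, hpos, hd⟩ := h.exists_of_isPKahler hj hM
  have h1 := ceDiff_obsTuple hm Θ
  refine hpos.ne_zero (injective_cons_obsIdx hm) (h1.symm.trans ?_)
  rw [hd]
  rfl

theorem IsNilCover.not_isWeaklyPKahler_le {m : ℕ} (hm : m ≤ 4) :
    ¬ IsWeaklyPKahler I M (m + 1) := by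
  intro hM
  obtain ⟨Θ, Α, hpos, hd⟩ := h.exists_of_isWeaklyPKahler hj hM
  exact hpos.ne_zero (injective_cons_obsIdx hm)
    (map_obsIdx_eq_zero_of_ceDel_eq hm hpos.typeProj_eq hd)

theorem IsNilCover.not_isPPluriclosed_le {m : ℕ} (hm : m ≤ 4) : ¬ IsPPluriclosed I M (m + 1) := by
  intro hM
  obtain ⟨Θ, hpos, hd⟩ := h.exists_of_isPPluriclosed hj hM
  exact hpos.ne_zero (injective_cons_obsIdx hm)
    (map_obsIdx_eq_zero_of_ceDel_ceDelBar hm hpos.typeProj_eq hd)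

theorem IsNilCover.not_isPSymplectic_six : ¬ IsPSymplectic I M (5 + 1) := by
  intro hM
  obtain ⟨Θ, hpos, hd⟩ := h.exists_of_isPSymplectic hj hM
  have h1 := ceDiff_obsTuple₆ Θ
  refine hpos.ne_zero (g := ![2, 3, 4, 5, 6, 7]) (by decide) ?_
  rw [typeProj_biIdx]
  have h2 : ceDiff structBilin Θ (fun i => biVec (obsTuple₆ i)) = 0 := by
    rw [hd]
    rfl
  simpa using h1.symm.trans h2

theorem IsNilCover.not_isPKahler_six : ¬ IsPKahler I M (5 + 1) := by
  intro hM
  obtain ⟨Θ, hpos, hd⟩ := h.exists_of_isPKahler hj hM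
  have h1 := ceDiff_obsTuple₆ Θ
  refine hpos.ne_zero (g := ![2, 3, 4, 5, 6, 7]) (by decide) ?_
  have h2 : ceDiff structBilin Θ (fun i => biVec (obsTuple₆ i)) = 0 := by
    rw [hd]
    rfl
  simpa using h1.symm.trans h2

theorem IsNilCover.not_isWeaklyPKahler_six : ¬ IsWeaklyPKahler I M (5 + 1) := by
  intro hM
  obtain ⟨Θ, Α, hpos, hd⟩ := h.exists_of_isWeaklyPKahler hj hM
  exact hpos.ne_zero (g := ![2, 3, 4, 5, 6, 7]) (by decide)
    (map_biIdx₆_eq_zero_of_ceDel_eq hpos.typeProj_eq hd)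

omit [FiniteDimensional ℝ E] [IsManifold I 1 M] [I.Boundaryless] h hj in
theorem IsDiagPositive.false_of_combination_eq_zero
    {Θ : (Fin 8 ⊕ Fin 8 → ℂ) [⋀^Fin (2 * (6 + 1))]→ₗ[ℂ] ℂ} (hpos : IsDiagPositive (6 + 1) Θ)
    (h : -(Complex.I / 2) *
        Θ (fun i => biVec (biIdx (![1, 2, 3, 4, 5, 6, 7] : Fin (6 + 1) → Fin 8) i)) +
      -Complex.I *
        Θ (fun i => biVec (biIdx (![0, 2, 3, 4, 5, 6, 7] : Fin (6 + 1) → Fin 8) i)) = 0) :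
    False := by
  have h1 := hpos.pos (![1, 2, 3, 4, 5, 6, 7] : Fin (6 + 1) → Fin 8) (by decide)
  have h2 := hpos.pos (![0, 2, 3, 4, 5, 6, 7] : Fin (6 + 1) → Fin 8) (by decide)
  set a := Θ (fun i => biVec (biIdx (![1, 2, 3, 4, 5, 6, 7] : Fin (6 + 1) → Fin 8) i))
  set b := Θ (fun i => biVec (biIdx (![0, 2, 3, 4, 5, 6, 7] : Fin (6 + 1) → Fin 8) i))
  have h3 : (-2 * Complex.I) ^ (6 + 1) * a + 2 * ((-2 * Complex.I) ^ (6 + 1) * b) = 0 := by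
    have h4 : a + 2 * b = 0 := by
      have hI := Complex.I_mul_I
      linear_combination 2 * Complex.I * h + (a + 2 * b) * hI
    linear_combination (-2 * Complex.I) ^ (6 + 1) * h4
  have h5 := congrArg Complex.re h3
  rw [Complex.add_re, Complex.zero_re, two_mul, Complex.add_re] at h5
  linarith

theorem IsNilCover.not_isWeaklyPKahler_seven : ¬ IsWeaklyPKahler I M (6 + 1) := by
  intro hM
  obtain ⟨Θ, Α, hpos, hd⟩ := h.exists_of_isWeaklyPKahler hj hM
  exact hpos.false_of_combination_eq_zero (map_biIdx₇_eq_zero_of_ceDel_eq hpos.typeProj_eq hd)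

theorem IsNilCover.not_isPKahler_seven : ¬ IsPKahler I M (6 + 1) := by
  intro hM
  obtain ⟨Θ, hpos, hd⟩ := h.exists_of_isPKahler hj hM
  have hw : ∀ f, biWeight f ≠ 0 → Θ (fun i => biVec (f i)) = 0 := by
    intro f hf
    rw [← hpos.typeProj_eq, typeProj_apply_biVec, if_neg]
    rintro ⟨-, h⟩
    exact hf (by rw [← h, sub_self])
  have h1 := ceDiff_obsTuple₇ hw
  have h2 : ceDiff structBilin Θ (fun i => biVec (obsTuple₇ i)) = 0 := by
    rw [hd]
    rfl
  refine hpos.false_of_combination_eq_zero (Eq.trans ?_ (h1.symm.trans h2))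
  rw [neg_mul Complex.I, ← sub_eq_add_neg]

end Nonexistence

/-! ### The volume form of the complexification -/

section Volume

theorem ceDiffₗ_apply {K W N : Type*} [CommRing K] [AddCommGroup W] [Module K W] [AddCommGroup N]
    [Module K N] (c : W →ₗ[K] W →ₗ[K] W) {k : ℕ} (Φ : W [⋀^Fin k]→ₗ[K] N) :
    ceDiffₗ c k Φ = ceDiff c Φ := rfl

variable {n : ℕ}

/-- The embedding of `ℂⁿ` as first summand of the complexification. -/
def leftVec : (Fin n → ℂ) →ₗ[ℂ] (Fin n ⊕ Fin n → ℂ) where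
  toFun x := Sum.elim x 0
  map_add' x y := by funext i; cases i <;> simp
  map_smul' r x := by funext i; cases i <;> simp

/-- The embedding of `ℂⁿ` as second summand of the complexification. -/
def rightVec : (Fin n → ℂ) →ₗ[ℂ] (Fin n ⊕ Fin n → ℂ) where
  toFun x := Sum.elim 0 x
  map_add' x y := by funext i; cases i <;> simp
  map_smul' r x := by funext i; cases i <;> simp

theorem leftVec_single (a : Fin n) : leftVec (Pi.single a 1) = biVec (.inl a) := by
  funext i
  cases i <;> simp [leftVec, biVec, Pi.single_apply]

theorem rightVec_single (a : Fin n) : rightVec (Pi.single a 1) = biVec (.inr a) := by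
  funext i
  cases i <;> simp [rightVec, biVec, Pi.single_apply]

theorem bijective_biIdx_id : Function.Bijective (biIdx (id : Fin n → Fin n)) := by
  rw [Fintype.bijective_iff_injective_and_card]
  refine ⟨fun i j hij => ?_, by simp [two_mul]⟩
  simp only [biIdx, interleave, id] at hij
  split_ifs at hij with h1 h2 h2
  · simp only [Sum.inl.injEq, Fin.mk.injEq] at hij
    exact Fin.ext (by omega)
  · simp only [Sum.inr.injEq, Fin.mk.injEq] at hij
    exact Fin.ext (by omega)

/-- The basis `l₀, r₀, l₁, r₁, …` of the complexification. -/
noncomputable def interBasis (n : ℕ) : Module.Basis (Fin (2 * n)) ℂ (Fin n ⊕ Fin n → ℂ) :=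
  (Pi.basisFun ℂ (Fin n ⊕ Fin n)).reindex (Equiv.ofBijective _ bijective_biIdx_id).symm

theorem interBasis_apply (i : Fin (2 * n)) : interBasis n i = biVec (biIdx id i) := by
  rw [interBasis, Module.Basis.reindex_apply, Pi.basisFun_apply]
  rfl

/-- The volume form, with value `1` on `(l₀, r₀, l₁, r₁, …)`. -/
noncomputable def biVol (n : ℕ) : (Fin n ⊕ Fin n → ℂ) [⋀^Fin (2 * n)]→ₗ[ℂ] ℂ := (interBasis n).det

theorem biVol_biVec : biVol n (fun i => biVec (biIdx id i)) = 1 := by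
  rw [biVol, ← (interBasis n).det_self]
  exact congrArg _ (funext fun i => (interBasis_apply i).symm)

theorem eq_smul_biVol (Φ : (Fin n ⊕ Fin n → ℂ) [⋀^Fin (2 * n)]→ₗ[ℂ] ℂ) :
    Φ = Φ (fun i => biVec (biIdx id i)) • biVol n := by
  conv_lhs => rw [AlternatingMap.eq_smul_basis_det (interBasis n) Φ]
  rw [biVol]
  congr 2
  funext i
  exact interBasis_apply i

theorem interleave_update_left {X : Type*} {p : ℕ} (x y : Fin p → X) (i : Fin p) (a : X) :
    interleave (Function.update x i a) y =
      Function.update (interleave x y) ⟨2 * i.val, by omega⟩ a := by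
  funext ⟨l, hl⟩
  by_cases h : l = 2 * i.val
  · subst h
    simp [interleave]
  · rw [Function.update_of_ne (by simpa using h)]
    simp only [interleave]
    split_ifs with h1
    · rw [Function.update_of_ne]
      intro h2
      have := congrArg Fin.val h2
      simp only at this
      omega
    · rfl

theorem interleave_update_right {X : Type*} {p : ℕ} (x y : Fin p → X) (i : Fin p) (a : X) :
    interleave x (Function.update y i a) =
      Function.update (interleave x y) ⟨2 * i.val + 1, by omega⟩ a := by
  funext ⟨l, hl⟩
  by_cases h : l = 2 * i.val + 1
  · subst h
    have h2 : ∀ h, (⟨(2 * i.val + 1) / 2, h⟩ : Fin p) = i := fun h => Fin.ext (by simp; omega)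
    simp [interleave, h2]
  · rw [Function.update_of_ne (by simpa using h)]
    simp only [interleave]
    split_ifs with h1
    · rfl
    · rw [Function.update_of_ne]
      intro h2
      have := congrArg Fin.val h2
      simp only at this
      omega

theorem interleave_even {X : Type*} {p : ℕ} (x y : Fin p → X) (i : Fin p) :
    interleave x y ⟨2 * i.val, by omega⟩ = x i := by
  simp [interleave]

theorem interleave_odd {X : Type*} {p : ℕ} (x y : Fin p → X) (i : Fin p) :
    interleave x y ⟨2 * i.val + 1, by omega⟩ = y i := by
  have h2 : ∀ h, (⟨(2 * i.val + 1) / 2, h⟩ : Fin p) = i := fun h => Fin.ext (by simp; omega)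
  simp [interleave, h2]

section

variable {W : Type*} [AddCommGroup W] [Module ℂ W] {p : ℕ}

/-- The even arguments of a form, the odd ones being fixed. -/
def evenForm (Φ : W [⋀^Fin (2 * p)]→ₗ[ℂ] ℂ) (y : Fin p → W) : W [⋀^Fin p]→ₗ[ℂ] ℂ where
  toFun x := Φ (interleave x y)
  map_update_add' := by
    intro hdec x i a b
    have : hdec = instDecidableEqFin p := Subsingleton.elim _ _
    subst this
    simp only [interleave_update_left, Φ.map_update_add]
  map_update_smul' := by
    intro hdec x i a b
    have : hdec = instDecidableEqFin p := Subsingleton.elim _ _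
    subst this
    simp only [interleave_update_left, Φ.map_update_smul]
  map_eq_zero_of_eq' x i j hij hne :=
    Φ.map_eq_zero_of_eq (i := ⟨2 * i.val, by omega⟩) (j := ⟨2 * j.val, by omega⟩) _
      (by rw [interleave_even, interleave_even, hij])
      fun h => hne (Fin.ext (by have := congrArg Fin.val h; simp only at this; omega))

/-- The odd arguments of a form, the even ones being fixed. -/
def oddForm (Φ : W [⋀^Fin (2 * p)]→ₗ[ℂ] ℂ) (x : Fin p → W) : W [⋀^Fin p]→ₗ[ℂ] ℂ where
  toFun y := Φ (interleave x y)
  map_update_add' := by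
    intro hdec y i a b
    have : hdec = instDecidableEqFin p := Subsingleton.elim _ _
    subst this
    simp only [interleave_update_right, Φ.map_update_add]
  map_update_smul' := by
    intro hdec y i a b
    have : hdec = instDecidableEqFin p := Subsingleton.elim _ _
    subst this
    simp only [interleave_update_right, Φ.map_update_smul]
  map_eq_zero_of_eq' y i j hij hne :=
    Φ.map_eq_zero_of_eq (i := ⟨2 * i.val + 1, by omega⟩) (j := ⟨2 * j.val + 1, by omega⟩) _
      (by rw [interleave_odd, interleave_odd, hij])
      fun h => hne (Fin.ext (by have := congrArg Fin.val h; simp only at this; omega))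

theorem AlternatingMap.map_interleave_swap (Θ : W [⋀^Fin (2 * p)]→ₗ[ℂ] ℂ) (x y : Fin p → W) :
    Θ (interleave y x) = (-1) ^ p * Θ (interleave x y) := by
  induction p with
  | zero =>
    rw [pow_zero, one_mul]
    exact congrArg Θ (funext fun i => i.elim0)
  | succ p ih =>
    obtain ⟨x0, x, rfl⟩ : ∃ a u, x = Matrix.vecCons a u := ⟨x 0, fun i => x i.succ, by
      funext i; exact Fin.cases rfl (fun _ => rfl) i⟩
    obtain ⟨y0, y, rfl⟩ : ∃ a u, y = Matrix.vecCons a u := ⟨y 0, fun i => y i.succ, by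
      funext i; exact Fin.cases rfl (fun _ => rfl) i⟩
    rw [interleave_cons, interleave_cons]
    have h4 := ih (AlternatingMap.curryLeft (n := 2 * p)
      (AlternatingMap.curryLeft (n := 2 * p + 1) Θ x0) y0) x y
    simp only [AlternatingMap.curryLeft_apply_apply] at h4
    have hc := AlternatingMap.map_vecCons_swap (k := 2 * p) Θ x0 y0 (interleave y x)
    rw [hc, h4, pow_succ]
    ring

end

/-- The determinant on `ℂⁿ`. -/
noncomputable def stdDet (n : ℕ) : (Fin n → ℂ) [⋀^Fin n]→ₗ[ℂ] ℂ := (Pi.basisFun ℂ (Fin n)).det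

theorem eq_smul_stdDet (Φ : (Fin n → ℂ) [⋀^Fin n]→ₗ[ℂ] ℂ) :
    Φ = Φ (fun i => Pi.single i 1) • stdDet n := by
  conv_lhs => rw [AlternatingMap.eq_smul_basis_det (Pi.basisFun ℂ (Fin n)) Φ]
  rw [stdDet]
  congr 2
  funext i
  exact Pi.basisFun_apply ℂ (Fin n) i

theorem biVol_interleave (x y : Fin n → Fin n → ℂ) :
    biVol n (interleave (fun i => leftVec (x i)) fun i => rightVec (y i)) =
      stdDet n x * stdDet n y := by
  have h1 := DFunLike.congr_fun (eq_smul_stdDet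
    ((evenForm (biVol n) fun i => rightVec (y i)).compLinearMap leftVec)) x
  have h2 := DFunLike.congr_fun (eq_smul_stdDet
    ((oddForm (biVol n) fun i => leftVec (Pi.single i 1)).compLinearMap rightVec)) y
  have h3 : biVol n (interleave (fun i => leftVec (Pi.single i 1))
      fun i => rightVec (Pi.single i 1)) = 1 := by
    refine Eq.trans ?_ (biVol_biVec (n := n))
    rw [biIdx, comp_interleave]
    simp only [leftVec_single, rightVec_single, id]
  change biVol n _ = biVol n (interleave (fun i => leftVec (Pi.single i 1)) fun i =>
    rightVec (y i)) * stdDet n x at h1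
  change biVol n _ = biVol n (interleave (fun i => leftVec (Pi.single i 1)) fun i =>
    rightVec (Pi.single i 1)) * stdDet n y at h2
  rw [h3, one_mul] at h2
  refine h1.trans ?_
  rw [mul_comm]
  congr 1

/-- The complex conjugation of the complexification, which fixes the image of `biEmb`. -/
noncomputable def biConj (w : Fin n ⊕ Fin n → ℂ) : Fin n ⊕ Fin n → ℂ :=
  Sum.elim (fun i => starRingEnd ℂ (w (.inr i))) fun i => starRingEnd ℂ (w (.inl i))

theorem biConj_add (x y : Fin n ⊕ Fin n → ℂ) : biConj (x + y) = biConj x + biConj y := by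
  funext i
  cases i <;> simp [biConj]

theorem biConj_smul (a : ℂ) (x : Fin n ⊕ Fin n → ℂ) :
    biConj (a • x) = starRingEnd ℂ a • biConj x := by
  funext i
  cases i <;> simp [biConj]

theorem biConj_inl (a : Fin n) : biConj (biVec (.inl a)) = biVec (.inr a) := by
  funext i
  cases i <;> simp [biConj, biVec, Pi.single_apply, apply_ite (starRingEnd ℂ)]

theorem biConj_inr (a : Fin n) : biConj (biVec (.inr a)) = biVec (.inl a) := by
  funext i
  cases i <;> simp [biConj, biVec, Pi.single_apply, apply_ite (starRingEnd ℂ)]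

theorem biConj_biEmb {E : Type*} [AddCommGroup E] [Module ℂ E] (crd : E ≃ₗ[ℂ] (Fin n → ℂ))
    (v : E) : biConj (biEmb crd v) = biEmb crd v := by
  funext i
  cases i <;> simp [biConj, biEmb_apply]

/-- The conjugate of a form on the complexification. -/
noncomputable def conjForm {k : ℕ} (Φ : (Fin n ⊕ Fin n → ℂ) [⋀^Fin k]→ₗ[ℂ] ℂ) :
    (Fin n ⊕ Fin n → ℂ) [⋀^Fin k]→ₗ[ℂ] ℂ where
  toFun w := starRingEnd ℂ (Φ fun i => biConj (w i))
  map_update_add' := by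
    intro hdec v i x y
    have h : ∀ z, (fun l => biConj (Function.update v i z l)) =
        Function.update (fun l => biConj (v l)) i (biConj z) := fun z => by
      funext l
      by_cases hl : l = i
      · subst hl; simp
      · simp [hl]
    rw [h, h, h, biConj_add, Φ.map_update_add, map_add]
  map_update_smul' := by
    intro hdec v i r x
    have h : ∀ z, (fun l => biConj (Function.update v i z l)) =
        Function.update (fun l => biConj (v l)) i (biConj z) := fun z => by
      funext l
      by_cases hl : l = i
      · subst hl; simp
      · simp [hl]
    rw [h, h, biConj_smul, Φ.map_update_smul, smul_eq_mul, map_mul, Complex.conj_conj]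
    rfl
  map_eq_zero_of_eq' v i j hij hne := by
    rw [Φ.map_eq_zero_of_eq _ (congrArg biConj hij) hne, map_zero]

theorem conjForm_apply {k : ℕ} (Φ : (Fin n ⊕ Fin n → ℂ) [⋀^Fin k]→ₗ[ℂ] ℂ)
    (w : Fin k → Fin n ⊕ Fin n → ℂ) :
    conjForm Φ w = starRingEnd ℂ (Φ fun i => biConj (w i)) := rfl

theorem conjForm_add {k : ℕ} (Φ Ψ : (Fin n ⊕ Fin n → ℂ) [⋀^Fin k]→ₗ[ℂ] ℂ) :
    conjForm (Φ + Ψ) = conjForm Φ + conjForm Ψ := by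
  ext w
  simp [conjForm_apply]

theorem conjForm_smul {k : ℕ} (a : ℂ) (Φ : (Fin n ⊕ Fin n → ℂ) [⋀^Fin k]→ₗ[ℂ] ℂ) :
    conjForm (a • Φ) = starRingEnd ℂ a • conjForm Φ := by
  ext w
  simp [conjForm_apply]

theorem conjForm_sum {ι : Type*} {k : ℕ} (s : Finset ι)
    (g : ι → (Fin n ⊕ Fin n → ℂ) [⋀^Fin k]→ₗ[ℂ] ℂ) :
    conjForm (∑ i ∈ s, g i) = ∑ i ∈ s, conjForm (g i) := by
  ext w
  simp [conjForm_apply, AlternatingMap.finset_sum_apply]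

theorem conjForm_curryLeft {k : ℕ} {Φ Ψ : (Fin n ⊕ Fin n → ℂ) [⋀^Fin (k + 1)]→ₗ[ℂ] ℂ}
    (h : conjForm Φ = Ψ) (x : Fin n ⊕ Fin n → ℂ) :
    conjForm (Φ.curryLeft x) = Ψ.curryLeft (biConj x) := by
  ext w
  rw [← h, conjForm_apply, AlternatingMap.curryLeft_apply_apply,
    AlternatingMap.curryLeft_apply_apply, conjForm_apply]
  have hx : biConj (biConj x) = x := by
    funext i
    cases i <;> simp [biConj]
  congr 2
  funext i
  refine Fin.cases hx.symm (fun _ => rfl) i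

theorem conjForm_biVol (hn : Even n) : conjForm (biVol n) = biVol n := by
  rw [eq_smul_biVol (conjForm (biVol n)), conjForm_apply, biIdx]
  have h1 : (fun i => biConj (biVec (interleave (fun i => Sum.inl (id i))
      (fun i => Sum.inr (id i)) i) : Fin n ⊕ Fin n → ℂ)) =
        interleave (fun i => biVec (.inr i)) fun i => biVec (.inl i) := by
    rw [comp_interleave (fun a => biConj (biVec a))]
    simp only [biConj_inl, biConj_inr, id]
  have h2 := biVol_biVec (n := n)
  rw [biIdx, comp_interleave] at h2
  simp only [id] at h2
  rw [h1, AlternatingMap.map_interleave_swap, h2, hn.neg_one_pow]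
  simp

/-- The form is multiplied by `a ^ m` under the action of `a` in the unit circle. -/
def HasWeight (m : ℤ) {k : ℕ} (Φ : (Fin n ⊕ Fin n → ℂ) [⋀^Fin k]→ₗ[ℂ] ℂ) : Prop :=
  ∀ a : ℂ, ‖a‖ = 1 → ∀ w, Φ (fun i => biScale n a (w i)) = a ^ m * Φ w

theorem hasWeight_biVol : HasWeight 0 (biVol n) := by
  intro a ha w
  have h1 := DFunLike.congr_fun (eq_smul_biVol ((biVol n).compLinearMap (biScale n a))) w
  refine h1.trans ?_
  have h2 := map_biScale_biVec (biVol n) (biIdx id) a ha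
  rw [biWeight_biIdx, biVol_biVec, zpow_zero, one_mul] at h2
  have h3 : (biVol n).compLinearMap (biScale n a) (fun i => biVec (biIdx id i)) = 1 := h2
  rw [h3, zpow_zero]
  simp

/-- The vector is multiplied by `a ^ s` under the action of `a` in the unit circle. -/
def HomVec (s : ℤ) (x : Fin n ⊕ Fin n → ℂ) : Prop := ∀ a : ℂ, ‖a‖ = 1 → biScale n a x = a ^ s • x

theorem homVec_inl (i : Fin n) : HomVec 1 (biVec (.inl i)) :=
  fun a ha => biScale_biVec a ha (.inl i)

theorem homVec_inr (i : Fin n) : HomVec (-1) (biVec (.inr i)) :=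
  fun a ha => biScale_biVec a ha (.inr i)

theorem HasWeight.curryLeft {m s : ℤ} {k : ℕ} {Φ : (Fin n ⊕ Fin n → ℂ) [⋀^Fin (k + 1)]→ₗ[ℂ] ℂ}
    (h : HasWeight m Φ) {x : Fin n ⊕ Fin n → ℂ} (hx : HomVec s x) :
    HasWeight (m - s) (Φ.curryLeft x) := by
  intro a ha w
  have ha0 : a ≠ 0 := by
    rintro rfl
    simp at ha
  have h1 := h a ha (Matrix.vecCons x w)
  have h2 : (fun l => biScale n a (Matrix.vecCons x w l)) =
      Matrix.vecCons (a ^ s • x) fun l => biScale n a (w l) := by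
    funext l
    refine Fin.cases ?_ (fun _ => rfl) l
    exact hx a ha
  rw [h2, AlternatingMap.map_vecCons_smul, smul_eq_mul] at h1
  rw [AlternatingMap.curryLeft_apply_apply, AlternatingMap.curryLeft_apply_apply, zpow_sub₀ ha0,
    div_mul_eq_mul_div, ← h1, mul_div_cancel_left₀ _ (zpow_ne_zero s ha0)]

theorem hasWeight_typeProj {k : ℕ} (Φ : (Fin n ⊕ Fin n → ℂ) [⋀^Fin k]→ₗ[ℂ] ℂ) (p q : ℕ) :
    HasWeight ((p : ℤ) - q) (typeProj (biScale n) p q Φ) := by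
  intro a ha w
  suffices h : (typeProj (biScale n) p q Φ).compLinearMap (biScale n a) =
      a ^ ((p : ℤ) - q) • typeProj (biScale n) p q Φ from DFunLike.congr_fun h w
  refine (Pi.basisFun ℂ (Fin n ⊕ Fin n)).ext_alternating fun f _ => ?_
  simp only [Pi.basisFun_apply]
  refine (map_biScale_biVec (typeProj (biScale n) p q Φ) f a ha).trans ?_
  change _ = a ^ ((p : ℤ) - q) * typeProj (biScale n) p q Φ fun i => biVec (f i)
  rw [typeProj_apply_biVec]
  split_ifs with h
  · rw [h.2]
  · rw [mul_zero, mul_zero]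

theorem HasWeight.add {m : ℤ} {k : ℕ} {Φ Ψ : (Fin n ⊕ Fin n → ℂ) [⋀^Fin k]→ₗ[ℂ] ℂ}
    (h : HasWeight m Φ) (h' : HasWeight m Ψ) : HasWeight m (Φ + Ψ) := by
  intro a ha w
  rw [AlternatingMap.add_apply, AlternatingMap.add_apply, h a ha, h' a ha, mul_add]

theorem HasWeight.smul {m : ℤ} {k : ℕ} {Φ : (Fin n ⊕ Fin n → ℂ) [⋀^Fin k]→ₗ[ℂ] ℂ}
    (h : HasWeight m Φ) (r : ℂ) : HasWeight m (r • Φ) := by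
  intro a ha w
  rw [AlternatingMap.smul_apply, AlternatingMap.smul_apply, h a ha, smul_eq_mul, smul_eq_mul,
    mul_left_comm]

theorem HasWeight.sum {ι : Type*} {m : ℤ} {k : ℕ} (s : Finset ι)
    {g : ι → (Fin n ⊕ Fin n → ℂ) [⋀^Fin k]→ₗ[ℂ] ℂ} (h : ∀ i ∈ s, HasWeight m (g i)) :
    HasWeight m (∑ i ∈ s, g i) := by
  intro a ha w
  rw [AlternatingMap.finset_sum_apply, AlternatingMap.finset_sum_apply, Finset.mul_sum]
  exact Finset.sum_congr rfl fun i hi => h i hi a ha w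

theorem HasWeight.typeProj_eq {m : ℤ} {k : ℕ} (hm : |m| ≤ k)
    {Φ : (Fin n ⊕ Fin n → ℂ) [⋀^Fin k]→ₗ[ℂ] ℂ} (h : HasWeight m Φ) (p q : ℕ) :
    typeProj (biScale n) p q Φ = if p + q = k ∧ (p : ℤ) - q = m then Φ else 0 := by
  ext w
  rw [typeProj_apply_of_weight hm fun a ha => h a ha w]
  split_ifs <;> rfl

/-- The projection to type `(p,q)` as a linear map. -/
noncomputable def typeProjₗ (p q k : ℕ) : ((Fin n ⊕ Fin n → ℂ) [⋀^Fin k]→ₗ[ℂ] ℂ) →ₗ[ℂ]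
    ((Fin n ⊕ Fin n → ℂ) [⋀^Fin k]→ₗ[ℂ] ℂ) where
  toFun := typeProj (biScale n) p q
  map_add' Φ Ψ := by
    by_cases h : p + q = k
    · ext w
      rw [AlternatingMap.add_apply, typeProj_apply _ h, typeProj_apply _ h, typeProj_apply _ h]
      simp only [AlternatingMap.add_apply, mul_add, Finset.sum_add_distrib]
    · simp only [typeProj, if_neg h, add_zero]
  map_smul' r Φ := by
    by_cases h : p + q = k
    · ext w
      rw [AlternatingMap.smul_apply, typeProj_apply _ h, typeProj_apply _ h]
      simp only [AlternatingMap.smul_apply, smul_eq_mul, Finset.mul_sum, RingHom.id_apply]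
      refine Finset.sum_congr rfl fun _ _ => ?_
      ring
    · simp only [typeProj, if_neg h, smul_zero]

theorem typeProj_zero (p q : ℕ) {k : ℕ} :
    typeProj (biScale n) p q (0 : (Fin n ⊕ Fin n → ℂ) [⋀^Fin k]→ₗ[ℂ] ℂ) = 0 :=
  map_zero (typeProjₗ p q k)

theorem HasWeight.ceDelBar_eq
    {cW : (Fin n ⊕ Fin n → ℂ) →ₗ[ℂ] (Fin n ⊕ Fin n → ℂ) →ₗ[ℂ] (Fin n ⊕ Fin n → ℂ)} {p : ℕ}
    {Φ : (Fin n ⊕ Fin n → ℂ) [⋀^Fin (2 * p)]→ₗ[ℂ] ℂ} (h : HasWeight 0 Φ) :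
    ceDelBar (biScale n) cW Φ = typeProj (biScale n) p (p + 1) (ceDiff cW Φ) := by
  rw [ceDelBar, Finset.sum_eq_single_of_mem (p, p)
    (Finset.HasAntidiagonal.mem_antidiagonal.2 (by ring))]
  · rw [h.typeProj_eq (by simp), if_pos ⟨by ring, by ring⟩]
  · rintro ⟨a, b⟩ hab hne
    rw [Finset.HasAntidiagonal.mem_antidiagonal] at hab
    rw [h.typeProj_eq (by simp), if_neg]
    · rw [← ceDiffₗ_apply, map_zero, typeProj_zero]
    · rintro ⟨-, h2⟩
      simp only at hab h2
      exact hne (Prod.ext (by simp only; omega) (by simp only; omega))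

/-- If `d ∂̄ Φ = 0` then `∂ ∂̄ Φ = 0`, for `Φ` of type `(p,p)`. -/
theorem HasWeight.ceDel_ceDelBar_eq_zero
    {cW : (Fin n ⊕ Fin n → ℂ) →ₗ[ℂ] (Fin n ⊕ Fin n → ℂ) →ₗ[ℂ] (Fin n ⊕ Fin n → ℂ)} {p : ℕ}
    {Φ : (Fin n ⊕ Fin n → ℂ) [⋀^Fin (2 * p)]→ₗ[ℂ] ℂ} (h : HasWeight 0 Φ)
    (hd : ceDiff cW (typeProj (biScale n) p (p + 1) (ceDiff cW Φ)) = 0) :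
    ceDel (biScale n) cW (ceDelBar (biScale n) cW Φ) = 0 := by
  have h1 := hasWeight_typeProj (ceDiff cW Φ) p (p + 1)
  rw [h.ceDelBar_eq, ceDel]
  refine Finset.sum_eq_zero fun pq _ => ?_
  rw [h1.typeProj_eq (by push_cast; rw [abs_le]; constructor <;> omega)]
  split_ifs
  · rw [hd, typeProj_zero]
  · rw [← ceDiffₗ_apply, map_zero, typeProj_zero]

theorem stdDet_conj (x : Fin n → Fin n → ℂ) :
    stdDet n (fun i l => starRingEnd ℂ (x i l)) = starRingEnd ℂ (stdDet n x) := by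
  rw [stdDet, Module.Basis.det_apply, Module.Basis.det_apply, RingHom.map_det]
  congr 1

theorem stdDet_ne_zero {x : Fin n → Fin n → ℂ} (hx : LinearIndependent ℂ x) : stdDet n x ≠ 0 := by
  have h1 : IsUnit ((Pi.basisFun ℂ (Fin n)).det x) :=
    ((Pi.basisFun ℂ (Fin n)).is_basis_iff_det).1
      ⟨hx, hx.span_eq_top_of_card_eq_finrank' (by simp)⟩
  exact h1.ne_zero

end Volume

/-! ### Contractions of a volume form -/

section Contraction

variable {K W N : Type*} [CommRing K] [AddCommGroup W] [Module K W] [AddCommGroup N] [Module K N]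
  {k : ℕ} (c : W →ₗ[K] W →ₗ[K] W)

/-- Contraction of the first two arguments. -/
def contract₂ (Φ : W [⋀^Fin (k + 2)]→ₗ[K] N) (u v : W) : W [⋀^Fin k]→ₗ[K] N :=
  (AlternatingMap.curryLeft (n := k + 1) Φ u).curryLeft v

/-- Contraction of the first three arguments. -/
def contract₃ (Φ : W [⋀^Fin (k + 3)]→ₗ[K] N) (u v w : W) : W [⋀^Fin k]→ₗ[K] N :=
  (contract₂ (k := k + 1) Φ u v).curryLeft w

/-- Contraction of the first four arguments. -/
def contract₄ (Φ : W [⋀^Fin (k + 4)]→ₗ[K] N) (u v w z : W) : W [⋀^Fin k]→ₗ[K] N :=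
  (contract₃ (k := k + 1) Φ u v w).curryLeft z

theorem lieAct_curryLeft (D : W →ₗ[K] W) (Φ : W [⋀^Fin (k + 1)]→ₗ[K] N) (x : W) :
    lieAct D (Φ.curryLeft x) = (lieAct D Φ).curryLeft x - Φ.curryLeft (D x) := by
  rw [curryLeft_lieAct, add_sub_cancel_left]

theorem ceDiff_curryLeft (Φ : W [⋀^Fin (k + 1)]→ₗ[K] N) (x : W) :
    ceDiff c (Φ.curryLeft x) = -lieAct (bracket c x) Φ - (ceDiff c Φ).curryLeft x := by
  rw [curryLeft_ceDiff]
  abel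

/-- The form is invariant under the adjoint action, and the contractions of it with one vector are
closed: the case of a volume form of a nilpotent Lie algebra. -/
structure IsInvariantVolume (Φ : W [⋀^Fin (k + 1)]→ₗ[K] N) : Prop where
  lieAct_eq : ∀ x, lieAct (bracket c x) Φ = 0
  ceDiff_eq : ∀ x, ceDiff c (Φ.curryLeft x) = 0

variable {c}

theorem IsInvariantVolume.ceDiff_contract₂ {Φ : W [⋀^Fin (k + 2)]→ₗ[K] N}
    (h : IsInvariantVolume (k := k + 1) c Φ) (u v : W) :
    ceDiff c (contract₂ Φ u v) = AlternatingMap.curryLeft (n := k + 1) Φ (bracket c v u) := by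
  rw [contract₂, ceDiff_curryLeft, h.ceDiff_eq, lieAct_curryLeft, h.lieAct_eq]
  ext w
  simp

theorem IsInvariantVolume.lieAct_contract₂ {Φ : W [⋀^Fin (k + 2)]→ₗ[K] N}
    (h : IsInvariantVolume (k := k + 1) c Φ) (x u v : W) :
    lieAct (bracket c x) (contract₂ Φ u v) =
      -contract₂ Φ (bracket c x u) v - contract₂ Φ u (bracket c x v) := by
  rw [contract₂, lieAct_curryLeft, lieAct_curryLeft, h.lieAct_eq]
  ext w
  simp [contract₂]

theorem IsInvariantVolume.ceDiff_contract₃ {Φ : W [⋀^Fin (k + 3)]→ₗ[K] N}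
    (h : IsInvariantVolume (k := k + 2) c Φ) (u v w : W) :
    ceDiff c (contract₃ Φ u v w) = contract₂ (k := k + 1) Φ (bracket c w u) v +
      contract₂ (k := k + 1) Φ u (bracket c w v) -
      contract₂ (k := k + 1) Φ (bracket c v u) w := by
  rw [contract₃, ceDiff_curryLeft, h.lieAct_contract₂, h.ceDiff_contract₂]
  simp only [contract₂]
  abel

theorem IsInvariantVolume.lieAct_contract₃ {Φ : W [⋀^Fin (k + 3)]→ₗ[K] N}
    (h : IsInvariantVolume (k := k + 2) c Φ) (x u v w : W) :
    lieAct (bracket c x) (contract₃ Φ u v w) = -contract₃ Φ (bracket c x u) v w -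
      contract₃ Φ u (bracket c x v) w - contract₃ Φ u v (bracket c x w) := by
  rw [contract₃, lieAct_curryLeft, h.lieAct_contract₂]
  ext y
  simp [contract₃]

theorem IsInvariantVolume.ceDiff_contract₄ {Φ : W [⋀^Fin (k + 4)]→ₗ[K] N}
    (h : IsInvariantVolume (k := k + 3) c Φ) (u v w z : W) :
    ceDiff c (contract₄ Φ u v w z) = contract₃ (k := k + 1) Φ (bracket c z u) v w +
      contract₃ (k := k + 1) Φ u (bracket c z v) w + contract₃ (k := k + 1) Φ u v (bracket c z w) -
      contract₃ (k := k + 1) Φ (bracket c w u) v z - contract₃ (k := k + 1) Φ u (bracket c w v) z +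
      contract₃ (k := k + 1) Φ (bracket c v u) w z := by
  rw [contract₄, ceDiff_curryLeft, h.lieAct_contract₃, h.ceDiff_contract₃]
  ext y
  simp [contract₃, contract₂]
  abel

variable (Φ : W [⋀^Fin (k + 2)]→ₗ[K] N)

theorem contract₂_swap (u v : W) : contract₂ Φ v u = -contract₂ Φ u v := by
  ext w
  have h := Φ.map_swap (Matrix.vecCons u (Matrix.vecCons v w)) (i := 0) (j := 1) (by simp)
  rw [AlternatingMap.neg_apply]
  refine Eq.trans ?_ h
  change Φ (Matrix.vecCons v (Matrix.vecCons u w)) = _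
  congr 1
  funext i
  refine Fin.cases rfl (fun i => Fin.cases rfl (fun i => ?_) i) i
  rw [Function.comp_apply, Equiv.swap_apply_of_ne_of_ne (Fin.succ_ne_zero _)]
  · rfl
  · intro h
    exact Fin.succ_ne_zero i (Fin.succ_injective _ h)

theorem contract₂_self (u : W) : contract₂ Φ u u = 0 := by
  ext w
  exact Φ.map_eq_zero_of_eq (i := 0) (j := 1) _ rfl (by simp)

theorem contract₂_add_left (u u' v : W) :
    contract₂ Φ (u + u') v = contract₂ Φ u v + contract₂ Φ u' v := by
  simp [contract₂]

theorem contract₂_add_right (u v v' : W) :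
    contract₂ Φ u (v + v') = contract₂ Φ u v + contract₂ Φ u v' := by
  simp [contract₂]

theorem contract₂_smul_left (a : K) (u v : W) : contract₂ Φ (a • u) v = a • contract₂ Φ u v := by
  simp [contract₂]

theorem contract₂_smul_right (a : K) (u v : W) : contract₂ Φ u (a • v) = a • contract₂ Φ u v := by
  simp [contract₂]

theorem contract₂_neg_left (u v : W) : contract₂ Φ (-u) v = -contract₂ Φ u v := by
  ext w
  simp [contract₂]

theorem contract₂_neg_right (u v : W) : contract₂ Φ u (-v) = -contract₂ Φ u v := by
  simp [contract₂]

end Contraction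

section StructVolume

/-- The volume form in the case of the structure constants `structBilin`. -/
noncomputable def vol₈ : (Fin 8 ⊕ Fin 8 → ℂ) [⋀^Fin (2 * 6 + 4)]→ₗ[ℂ] ℂ := biVol 8

theorem ceDiff_structBilin_eq_zero (Φ : (Fin 8 ⊕ Fin 8 → ℂ) [⋀^Fin (2 * 6 + 3)]→ₗ[ℂ] ℂ) :
    ceDiff structBilin Φ = 0 := by
  refine (eq_smul_biVol (n := 8) _).trans ?_
  have h : IsClosedTuple (k := 2 * 6 + 4) (biIdx (id : Fin 8 → Fin 8)) := by
    intro t i _ j _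
    exact (bijective_biIdx_id (n := 8)).2 _
  have h2 := h.ceDiff_eq_zero Φ
  rw [h2, zero_smul]

theorem isInvariantVolume_vol₈ : IsInvariantVolume (k := 2 * 6 + 3) structBilin vol₈ := by
  have hdeg : ∀ (x : Fin 8 ⊕ Fin 8 → ℂ) (a : Fin 8 ⊕ Fin 8), bracket structBilin x (biVec a) ∈
      Submodule.span ℂ ((biVec : Fin 8 ⊕ Fin 8 → _) '' {a}ᶜ) := by
    intro x a
    have h1 : ∀ t, (scIdx t).2.2 ≠ (scIdx t).1 ∧ (scIdx t).2.2 ≠ (scIdx t).2.1 := by decide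
    rw [bracket_apply, structBilin_apply, structBilin_apply]
    refine Submodule.sub_mem _ (Submodule.sum_mem _ fun t _ => ?_)
      (Submodule.sum_mem _ fun t _ => ?_)
    · by_cases h : (scIdx t).2.1 = a
      · exact Submodule.smul_mem _ _ (Submodule.subset_span ⟨_, h ▸ (h1 t).2, rfl⟩)
      · simp [biVec, h]
    · by_cases h : (scIdx t).1 = a
      · exact Submodule.smul_mem _ _ (Submodule.subset_span ⟨_, h ▸ (h1 t).1, rfl⟩)
      · simp [biVec, h]
  constructor
  · intro x
    refine (eq_smul_biVol (n := 8) _).trans ?_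
    rw [lieAct_apply, Finset.sum_eq_zero, zero_smul]
    intro j _
    refine AlternatingMap.map_update_eq_zero_of_mem_span _ _ _ ?_
    refine Submodule.span_mono ?_ (hdeg x (biIdx id j))
    rintro _ ⟨a, ha, rfl⟩
    obtain ⟨i, rfl⟩ := bijective_biIdx_id.2 a
    exact ⟨i, fun h => ha (congrArg _ h), rfl⟩
  · exact fun x => ceDiff_structBilin_eq_zero _

/-- The coefficients of the brackets of the `l`s and the `r`s: `[r_j, l_j] = σ_j (l₂ + r₂)`. -/
noncomputable def mixedCoef : Fin 8 → ℂ := ![Complex.I / 2, Complex.I, 0, 0, 0, 0, 0, 0]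

/-- The coefficient of `l₂ + r₂` in `[r_a, l_j]`. -/
noncomputable def mixedCoef₂ (a j : Fin 8) : ℂ := if a = j then mixedCoef j else 0

theorem bracket_swap {K W : Type*} [CommRing K] [AddCommGroup W] [Module K W]
    (c : W →ₗ[K] W →ₗ[K] W) (x y : W) : bracket c y x = -bracket c x y := by
  rw [bracket_apply, bracket_apply, neg_sub]

theorem bracket_inr_inl (a j : Fin 8) :
    bracket structBilin (biVec (.inr a)) (biVec (.inl j)) =
      mixedCoef₂ a j • (biVec (.inl 2) + biVec (.inr 2)) := by
  have h : ∀ a j : Fin 8, ¬(a = j ∧ (j = 0 ∨ j = 1)) → Commute₀ (.inr a) (.inl j) := by decide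
  rw [mixedCoef₂]
  by_cases h1 : a = j ∧ (j = 0 ∨ j = 1)
  · obtain ⟨rfl, rfl | rfl⟩ := h1
    · rw [bracket_swap, bracket_l0_r0, if_pos rfl, neg_smul, neg_neg]
      rfl
    · rw [bracket_swap, bracket_l1_r1, if_pos rfl, neg_smul, neg_neg]
      rfl
  · rw [(h a j h1).bracket_eq_zero]
    split_ifs with h2
    · subst h2
      have h3 : ∀ j : Fin 8, j ≠ 0 → j ≠ 1 → mixedCoef j = 0 := by
        intro j h0 h1
        fin_cases j <;> first | rfl | exact absurd rfl h0 | exact absurd rfl h1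
      rw [h3 a (fun h => h1 ⟨rfl, .inl h⟩) fun h => h1 ⟨rfl, .inr h⟩, zero_smul]
    · rw [zero_smul]

theorem bracket_inl_inr (a j : Fin 8) :
    bracket structBilin (biVec (.inl j)) (biVec (.inr a)) =
      -mixedCoef₂ a j • (biVec (.inl 2) + biVec (.inr 2)) := by
  rw [bracket_swap, bracket_inr_inl, neg_smul]

/-- `l₂`, `r₂` are central, as are the brackets. -/
theorem bracket_central (b : Fin 8 ⊕ Fin 8) :
    bracket structBilin (biVec b) (biVec (.inl 2)) = 0 ∧
      bracket structBilin (biVec b) (biVec (.inr 2)) = 0 := by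
  have h : ∀ b : Fin 8 ⊕ Fin 8, Commute₀ b (.inl 2) ∧ Commute₀ b (.inr 2) := by decide
  exact ⟨(h b).1.bracket_eq_zero, (h b).2.bracket_eq_zero⟩

theorem bracket_central_left (b : Fin 8 ⊕ Fin 8) :
    bracket structBilin (biVec (.inl 2)) (biVec b) = 0 ∧
      bracket structBilin (biVec (.inr 2)) (biVec b) = 0 := by
  rw [bracket_swap, (bracket_central b).1, bracket_swap _ (biVec b), (bracket_central b).2]
  simp

theorem bracket_bracket (x a b : Fin 8 ⊕ Fin 8) : bracket structBilin (biVec x)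
    (bracket structBilin (biVec a) (biVec b)) = 0 := by
  have h : ∀ t x, Commute₀ x (scIdx t).2.2 := by decide
  rw [bracket_biVec_eq, map_sum]
  refine Finset.sum_eq_zero fun t _ => ?_
  rw [map_smul, (h t x).bracket_eq_zero, smul_zero]

theorem bracket_bracket_left (x a b : Fin 8 ⊕ Fin 8) : bracket structBilin
    (bracket structBilin (biVec a) (biVec b)) (biVec x) = 0 := by
  rw [bracket_swap, bracket_bracket, neg_zero]

theorem homVec_sum_smul {n : ℕ} {ι : Type*} (s : Finset ι) {m : ℤ} (g : ι → ℂ)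
    (f : ι → Fin n ⊕ Fin n → ℂ) (h : ∀ i ∈ s, g i ≠ 0 → HomVec m (f i)) :
    HomVec m (∑ i ∈ s, g i • f i) := by
  intro a ha
  rw [map_sum, Finset.smul_sum]
  refine Finset.sum_congr rfl fun i hi => ?_
  by_cases h0 : g i = 0
  · simp [h0]
  · rw [map_smul, h i hi h0 a ha, smul_comm]

theorem homVec_bracket_inl (j k : Fin 8) :
    HomVec 1 (bracket structBilin (biVec (.inl j)) (biVec (.inl k))) := by
  have h : ∀ t, (scIdx t).1.isLeft → (scIdx t).2.1.isLeft → ∃ e, (scIdx t).2.2 = .inl e := by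
    decide
  rw [bracket_biVec_eq]
  refine homVec_sum_smul _ _ _ fun t _ h0 => ?_
  have h1 : ((scIdx t).1 = .inl j ∧ (scIdx t).2.1 = .inl k) ∨
      ((scIdx t).1 = .inl k ∧ (scIdx t).2.1 = .inl j) := by
    by_contra h2
    rw [not_or] at h2
    exact h0 (by rw [if_neg h2.1, if_neg h2.2, sub_zero])
  obtain ⟨e, he⟩ := h t (by rcases h1 with h1 | h1 <;> rw [h1.1] <;> rfl)
    (by rcases h1 with h1 | h1 <;> rw [h1.2] <;> rfl)
  rw [he]
  exact homVec_inl e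

theorem homVec_bracket_inr (j k : Fin 8) :
    HomVec (-1) (bracket structBilin (biVec (.inr j)) (biVec (.inr k))) := by
  have h : ∀ t, (scIdx t).1.isRight → (scIdx t).2.1.isRight → ∃ e, (scIdx t).2.2 = .inr e := by
    decide
  rw [bracket_biVec_eq]
  refine homVec_sum_smul _ _ _ fun t _ h0 => ?_
  have h1 : ((scIdx t).1 = .inr j ∧ (scIdx t).2.1 = .inr k) ∨
      ((scIdx t).1 = .inr k ∧ (scIdx t).2.1 = .inr j) := by
    by_contra h2
    rw [not_or] at h2
    exact h0 (by rw [if_neg h2.1, if_neg h2.2, sub_zero])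
  obtain ⟨e, he⟩ := h t (by rcases h1 with h1 | h1 <;> rw [h1.1] <;> rfl)
    (by rcases h1 with h1 | h1 <;> rw [h1.2] <;> rfl)
  rw [he]
  exact homVec_inr e

end StructVolume

/-! ### Contractions with two vectors of each type -/

section DelDelBar

variable {n : ℕ}

theorem HasWeight.contract₂ {k : ℕ} {m s t : ℤ}
    {Φ : (Fin n ⊕ Fin n → ℂ) [⋀^Fin (k + 2)]→ₗ[ℂ] ℂ} (h : HasWeight m Φ)
    {u v : Fin n ⊕ Fin n → ℂ} (hu : HomVec s u) (hv : HomVec t v) :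
    HasWeight (m - s - t) (contract₂ Φ u v) :=
  (HasWeight.curryLeft (k := k + 1) h hu).curryLeft hv

theorem HasWeight.contract₃ {k : ℕ} {m s t q : ℤ}
    {Φ : (Fin n ⊕ Fin n → ℂ) [⋀^Fin (k + 3)]→ₗ[ℂ] ℂ} (h : HasWeight m Φ)
    {u v w : Fin n ⊕ Fin n → ℂ} (hu : HomVec s u) (hv : HomVec t v) (hw : HomVec q w) :
    HasWeight (m - s - t - q) (contract₃ Φ u v w) :=
  (HasWeight.contract₂ (k := k + 1) h hu hv).curryLeft hw

theorem HasWeight.contract₄ {k : ℕ} {m s t q p : ℤ}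
    {Φ : (Fin n ⊕ Fin n → ℂ) [⋀^Fin (k + 4)]→ₗ[ℂ] ℂ} (h : HasWeight m Φ)
    {u v w z : Fin n ⊕ Fin n → ℂ} (hu : HomVec s u) (hv : HomVec t v) (hw : HomVec q w)
    (hz : HomVec p z) :
    HasWeight (m - s - t - q - p) (contract₄ Φ u v w z) :=
  (HasWeight.contract₃ (k := k + 1) h hu hv hw).curryLeft hz

theorem hasWeight_vol₈ : HasWeight (n := 8) 0 vol₈ := hasWeight_biVol

/-- The contraction with `l_j, r_a, l_k, r_b`. -/
noncomputable def mixedForm (j a k b : Fin 8) : (Fin 8 ⊕ Fin 8 → ℂ) [⋀^Fin (2 * 6)]→ₗ[ℂ] ℂ :=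
  contract₄ vol₈ (biVec (.inl j)) (biVec (.inr a)) (biVec (.inl k)) (biVec (.inr b))

/-- The component of type `(6,7)` of the differential of `mixedForm j a k b`. -/
noncomputable def mixedFormDelBar (j a k b : Fin 8) :
    (Fin 8 ⊕ Fin 8 → ℂ) [⋀^Fin (2 * 6 + 1)]→ₗ[ℂ] ℂ :=
  mixedCoef₂ b j • contract₃ (k := 2 * 6 + 1) vol₈
      (biVec (.inl 2)) (biVec (.inr a)) (biVec (.inl k)) +
    contract₃ (k := 2 * 6 + 1) vol₈ (biVec (.inl j))
      (bracket structBilin (biVec (.inr b)) (biVec (.inr a))) (biVec (.inl k)) +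
    mixedCoef₂ b k • contract₃ (k := 2 * 6 + 1) vol₈
      (biVec (.inl j)) (biVec (.inr a)) (biVec (.inl 2)) +
    mixedCoef₂ a k • contract₃ (k := 2 * 6 + 1) vol₈
      (biVec (.inl j)) (biVec (.inl 2)) (biVec (.inr b)) +
    mixedCoef₂ a j • contract₃ (k := 2 * 6 + 1) vol₈
      (biVec (.inl 2)) (biVec (.inl k)) (biVec (.inr b))

/-- The component of type `(7,6)` of the differential of `mixedForm j a k b`. -/
noncomputable def mixedFormDel (j a k b : Fin 8) :
    (Fin 8 ⊕ Fin 8 → ℂ) [⋀^Fin (2 * 6 + 1)]→ₗ[ℂ] ℂ :=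
  mixedCoef₂ b j • contract₃ (k := 2 * 6 + 1) vol₈
      (biVec (.inr 2)) (biVec (.inr a)) (biVec (.inl k)) +
    -1 • contract₃ (k := 2 * 6 + 1) vol₈
      (bracket structBilin (biVec (.inl k)) (biVec (.inl j))) (biVec (.inr a)) (biVec (.inr b)) +
    mixedCoef₂ b k • contract₃ (k := 2 * 6 + 1) vol₈
      (biVec (.inl j)) (biVec (.inr a)) (biVec (.inr 2)) +
    mixedCoef₂ a k • contract₃ (k := 2 * 6 + 1) vol₈
      (biVec (.inl j)) (biVec (.inr 2)) (biVec (.inr b)) +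
    mixedCoef₂ a j • contract₃ (k := 2 * 6 + 1) vol₈
      (biVec (.inr 2)) (biVec (.inl k)) (biVec (.inr b))

theorem ceDiff_mixedForm (j a k b : Fin 8) : ceDiff structBilin (mixedForm j a k b) =
    mixedFormDelBar j a k b + mixedFormDel j a k b := by
  rw [mixedForm, isInvariantVolume_vol₈.ceDiff_contract₄, bracket_inr_inl, bracket_inr_inl,
    bracket_inl_inr, bracket_inr_inl]
  simp only [mixedFormDelBar, mixedFormDel, contract₃, contract₂, map_add, map_smul,
    AlternatingMap.curryLeft_add, AlternatingMap.curryLeft_smul, LinearMap.add_apply,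
    LinearMap.smul_apply, smul_add]
  module

theorem hasWeight_mixedForm (j a k b : Fin 8) : HasWeight 0 (mixedForm j a k b) :=
  hasWeight_vol₈.contract₄ (homVec_inl j) (homVec_inr a) (homVec_inl k) (homVec_inr b)

theorem hasWeight_mixedFormDelBar (j a k b : Fin 8) :
    HasWeight (-1) (mixedFormDelBar j a k b) := by
  have h := hasWeight_vol₈
  refine ((((HasWeight.smul ?_ _).add ?_).add (HasWeight.smul ?_ _)).add
    (HasWeight.smul ?_ _)).add (HasWeight.smul ?_ _)
  · exact h.contract₃ (homVec_inl _) (homVec_inr _) (homVec_inl _)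
  · exact h.contract₃ (homVec_inl _) (homVec_bracket_inr _ _) (homVec_inl _)
  · exact h.contract₃ (homVec_inl _) (homVec_inr _) (homVec_inl _)
  · exact h.contract₃ (homVec_inl _) (homVec_inl _) (homVec_inr _)
  · exact h.contract₃ (homVec_inl _) (homVec_inl _) (homVec_inr _)

theorem hasWeight_mixedFormDel (j a k b : Fin 8) :
    HasWeight 1 (mixedFormDel j a k b) := by
  have h := hasWeight_vol₈
  rw [mixedFormDel, ← Int.cast_smul_eq_zsmul ℂ]
  refine ((((HasWeight.smul ?_ _).add (HasWeight.smul ?_ _)).add (HasWeight.smul ?_ _)).add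
    (HasWeight.smul ?_ _)).add (HasWeight.smul ?_ _)
  · exact h.contract₃ (homVec_inr _) (homVec_inr _) (homVec_inl _)
  · exact h.contract₃ (homVec_bracket_inl _ _) (homVec_inr _) (homVec_inr _)
  · exact h.contract₃ (homVec_inl _) (homVec_inr _) (homVec_inr _)
  · exact h.contract₃ (homVec_inl _) (homVec_inr _) (homVec_inr _)
  · exact h.contract₃ (homVec_inr _) (homVec_inl _) (homVec_inr _)

/-- `d ∘ pr ∘ d` with `pr` the projection to type `(6,7)`. -/
noncomputable def delDelBar₆ : ((Fin 8 ⊕ Fin 8 → ℂ) [⋀^Fin (2 * 6)]→ₗ[ℂ] ℂ) →ₗ[ℂ]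
    ((Fin 8 ⊕ Fin 8 → ℂ) [⋀^Fin (2 * 6 + 2)]→ₗ[ℂ] ℂ) :=
  ceDiffₗ structBilin (2 * 6 + 1) ∘ₗ typeProjₗ 6 7 (2 * 6 + 1) ∘ₗ ceDiffₗ structBilin (2 * 6)

theorem delDelBar₆_mixedForm_eq (j a k b : Fin 8) : delDelBar₆ (mixedForm j a k b) =
    ceDiff structBilin (mixedFormDelBar j a k b) := by
  have h1 : typeProjₗ 6 7 (2 * 6 + 1) (mixedFormDelBar j a k b) = mixedFormDelBar j a k b :=
    ((hasWeight_mixedFormDelBar j a k b).typeProj_eq (by norm_num) 6 7).trans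
      (if_pos ⟨by norm_num, by norm_num⟩)
  have h2 : typeProjₗ 6 7 (2 * 6 + 1) (mixedFormDel j a k b) = 0 :=
    ((hasWeight_mixedFormDel j a k b).typeProj_eq (by norm_num) 6 7).trans
      (if_neg (by norm_num))
  rw [delDelBar₆, LinearMap.comp_apply, LinearMap.comp_apply, ceDiffₗ_apply, ceDiffₗ_apply,
    ceDiff_mixedForm,
    map_add, h1, h2, add_zero]

/-- Brackets being central, only contractions with two brackets remain. -/
theorem delDelBar₆_mixedForm (j a k b : Fin 8) : delDelBar₆ (mixedForm j a k b) =
    contract₂ (k := 2 * 6 + 2) vol₈ (bracket structBilin (biVec (.inl k)) (biVec (.inl j)))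
      (bracket structBilin (biVec (.inr b)) (biVec (.inr a))) +
    (2 * (mixedCoef₂ a j * mixedCoef₂ b k - mixedCoef₂ b j * mixedCoef₂ a k)) •
      contract₂ (k := 2 * 6 + 2) vol₈ (biVec (.inl 2)) (biVec (.inr 2)) := by
  have h3 := contract₂_swap (k := 2 * 6 + 2) vol₈ (biVec (.inl 2)) (biVec (.inr 2))
  rw [delDelBar₆_mixedForm_eq, mixedFormDelBar]
  simp only [ceDiff_add, ceDiff_smul, IsInvariantVolume.ceDiff_contract₃ isInvariantVolume_vol₈]
  simp only [(bracket_central _).1, (bracket_central_left _).1, bracket_bracket,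
    bracket_bracket_left]
  simp only [bracket_inr_inl, bracket_inl_inr, contract₂_add_left,
    contract₂_smul_left, contract₂_add_right, contract₂_smul_right, contract₂_self, h3]
  have h0 : ∀ u, contract₂ (k := 2 * 6 + 2) vol₈ 0 u = 0 := fun u => by simp [contract₂]
  have h0' : ∀ u, contract₂ (k := 2 * 6 + 2) vol₈ u 0 = 0 := fun u => by simp [contract₂]
  simp only [h0, h0']
  module

end DelDelBar

/-! ### A `∂∂̄`-closed form of type `(6,6)` -/

section Forms

/-- The sum of all contractions of the volume form with `l_j, r_j, l_k, r_k`, which has, on the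
complex subspace spanned by `x`, the value `∑ |ξ_{jk}|²`, where `ξ_{jk} = det (e_j, e_k, x)`, with
four terms subtracted, which contribute `-|ξ₃₄ + ξ₅₆|²`. The correction cancels the contribution of
the second factor to `∂∂̄`, and is small enough not to destroy positivity. -/
noncomputable def sixSum : (Fin 8 ⊕ Fin 8 → ℂ) [⋀^Fin (2 * 6)]→ₗ[ℂ] ℂ :=
  ∑ j, ∑ k, mixedForm j j k k - mixedForm 3 3 4 4 - mixedForm 5 5 6 6 - mixedForm 3 5 4 6 -
    mixedForm 5 3 6 4

/-- In this and the following sum, the terms with `l₂, r₂` cancel: this is due to the coefficient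
`2` in `∂̄φ₃ = (i/2) (φ₁ ∧ φ̄₁ + 2 φ₂ ∧ φ̄₂)`. -/
theorem sum_mixedCoef : ∑ j, ∑ k, 2 * (mixedCoef₂ j j * mixedCoef₂ k k -
    mixedCoef₂ k j * mixedCoef₂ j k) = -2 := by
  have h : ∀ j k : Fin 8, mixedCoef₂ k j * mixedCoef₂ j k =
      if j = k then mixedCoef k * mixedCoef k else 0 := by
    intro j k
    unfold mixedCoef₂
    by_cases h : j = k
    · simp [h]
    · simp [h, Ne.symm h]
  have h2 : ∀ j, mixedCoef₂ j j = mixedCoef j := fun j => if_pos rfl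
  simp only [h, h2, mul_sub, Finset.sum_sub_distrib]
  simp [Fin.sum_univ_eight, mixedCoef]
  ring_nf
  simp

theorem sum_contract₂_bracket : ∑ j, ∑ k, contract₂ (k := 2 * 6 + 2) vol₈
      (bracket structBilin (biVec (.inl k)) (biVec (.inl j)))
      (bracket structBilin (biVec (.inr k)) (biVec (.inr j))) =
    (2 : ℂ) • contract₂ (k := 2 * 6 + 2) vol₈ (biVec (.inl 2)) (biVec (.inr 2)) +
      (4 : ℂ) • contract₂ (k := 2 * 6 + 2) vol₈ (biVec (.inl 7)) (biVec (.inr 7)) := by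
  have h0 : ∀ jk : Fin 8 × Fin 8, jk ∉ ({(0, 1), (1, 0), (3, 4), (4, 3), (5, 6), (6, 5)} :
      Finset (Fin 8 × Fin 8)) → Commute₀ (.inl jk.2) (.inl jk.1) := by decide
  rw [← Finset.sum_product', Finset.univ_product_univ, ← Finset.sum_subset (Finset.subset_univ
    ({(0, 1), (1, 0), (3, 4), (4, 3), (5, 6), (6, 5)} : Finset (Fin 8 × Fin 8)))]
  · rw [Finset.sum_insert (by decide), Finset.sum_insert (by decide),
      Finset.sum_insert (by decide), Finset.sum_insert (by decide), Finset.sum_insert (by decide),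
      Finset.sum_singleton]
    simp only
    rw [bracket_swap _ (biVec (.inl 0)) (biVec (.inl 1)), bracket_l0_l1,
      bracket_swap _ (biVec (.inr 0)) (biVec (.inr 1)), bracket_r0_r1,
      bracket_swap _ (biVec (.inl 3)) (biVec (.inl 4)), bracket_l3_l4,
      bracket_swap _ (biVec (.inr 3)) (biVec (.inr 4)), bracket_r3_r4,
      bracket_swap _ (biVec (.inl 5)) (biVec (.inl 6)), bracket_l5_l6,
      bracket_swap _ (biVec (.inr 5)) (biVec (.inr 6)), bracket_r5_r6]
    simp only [contract₂_neg_left, contract₂_neg_right, neg_neg]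
    module
  · intro jk _ hjk
    rw [(h0 jk hjk).bracket_eq_zero]
    simp [contract₂]

theorem delDelBar₆_sixSum : delDelBar₆ sixSum = 0 := by
  have h0 : mixedCoef₂ 3 3 = 0 ∧ mixedCoef₂ 5 5 = 0 ∧ mixedCoef₂ 4 3 = 0 ∧ mixedCoef₂ 5 3 = 0 ∧
      mixedCoef₂ 6 5 = 0 ∧ mixedCoef₂ 3 5 = 0 ∧ mixedCoef₂ 6 3 = 0 ∧ mixedCoef₂ 4 5 = 0 := by
    refine ⟨?_, ?_, ?_, ?_, ?_, ?_, ?_, ?_⟩ <;> simp [mixedCoef₂, mixedCoef]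
  obtain ⟨h1, h2, h3, h4, h5, h6, h7, h8⟩ := h0
  simp only [sixSum, map_sub, map_sum, delDelBar₆_mixedForm, Finset.sum_add_distrib,
    ← Finset.sum_smul, h1, h2, h3, h4, h5, h6, h7, h8]
  rw [sum_contract₂_bracket, sum_mixedCoef,
      bracket_swap _ (biVec (.inl 3)) (biVec (.inl 4)), bracket_l3_l4,
      bracket_swap _ (biVec (.inr 3)) (biVec (.inr 4)), bracket_r3_r4,
      bracket_swap _ (biVec (.inl 5)) (biVec (.inl 6)), bracket_l5_l6,
      bracket_swap _ (biVec (.inr 5)) (biVec (.inr 6)), bracket_r5_r6]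
  simp only [neg_neg]
  module

/-- A transverse form of type `(6,6)` which is `∂∂̄`-closed. -/
noncomputable def formSix : (Fin 8 ⊕ Fin 8 → ℂ) [⋀^Fin (2 * 6)]→ₗ[ℂ] ℂ :=
  ((-2 * Complex.I) ^ 6)⁻¹ • sixSum

theorem hasWeight_sixSum : HasWeight 0 sixSum := by
  have h : ∀ {Φ Ψ : (Fin 8 ⊕ Fin 8 → ℂ) [⋀^Fin (2 * 6)]→ₗ[ℂ] ℂ}, HasWeight 0 Φ → HasWeight 0 Ψ →
      HasWeight 0 (Φ - Ψ) := by
    intro Φ Ψ h1 h2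
    rw [sub_eq_add_neg, ← neg_one_smul ℂ]
    exact h1.add (h2.smul _)
  have hs : HasWeight 0 (∑ j, ∑ k, mixedForm j j k k) :=
    HasWeight.sum _ fun j _ => HasWeight.sum _ fun k _ => hasWeight_mixedForm _ _ _ _
  exact h (h (h (h hs (hasWeight_mixedForm _ _ _ _)) (hasWeight_mixedForm _ _ _ _))
    (hasWeight_mixedForm _ _ _ _)) (hasWeight_mixedForm _ _ _ _)

theorem hasWeight_formSix : HasWeight 0 formSix := hasWeight_sixSum.smul _

theorem ceDel_ceDelBar_formSix :
    ceDel (biScale 8) structBilin (ceDelBar (biScale 8) structBilin formSix) = 0 := by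
  refine hasWeight_formSix.ceDel_ceDelBar_eq_zero ?_
  change delDelBar₆ formSix = 0
  rw [formSix, map_smul, delDelBar₆_sixSum, smul_zero]

theorem conjForm_mixedForm (j a k b : Fin 8) :
    conjForm (mixedForm j a k b) = mixedForm a j b k := by
  have h0 : conjForm (n := 8) vol₈ = vol₈ := conjForm_biVol (by decide)
  have h1 := conjForm_curryLeft (conjForm_curryLeft (conjForm_curryLeft (conjForm_curryLeft h0
    (biVec (.inl j))) (biVec (.inr a))) (biVec (.inl k))) (biVec (.inr b))
  refine h1.trans ?_
  rw [biConj_inl, biConj_inr, biConj_inl, biConj_inr]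
  change contract₂ (contract₂ (k := 2 * 6 + 2) vol₈ _ _) _ _ =
    contract₂ (contract₂ (k := 2 * 6 + 2) vol₈ _ _) _ _
  rw [contract₂_swap vol₈, contract₂_swap (-_)]
  ext w
  simp [contract₂]

theorem conjForm_sub {n k : ℕ} (Φ Ψ : (Fin n ⊕ Fin n → ℂ) [⋀^Fin k]→ₗ[ℂ] ℂ) :
    conjForm (Φ - Ψ) = conjForm Φ - conjForm Ψ := by
  ext w
  simp [conjForm_apply]

theorem conjForm_formSix : conjForm formSix = formSix := by
  have h : starRingEnd ℂ ((-2 * Complex.I) ^ 6)⁻¹ = ((-2 * Complex.I) ^ 6)⁻¹ := by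
    simp [mul_pow, Even.neg_pow (by decide : Even 6), map_ofNat (starRingEnd ℂ) 2]
  rw [formSix, conjForm_smul, h, sixSum]
  simp only [conjForm_sub, conjForm_sum, conjForm_mixedForm]
  exact congrArg _ (sub_right_comm _ _ _)

theorem mixedForm_interleave (j a k b : Fin 8) (x y : Fin 6 → Fin 8 → ℂ) :
    mixedForm j a k b (interleave (fun i => leftVec (x i)) fun i => rightVec (y i)) =
      stdDet 8 (Matrix.vecCons (Pi.single j 1) (Matrix.vecCons (Pi.single k 1) x)) *
      stdDet 8 (Matrix.vecCons (Pi.single a 1) (Matrix.vecCons (Pi.single b 1) y)) := by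
  rw [← biVol_interleave]
  have h : ∀ {p : ℕ} (f : (Fin 8 → ℂ) →ₗ[ℂ] (Fin 8 ⊕ Fin 8 → ℂ)) (v : Fin 8 → ℂ)
      (x : Fin p → Fin 8 → ℂ), (fun i => f (Matrix.vecCons v x i)) =
        Matrix.vecCons (f v) fun i => f (x i) := by
    intro p f v x
    funext i
    exact Fin.cases rfl (fun _ => rfl) i
  rw [h, h, h, h, interleave_cons, interleave_cons, leftVec_single, leftVec_single,
    rightVec_single, rightVec_single]
  simp only [mixedForm, contract₄, contract₃, contract₂, AlternatingMap.curryLeft_apply_apply]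
  rfl

theorem conj_single (j : Fin 8) :
    (fun l => starRingEnd ℂ ((Pi.single j 1 : Fin 8 → ℂ) l)) = Pi.single j 1 := by
  funext l
  simp [Pi.single_apply, apply_ite (starRingEnd ℂ)]

end Forms

/-! ### Positivity of the form of type `(6,6)` -/

section Positivity

/-- Positivity of a form of type `(p,p)` on the complexification, in terms of the restriction to a
complex subspace of dimension `p`. The factor `(-2i) ^ p` is that of `map_interleave_add_sub`, which
expresses values on tuples `x₀, i x₀, x₁, i x₁, …`. -/
def IsPositiveForm {n : ℕ} (p : ℕ) (Θ : (Fin n ⊕ Fin n → ℂ) [⋀^Fin (2 * p)]→ₗ[ℂ] ℂ) : Prop :=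
  ∀ x : Fin p → Fin n → ℂ, LinearIndependent ℂ x →
    0 < ((-2 * Complex.I) ^ p * Θ (interleave (fun i => leftVec (x i))
      fun i => rightVec fun l => starRingEnd ℂ (x i l))).re

theorem AlternatingMap.map_vecCons_eq_zero_of_mem_span {W : Type*} [AddCommGroup W] [Module ℂ W]
    {k : ℕ} (Φ : W [⋀^Fin (k + 1)]→ₗ[ℂ] ℂ) {x : Fin k → W} {z : W}
    (hz : z ∈ Submodule.span ℂ (Set.range x)) : Φ (Matrix.vecCons z x) = 0 := by
  have h := Φ.map_update_eq_zero_of_mem_span (Matrix.vecCons 0 x) 0 (x := z)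
    (Submodule.span_mono (by
      rintro _ ⟨i, rfl⟩
      exact ⟨i.succ, Fin.succ_ne_zero i, rfl⟩) hz)
  rwa [vecCons_update_zero] at h

theorem AlternatingMap.exists_single_ne_zero {n k : ℕ} (D : (Fin n → ℂ) [⋀^Fin (k + 1)]→ₗ[ℂ] ℂ)
    {x : Fin k → Fin n → ℂ} {u : Fin n → ℂ} (h : D (Matrix.vecCons u x) ≠ 0) :
    ∃ j, D (Matrix.vecCons (Pi.single j 1) x) ≠ 0 := by
  by_contra! h0
  refine h ?_
  rw [pi_eq_sum_univ' u]
  refine (congrArg (fun f => f x) (map_sum D.curryLeft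
    (fun i => u i • (Pi.single i 1 : Fin n → ℂ)) Finset.univ)).trans ?_
  rw [AlternatingMap.finset_sum_apply]
  refine Finset.sum_eq_zero fun i _ => ?_
  rw [map_smul, AlternatingMap.smul_apply]
  exact (congrArg (u i • ·) (h0 i)).trans (smul_zero _)

theorem AlternatingMap.exists_single_single_ne_zero {n k : ℕ}
    (D : (Fin n → ℂ) [⋀^Fin (k + 2)]→ₗ[ℂ] ℂ) {x : Fin k → Fin n → ℂ} {u v : Fin n → ℂ}
    (h : D (Matrix.vecCons v (Matrix.vecCons u x)) ≠ 0) :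
    ∃ i j, D (Matrix.vecCons (Pi.single i 1) (Matrix.vecCons (Pi.single j 1) x)) ≠ 0 := by
  obtain ⟨i, hi⟩ := AlternatingMap.exists_single_ne_zero D h
  obtain ⟨j, hj⟩ := AlternatingMap.exists_single_ne_zero (D.curryLeft (Pi.single i 1)) hi
  exact ⟨i, j, hj⟩

theorem exists_stdDet_cons_ne_zero {x : Fin 7 → Fin 8 → ℂ} (hx : LinearIndependent ℂ x) :
    ∃ j : Fin 8, stdDet 8 (Matrix.vecCons (Pi.single j 1) x) ≠ 0 := by
  have hlt : 7 < Module.finrank ℂ (Fin 8 → ℂ) := by simp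
  obtain ⟨u, hu⟩ := exists_linearIndependent_cons_of_lt_finrank hx hlt
  exact AlternatingMap.exists_single_ne_zero (k := 7) (stdDet 8) (stdDet_ne_zero hu)

theorem exists_stdDet_cons_cons_ne_zero {x : Fin 6 → Fin 8 → ℂ} (hx : LinearIndependent ℂ x) :
    ∃ j k : Fin 8, stdDet 8 (Matrix.vecCons (Pi.single j 1)
      (Matrix.vecCons (Pi.single k 1) x)) ≠ 0 := by
  have hlt : 6 < Module.finrank ℂ (Fin 8 → ℂ) := by simp
  obtain ⟨u, hu⟩ := exists_linearIndependent_cons_of_lt_finrank hx hlt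
  have hlt' : 7 < Module.finrank ℂ (Fin 8 → ℂ) := by simp
  obtain ⟨v, hv⟩ := exists_linearIndependent_cons_of_lt_finrank hu hlt'
  exact AlternatingMap.exists_single_single_ne_zero (k := 6) (stdDet 8) (stdDet_ne_zero hv)

theorem AlternatingMap.map_vecCons_vecCons_eq_zero {W : Type*} [AddCommGroup W] [Module ℂ W]
    {k : ℕ} (D : W [⋀^Fin (k + 2)]→ₗ[ℂ] ℂ) {x : Fin k → W} {u v w z : W}
    (h : D (Matrix.vecCons u (Matrix.vecCons v x)) ≠ 0)
    (h1 : D (Matrix.vecCons u (Matrix.vecCons w x)) = 0)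
    (h2 : D (Matrix.vecCons v (Matrix.vecCons w x)) = 0)
    (hw : w ∈ Submodule.span ℂ (Set.range (Matrix.vecCons u (Matrix.vecCons v x)))) :
    D (Matrix.vecCons w (Matrix.vecCons z x)) = 0 := by
  rw [Matrix.range_cons, Matrix.range_cons, Set.singleton_union, Set.singleton_union,
    Submodule.mem_span_insert] at hw
  obtain ⟨a, y, hy', rfl⟩ := hw
  obtain ⟨b, y, hy, rfl⟩ := Submodule.mem_span_insert.1 hy'
  have hadd : ∀ t, D (Matrix.vecCons t (Matrix.vecCons (a • u + (b • v + y)) x)) =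
      a * D (Matrix.vecCons t (Matrix.vecCons u x)) +
        b * D (Matrix.vecCons t (Matrix.vecCons v x)) := by
    intro t
    have h4 : D.curryLeft t (Matrix.vecCons y x) = 0 :=
      AlternatingMap.map_vecCons_eq_zero_of_mem_span (D.curryLeft t) hy
    have h5 : D.curryLeft t (Matrix.vecCons (a • u + (b • v + y)) x) =
        a * D.curryLeft t (Matrix.vecCons u x) + b * D.curryLeft t (Matrix.vecCons v x) := by
      rw [AlternatingMap.map_vecCons_add, AlternatingMap.map_vecCons_add,
        AlternatingMap.map_vecCons_smul, AlternatingMap.map_vecCons_smul, h4, add_zero,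
        smul_eq_mul, smul_eq_mul]
    exact h5
  rw [hadd, AlternatingMap.map_vecCons_self, mul_zero, zero_add] at h1
  rw [hadd, AlternatingMap.map_vecCons_self, mul_zero, add_zero,
    AlternatingMap.map_vecCons_swap] at h2
  have hb : b = 0 := (mul_eq_zero.1 h1).resolve_right h
  have ha : a = 0 := (mul_eq_zero.1 h2).resolve_right (neg_ne_zero.2 h)
  subst ha hb
  rw [zero_smul, zero_smul, zero_add, zero_add, ← neg_eq_zero, ← AlternatingMap.map_vecCons_swap]
  exact AlternatingMap.map_vecCons_eq_zero_of_mem_span (D.curryLeft z) hy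

/-- A case of the Plücker relations: `ξ_{uv} ξ_{wz} = 0` if `ξ_{uw} = ξ_{vw} = 0`, where
`ξ_{uv} = det (u, v, x)`. -/
theorem stdDet_cons_cons_eq_zero {x : Fin 6 → Fin 8 → ℂ} {u v w z : Fin 8 → ℂ}
    (h : stdDet 8 (Matrix.vecCons u (Matrix.vecCons v x)) ≠ 0)
    (h1 : stdDet 8 (Matrix.vecCons u (Matrix.vecCons w x)) = 0)
    (h2 : stdDet 8 (Matrix.vecCons v (Matrix.vecCons w x)) = 0) :
    stdDet 8 (Matrix.vecCons w (Matrix.vecCons z x)) = 0 := by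
  have hli : LinearIndependent ℂ (Matrix.vecCons u (Matrix.vecCons v x) : Fin 8 → Fin 8 → ℂ) := by
    by_contra hd
    exact h ((stdDet 8).map_linearDependent _ hd)
  refine AlternatingMap.map_vecCons_vecCons_eq_zero (k := 6) (stdDet 8) h h1 h2 ?_
  have h3 := hli.span_eq_top_of_card_eq_finrank' (by simp)
  have h4 : w ∈ (⊤ : Submodule ℂ (Fin 8 → ℂ)) := trivial
  rw [← h3] at h4
  exact h4

/-- With `ξ_{jk} = det (e_j, e_k, x)`, the value on the subspace spanned by `x` is
`∑ |ξ_{jk}|² - |ξ₃₄ + ξ₅₆|²`. Each pair occurs twice in the sum, so this is nonnegative, and it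
vanishes only if `ξ₃₄ = ξ₅₆` and `ξ_{jk} = 0` for all other pairs. Then `ξ₃₄ ξ₅₆ = 0` by a Plücker
relation, and all `ξ_{jk}` are zero, contrary to the independence of `x`. -/
theorem isPositiveForm_formSix : IsPositiveForm 6 formSix := by
  intro x hx
  set ξ : Fin 8 → Fin 8 → ℂ := fun j k =>
    stdDet 8 (Matrix.vecCons (Pi.single j 1) (Matrix.vecCons (Pi.single k 1) x)) with hξ
  have hval : ∀ j a k b, mixedForm j a k b (interleave (fun i => leftVec (x i))
      fun i => rightVec fun l => starRingEnd ℂ (x i l)) = ξ j k * starRingEnd ℂ (ξ a b) := by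
    intro j a k b
    rw [mixedForm_interleave, hξ]
    simp only
    rw [← stdDet_conj]
    congr 2
    funext i
    refine Fin.cases (conj_single a).symm (fun i => ?_) i
    exact Fin.cases (conj_single b).symm (fun _ => rfl) i
  have hanti : ∀ j k, ξ k j = -ξ j k := fun j k =>
    AlternatingMap.map_vecCons_swap (k := 6) (stdDet 8) _ _ x
  have hI : ((-2 * Complex.I) ^ 6 : ℂ) ≠ 0 := by simp
  have h1 : ((-2 * Complex.I) ^ 6 * formSix (interleave (fun i => leftVec (x i))
      fun i => rightVec fun l => starRingEnd ℂ (x i l))).re =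
      ∑ jk : Fin 8 × Fin 8, Complex.normSq (ξ jk.1 jk.2) -
        Complex.normSq (ξ 3 4 + ξ 5 6) := by
    rw [formSix, AlternatingMap.smul_apply, smul_eq_mul, mul_inv_cancel_left₀ hI, sixSum]
    simp only [AlternatingMap.sub_apply, AlternatingMap.finset_sum_apply, hval, Complex.sub_re,
      Complex.re_sum, Complex.mul_conj, Complex.ofReal_re]
    rw [Complex.normSq_add, ← Finset.univ_product_univ, Finset.sum_product,
      ← Complex.conj_re (ξ 5 6 * _), map_mul, Complex.conj_conj, mul_comm (starRingEnd ℂ _)]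
    ring
  have h2 : Complex.normSq (ξ 3 4 + ξ 5 6) + Complex.normSq (ξ 3 4 - ξ 5 6) =
      Complex.normSq (ξ 3 4) + Complex.normSq (ξ 4 3) + Complex.normSq (ξ 5 6) +
        Complex.normSq (ξ 6 5) := by
    rw [hanti 3 4, hanti 5 6, Complex.normSq_neg, Complex.normSq_neg, Complex.normSq_add,
      Complex.normSq_sub]
    ring
  set T : Finset (Fin 8 × Fin 8) := {(3, 4), (4, 3), (5, 6), (6, 5)} with hT
  have hTsum : ∑ jk ∈ T, Complex.normSq (ξ jk.1 jk.2) = Complex.normSq (ξ 3 4) +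
      Complex.normSq (ξ 4 3) + Complex.normSq (ξ 5 6) + Complex.normSq (ξ 6 5) := by
    rw [hT, Finset.sum_insert (by decide), Finset.sum_insert (by decide),
      Finset.sum_insert (by decide), Finset.sum_singleton]
    ring
  rw [h1]
  by_contra! hle
  have hothers : ∀ jk ∉ T, ξ jk.1 jk.2 = 0 := by
    intro jk hjk
    have h3 := Finset.sum_le_sum_of_subset_of_nonneg (Finset.subset_univ (insert jk T))
      fun i _ _ => Complex.normSq_nonneg (ξ i.1 i.2)
    rw [Finset.sum_insert hjk, hTsum, ← h2] at h3
    have h4 := Complex.normSq_nonneg (ξ 3 4 - ξ 5 6)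
    have h5 := Complex.normSq_nonneg (ξ jk.1 jk.2)
    exact Complex.normSq_eq_zero.1 (by linarith)
  have hab : ξ 3 4 = ξ 5 6 := by
    have h3 := Finset.sum_le_sum_of_subset_of_nonneg (Finset.subset_univ T)
      fun i _ _ => Complex.normSq_nonneg (ξ i.1 i.2)
    rw [hTsum, ← h2] at h3
    have h4 := Complex.normSq_nonneg (ξ 3 4 - ξ 5 6)
    exact sub_eq_zero.1 (Complex.normSq_eq_zero.1 (by linarith))
  have h34 : ξ 3 4 ≠ 0 := by
    intro h0
    obtain ⟨j, k, hjk⟩ := exists_stdDet_cons_cons_ne_zero hx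
    refine hjk ?_
    change ξ j k = 0
    by_cases hm : (j, k) ∈ T
    · simp only [hT, Finset.mem_insert, Finset.mem_singleton, Prod.mk.injEq] at hm
      rcases hm with ⟨rfl, rfl⟩ | ⟨rfl, rfl⟩ | ⟨rfl, rfl⟩ | ⟨rfl, rfl⟩
      · exact h0
      · rw [hanti 3 4, h0, neg_zero]
      · rw [← hab, h0]
      · rw [hanti 5 6, ← hab, h0, neg_zero]
    · exact hothers (j, k) hm
  exact h34 (hab.trans (stdDet_cons_cons_eq_zero h34 (hothers (3, 5) (by decide))
    (hothers (4, 5) (by decide))))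

end Positivity

/-! ### A transverse form of type `(7,7)` and a closed form with this component -/

section Seven

/-- The volume form in the case of the structure constants `structBilin`, in the degree suitable for
contractions with two vectors. -/
noncomputable def vol₈' : (Fin 8 ⊕ Fin 8 → ℂ) [⋀^Fin (2 * 7 + 2)]→ₗ[ℂ] ℂ := biVol 8

/-- The contraction with `l_j, r_j`, summed over `j`. -/
noncomputable def sevenSum : (Fin 8 ⊕ Fin 8 → ℂ) [⋀^Fin (2 * 7)]→ₗ[ℂ] ℂ :=
  ∑ j, contract₂ vol₈' (biVec (.inl j)) (biVec (.inr j))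

/-- A transverse form of type `(7,7)`. -/
noncomputable def formSeven : (Fin 8 ⊕ Fin 8 → ℂ) [⋀^Fin (2 * 7)]→ₗ[ℂ] ℂ :=
  ((-2 * Complex.I) ^ 7)⁻¹ • sevenSum

/-- The corrections of types `(6,8)` and `(8,6)` which make `sevenSum` closed: the differential of
`sevenSum` is `3i/2` times the contraction with `l₂ + r₂`, and `l₂ = [l₁, l₀]`, `r₂ = [r₁, r₀]`. -/
noncomputable def sevenCorrection : (Fin 8 ⊕ Fin 8 → ℂ) [⋀^Fin (2 * 7)]→ₗ[ℂ] ℂ :=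
  (3 * Complex.I / 2) • contract₂ vol₈' (biVec (.inl 0)) (biVec (.inl 1)) +
    (3 * Complex.I / 2) • contract₂ vol₈' (biVec (.inr 0)) (biVec (.inr 1))

/-- A real closed form with the component `formSeven` of type `(7,7)`. -/
noncomputable def closedFormSeven : (Fin 8 ⊕ Fin 8 → ℂ) [⋀^Fin (2 * 7)]→ₗ[ℂ] ℂ :=
  ((-2 * Complex.I) ^ 7)⁻¹ • (sevenSum - sevenCorrection)

theorem isPositiveForm_formSeven : IsPositiveForm 7 formSeven := by
  intro x hx
  have hI : ((-2 * Complex.I) ^ 7 : ℂ) ≠ 0 := by simp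
  have hval : ∀ j, contract₂ vol₈' (biVec (.inl j)) (biVec (.inr j))
      (interleave (fun i => leftVec (x i)) fun i => rightVec fun l => starRingEnd ℂ (x i l)) =
      stdDet 8 (Matrix.vecCons (Pi.single j 1) x) *
        starRingEnd ℂ (stdDet 8 (Matrix.vecCons (Pi.single j 1) x)) := by
    intro j
    rw [← stdDet_conj]
    have h3 : ∀ (f : (Fin 8 → ℂ) →ₗ[ℂ] (Fin 8 ⊕ Fin 8 → ℂ)) (v : Fin 8 → ℂ)
        (x : Fin 7 → Fin 8 → ℂ), (fun i => f (Matrix.vecCons v x i)) =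
          Matrix.vecCons (f v) fun i => f (x i) := by
      intro f v x
      funext i
      exact Fin.cases rfl (fun _ => rfl) i
    have h4 : (fun i l => starRingEnd ℂ ((Matrix.vecCons (Pi.single j 1) x :
        Fin 8 → Fin 8 → ℂ) i l)) =
          Matrix.vecCons (Pi.single j 1) fun i l => starRingEnd ℂ (x i l) := by
      funext i
      exact Fin.cases (conj_single j) (fun _ => rfl) i
    rw [h4]
    refine Eq.trans ?_ (biVol_interleave _ _)
    rw [h3, h3, interleave_cons, leftVec_single, rightVec_single]
    simp only [contract₂, AlternatingMap.curryLeft_apply_apply]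
    rfl
  rw [formSeven, AlternatingMap.smul_apply, smul_eq_mul, mul_inv_cancel_left₀ hI, sevenSum,
    AlternatingMap.finset_sum_apply]
  simp only [hval, Complex.re_sum, Complex.mul_conj, Complex.ofReal_re]
  obtain ⟨j, hj⟩ := exists_stdDet_cons_ne_zero hx
  exact Finset.sum_pos' (fun i _ => Complex.normSq_nonneg _)
    ⟨j, Finset.mem_univ j, Complex.normSq_pos.2 hj⟩

theorem hasWeight_contract₂_vol₈' {s t : ℤ} {u v : Fin 8 ⊕ Fin 8 → ℂ} (hu : HomVec s u)
    (hv : HomVec t v) : HasWeight (0 - s - t) (contract₂ vol₈' u v) :=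
  HasWeight.contract₂ (hasWeight_biVol (n := 8)) hu hv

theorem hasWeight_formSeven : HasWeight 0 formSeven :=
  (HasWeight.sum _ fun j _ => hasWeight_contract₂_vol₈' (homVec_inl j) (homVec_inr j)).smul _

theorem typeProj_closedFormSeven : typeProj (biScale 8) 7 7 closedFormSeven = formSeven := by
  have h1 : ∀ j, typeProjₗ 7 7 (2 * 7) (contract₂ vol₈' (biVec (.inl j)) (biVec (.inr j))) =
      contract₂ vol₈' (biVec (.inl j)) (biVec (.inr j)) := fun j =>
    ((hasWeight_contract₂_vol₈' (homVec_inl j) (homVec_inr j)).typeProj_eq (by norm_num) 7 7).trans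
      (if_pos ⟨by norm_num, by norm_num⟩)
  have h2 : typeProjₗ 7 7 (2 * 7) (contract₂ vol₈' (biVec (.inl 0)) (biVec (.inl 1))) = 0 :=
    ((hasWeight_contract₂_vol₈' (homVec_inl 0) (homVec_inl 1)).typeProj_eq (by norm_num) 7 7).trans
      (if_neg (by norm_num))
  have h3 : typeProjₗ 7 7 (2 * 7) (contract₂ vol₈' (biVec (.inr 0)) (biVec (.inr 1))) = 0 :=
    ((hasWeight_contract₂_vol₈' (homVec_inr 0) (homVec_inr 1)).typeProj_eq (by norm_num) 7 7).trans
      (if_neg (by norm_num))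
  change typeProjₗ 7 7 (2 * 7) closedFormSeven = formSeven
  rw [closedFormSeven, sevenSum, sevenCorrection, map_smul, map_sub, map_add, map_smul, map_smul,
    h2, h3, map_sum, formSeven, sevenSum]
  simp only [h1, smul_zero, add_zero, sub_zero]

theorem isInvariantVolume_vol₈' : IsInvariantVolume (k := 2 * 7 + 1) structBilin vol₈' :=
  isInvariantVolume_vol₈

theorem ceDiff_closedFormSeven : ceDiff structBilin closedFormSeven = 0 := by
  have h : ∀ u v, ceDiffₗ structBilin (2 * 7) (contract₂ vol₈' u v) =
      AlternatingMap.curryLeft (n := 2 * 7 + 1) vol₈' (bracket structBilin v u) :=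
    isInvariantVolume_vol₈'.ceDiff_contract₂
  have h1 : ∑ j, mixedCoef₂ j j = 3 * Complex.I / 2 := by
    simp [mixedCoef₂, mixedCoef, Fin.sum_univ_eight]
    ring
  rw [ceDiff_eq_linearMap, closedFormSeven, sevenSum, sevenCorrection, map_smul, map_sub, map_add,
    map_smul, map_smul, map_sum]
  simp only [h, bracket_inr_inl]
  rw [bracket_swap _ (biVec (.inl 0)) (biVec (.inl 1)), bracket_l0_l1,
    bracket_swap _ (biVec (.inr 0)) (biVec (.inr 1)), bracket_r0_r1, neg_neg, neg_neg]
  simp only [map_smul, ← Finset.sum_smul, h1, map_add]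
  rw [smul_add, sub_self, smul_zero]

theorem conjForm_contract₂ (u v : Fin 8 ⊕ Fin 8 → ℂ) :
    conjForm (contract₂ vol₈' u v) = contract₂ vol₈' (biConj u) (biConj v) := by
  have h0 : conjForm (n := 8) vol₈' = vol₈' := conjForm_biVol (by decide)
  exact conjForm_curryLeft (conjForm_curryLeft h0 u) v

theorem conj_pow_seven : starRingEnd ℂ ((-2 * Complex.I) ^ 7)⁻¹ = -((-2 * Complex.I) ^ 7)⁻¹ := by
  simp [mul_pow, Odd.neg_pow (by decide : Odd 7), map_ofNat (starRingEnd ℂ) 2]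

theorem conjForm_sevenSum : conjForm sevenSum = -sevenSum := by
  rw [sevenSum, conjForm_sum, ← Finset.sum_neg_distrib]
  refine Finset.sum_congr rfl fun j _ => ?_
  rw [conjForm_contract₂, biConj_inl, biConj_inr, contract₂_swap]

theorem conjForm_formSeven : conjForm formSeven = formSeven := by
  rw [formSeven, conjForm_smul, conj_pow_seven, conjForm_sevenSum, smul_neg, neg_smul, neg_neg]

theorem conjForm_closedFormSeven : conjForm closedFormSeven = closedFormSeven := by
  have h1 : starRingEnd ℂ (3 * Complex.I / 2) = -(3 * Complex.I / 2) := by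
    simp [map_ofNat (starRingEnd ℂ) 2, map_ofNat (starRingEnd ℂ) 3]
    ring
  rw [closedFormSeven, conjForm_smul, conj_pow_seven, conjForm_sub, conjForm_sevenSum,
    sevenCorrection, conjForm_add, conjForm_smul, conjForm_smul, conjForm_contract₂,
    conjForm_contract₂, biConj_inl, biConj_inl, biConj_inr, biConj_inr, h1]
  module

theorem ceDel_ceDelBar_formSeven :
    ceDel (biScale 8) structBilin (ceDelBar (biScale 8) structBilin formSeven) = 0 :=
  hasWeight_formSeven.ceDel_ceDelBar_eq_zero (ceDiff_structBilin_eq_zero _)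

end Seven

/-! ### Left-invariant forms on the quotient -/

section Invariant

theorem AlternatingMap.continuous_of_pi {ι : Type*} [Fintype ι] {k : ℕ}
    (Φ : (ι → ℂ) [⋀^Fin k]→ₗ[ℂ] ℂ) : Continuous Φ := by
  classical
  induction k with
  | zero => exact continuous_of_const fun v w => congrArg Φ (Subsingleton.elim v w)
  | succ k ih =>
    have h : ∀ v : Fin (k + 1) → ι → ℂ, Φ v =
        ∑ i, v 0 i * Φ.curryLeft (Pi.single i 1) (Matrix.vecTail v) := by
      intro v
      have h1 : Φ v = Φ.curryLeft (v 0) (Matrix.vecTail v) := by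
        rw [AlternatingMap.curryLeft_apply_apply]
        exact congrArg Φ (Matrix.cons_head_tail v).symm
      rw [h1]
      conv_lhs => rw [pi_eq_sum_univ' (v 0), map_sum, AlternatingMap.finset_sum_apply]
      refine Finset.sum_congr rfl fun i _ => ?_
      rw [map_smul, AlternatingMap.smul_apply, smul_eq_mul]
    have h2 : (Φ : (Fin (k + 1) → ι → ℂ) → ℂ) = fun v =>
        ∑ i, v 0 i * Φ.curryLeft (Pi.single i 1) (Matrix.vecTail v) := funext h
    rw [h2]
    refine continuous_finsetSum _ fun i _ => Continuous.mul (by fun_prop) ?_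
    refine (ih (Φ.curryLeft (Pi.single i 1))).comp (continuous_pi fun j => ?_)
    exact continuous_apply j.succ

variable {E : Type*} [NormedAddCommGroup E] [NormedSpace ℂ E] [FiniteDimensional ℝ E]
  {H : Type*} [TopologicalSpace H] {I : ModelWithCorners ℂ E H}
  {M : Type*} [TopologicalSpace M] [ChartedSpace H M]
  {c : E →ₗ[ℝ] E →ₗ[ℝ] E} {π : E → M}
  {n : ℕ} (crd : E ≃ₗ[ℂ] (Fin n → ℂ))
  {cW : (Fin n ⊕ Fin n → ℂ) →ₗ[ℂ] (Fin n ⊕ Fin n → ℂ) →ₗ[ℂ] (Fin n ⊕ Fin n → ℂ)}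

/-- `restrictForm` along `biEmb` as a continuous alternating map. -/
noncomputable def realForm {k : ℕ} (Θ : (Fin n ⊕ Fin n → ℂ) [⋀^Fin k]→ₗ[ℂ] ℂ) :
    E [⋀^Fin k]→L[ℝ] ℂ :=
  { restrictForm (biEmb crd) Θ with
    cont := Θ.continuous_of_pi.comp (continuous_pi fun i =>
      (LinearMap.continuous_of_finiteDimensional (biEmb crd)).comp (continuous_apply i)) }

variable (I M c) in
/-- The form on `M` with constant coefficients in the left-invariant frame. -/
noncomputable def invariantForm {k : ℕ} (Θ : (Fin n ⊕ Fin n → ℂ) [⋀^Fin k]→ₗ[ℂ] ℂ) :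
    DForm I M k := DForm.fromFrame I c fun _ => realForm crd Θ

/-- The coefficients of the form in the left-invariant frame are constant, and given by `Θ`. -/
def DForm.IsInvariant (c : E →ₗ[ℝ] E →ₗ[ℝ] E) (π : E → M) {k : ℕ} (η : DForm I M k)
    (Θ : (Fin n ⊕ Fin n → ℂ) [⋀^Fin k]→ₗ[ℂ] ℂ) : Prop :=
  ∀ y, η.HasMean c π (constFun E) (LinearMap.proj y) (biEmb crd) Θ

variable {crd}

theorem IsNilCover.isInvariant_invariantForm (h : IsNilCover I c π) {k : ℕ}
    (Θ : (Fin n ⊕ Fin n → ℂ) [⋀^Fin k]→ₗ[ℂ] ℂ) :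
    (invariantForm I M c crd Θ).IsInvariant crd c π Θ := by
  intro y
  rw [DForm.HasMean, invariantForm, h.toFrame_fromFrame]
  exact ⟨fun v => ⟨_, rfl⟩, fun v => rfl⟩

theorem DForm.IsInvariant.apply_eq (h : IsNilCover I c π) {k : ℕ} {η : DForm I M k}
    {Θ : (Fin n ⊕ Fin n → ℂ) [⋀^Fin k]→ₗ[ℂ] ℂ} (hη : η.IsInvariant crd c π Θ) (x : M)
    (v : Fin k → E) :
    η x v = Θ fun i => biEmb crd (coframeMap c (chartPoint I x) (v i)) := by
  refine (h.apply_eq_toFrame η x v).trans ?_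
  obtain ⟨y, rfl⟩ := h.quotient.surjective x
  exact (hη y).2 _

theorem DForm.IsInvariant.eq_zero (h : IsNilCover I c π) {k : ℕ} {η : DForm I M k}
    (hη : η.IsInvariant crd c π 0) : η = 0 := by
  funext x
  ext v
  exact hη.apply_eq h x v

theorem DForm.IsInvariant.isSmooth [IsManifold I 1 M] [I.Boundaryless] (h : IsNilCover I c π)
    {k : ℕ} {η : DForm I M k} {Θ : (Fin n ⊕ Fin n → ℂ) [⋀^Fin k]→ₗ[ℂ] ℂ}
    (hη : η.IsInvariant crd c π Θ) : η.IsSmooth := by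
  rw [h.isSmooth_iff]
  intro v
  obtain ⟨a, ha⟩ := (hη 0).1 v
  rw [ha]
  exact contDiff_const

omit [FiniteDimensional ℝ E] in
theorem biEmb_eq_add (v : E) : biEmb crd v =
    leftVec (crd v) + rightVec fun l => starRingEnd ℂ (crd v l) := by
  funext i
  cases i <;> simp [biEmb_apply, leftVec, rightVec]

omit [FiniteDimensional ℝ E] in
theorem biEmb_I_smul (v : E) : biEmb crd (Complex.I • v) = Complex.I • leftVec (crd v) -
    Complex.I • rightVec fun l => starRingEnd ℂ (crd v l) := by
  rw [biEmb_smul, biEmb_eq_add]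
  funext i
  cases i <;> simp [biScale, leftVec, rightVec]

omit [FiniteDimensional ℝ E] in
/-- A form of weight zero is of type `(p,p)`. -/
theorem HasWeight.map_biEmb_smul {p : ℕ} {Θ : (Fin n ⊕ Fin n → ℂ) [⋀^Fin (2 * p)]→ₗ[ℂ] ℂ}
    (hΘ : HasWeight 0 Θ) (a : ℂ) (v : Fin (2 * p) → E) :
    (Θ fun i => biEmb crd (a • v i)) =
      a ^ p * starRingEnd ℂ a ^ p * Θ fun i => biEmb crd (v i) := by
  have hr : ∀ (r : ℝ) (w : Fin (2 * p) → E), (Θ fun i => biEmb crd ((r : ℂ) • w i)) =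
      (r : ℂ) ^ (2 * p) * Θ fun i => biEmb crd (w i) := by
    intro r w
    have h1 : ∀ i, biEmb crd ((r : ℂ) • w i) = (r : ℂ) • biEmb crd (w i) := fun i => by
      rw [Complex.coe_smul, map_smul, Complex.coe_smul]
    simp only [h1]
    rw [AlternatingMap.map_smul_univ]
    simp
  by_cases ha : a = 0
  · subst ha
    have h0 := hr 0 v
    rw [Complex.ofReal_zero] at h0
    rw [h0, map_zero, ← pow_add, ← two_mul]
  · have hn : (‖a‖ : ℂ) ≠ 0 := by simpa using ha
    obtain ⟨u, hu, hau⟩ : ∃ u : ℂ, ‖u‖ = 1 ∧ a = (‖a‖ : ℂ) * u :=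
      ⟨a / ‖a‖, by simp [ha], by field_simp⟩
    have h1 : ∀ i, a • v i = (‖a‖ : ℂ) • u • v i := fun i => by rw [smul_smul, ← hau]
    have h2 := hΘ u hu fun i => biEmb crd (v i)
    simp only [← biEmb_smul, zpow_zero, one_mul] at h2
    simp only [h1]
    rw [hr, h2, ← mul_pow, Complex.mul_conj, Complex.normSq_eq_norm_sq, Complex.ofReal_pow,
      ← pow_mul]

/-- A positive form of weight zero fixed under conjugation defines a transverse form. -/
theorem DForm.IsInvariant.isSmoothTransverse [IsManifold I 1 M] [I.Boundaryless]
    (h : IsNilCover I c π) {p : ℕ} {Ω : DForm I M (2 * p)}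
    {Θ : (Fin n ⊕ Fin n → ℂ) [⋀^Fin (2 * p)]→ₗ[ℂ] ℂ} (hΩ : Ω.IsInvariant crd c π Θ)
    (hw : HasWeight 0 Θ) (hc : conjForm Θ = Θ) (hpos : IsPositiveForm p Θ) :
    Ω.IsSmoothTransverse p := by
  have hsmul : ∀ (x : M) (a : ℂ) (u : E), coframeMap c (chartPoint I x) (a • u) =
      a • coframeMap c (chartPoint I x) u := fun x a u => by
    rw [coframeMap_apply, coframeMap_apply, h.smul_right, smul_sub]
  refine ⟨hΩ.isSmooth h, fun x => ⟨⟨by ring, fun a v => ?_⟩, fun v => ?_, fun v hv => ?_⟩⟩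
  · refine (hΩ.apply_eq h x _).trans (Eq.trans ?_ (congrArg _ (hΩ.apply_eq h x v)).symm)
    refine Eq.trans ?_ (hw.map_biEmb_smul a _)
    exact congrArg Θ (funext fun i => congrArg _ (hsmul x a (v i)))
  · rw [← Complex.conj_eq_iff_im]
    refine (congrArg _ (hΩ.apply_eq h x v)).trans (Eq.trans ?_ (hΩ.apply_eq h x v).symm)
    have h1 := DFunLike.congr_fun hc fun i => biEmb crd (coframeMap c (chartPoint I x) (v i))
    rw [conjForm_apply] at h1
    simpa only [biConj_biEmb] using h1
  · set T : E →ₗ[ℂ] (Fin n → ℂ) := crd.toLinearMap ∘ₗ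
      { toFun := coframeMap c (chartPoint I x), map_add' := map_add _, map_smul' := hsmul x }
    have hT : Function.Injective T := by
      intro u u' huu
      have h1 := congrArg (frameMap c (chartPoint I x)) (crd.injective huu)
      exact (frameMap_coframeMap h.twoStep _ u).symm.trans
        (h1.trans (frameMap_coframeMap h.twoStep _ u'))
    have hli : LinearIndependent ℂ fun i => T (v i) :=
      LinearIndependent.map' (M := E) hv T (LinearMap.ker_eq_bot.2 hT)
    refine (hpos _ hli).trans_eq (congrArg Complex.re ?_)
    refine Eq.trans ?_ (hΩ.apply_eq h x _).symm
    rw [← AlternatingMap.map_interleave_add_sub]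
    refine congrArg Θ ?_
    refine Eq.trans ?_ (comp_interleave (fun u : E => biEmb crd
      (coframeMap c (chartPoint I x) u)) v fun i => Complex.I • v i).symm
    congr 1
    · funext i
      exact (biEmb_eq_add _).symm
    · funext i
      exact (biEmb_I_smul _).symm.trans (congrArg _ (hsmul x _ _).symm)

theorem DForm.IsInvariant.im_eq_zero (h : IsNilCover I c π) {k : ℕ} {η : DForm I M k}
    {Θ : (Fin n ⊕ Fin n → ℂ) [⋀^Fin k]→ₗ[ℂ] ℂ} (hη : η.IsInvariant crd c π Θ)
    (hc : conjForm Θ = Θ) (x : M) (v : Fin k → E) : (η x v).im = 0 := by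
  rw [← Complex.conj_eq_iff_im]
  refine (congrArg _ (hη.apply_eq h x v)).trans (Eq.trans ?_ (hη.apply_eq h x v).symm)
  have h1 := DFunLike.congr_fun hc fun i => biEmb crd (coframeMap c (chartPoint I x) (v i))
  rw [conjForm_apply] at h1
  simpa only [biConj_biEmb] using h1

variable [IsManifold I 1 M] [I.Boundaryless] (h : IsNilCover I c π)
include h

theorem IsNilCover.isPPluriclosed_of_form (hj : IsComplexModel c (biEmb crd) cW (biScale n)) {p : ℕ}
    {Θ : (Fin n ⊕ Fin n → ℂ) [⋀^Fin (2 * p)]→ₗ[ℂ] ℂ} (hw : HasWeight 0 Θ) (hc : conjForm Θ = Θ)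
    (hpos : IsPositiveForm p Θ)
    (hd : ceDel (biScale n) cW (ceDelBar (biScale n) cW Θ) = 0) : IsPPluriclosed I M p := by
  have hΩ := h.isInvariant_invariantForm (M := M) (crd := crd) Θ
  refine ⟨_, hΩ.isSmoothTransverse h hw hc hpos,
    DForm.IsInvariant.eq_zero (crd := crd) h fun y => ?_⟩
  rw [← hd]
  exact ((hΩ y).delBar hj (isInvariantMean_eval c y) h).del hj (isInvariantMean_eval c y) h

theorem IsNilCover.isPSymplectic_of_form (hj : IsComplexModel c (biEmb crd) cW (biScale n)) {p : ℕ}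
    {Θ Ψ : (Fin n ⊕ Fin n → ℂ) [⋀^Fin (2 * p)]→ₗ[ℂ] ℂ} (hw : HasWeight 0 Θ) (hc : conjForm Θ = Θ)
    (hpos : IsPositiveForm p Θ) (hd : ceDiff cW Ψ = 0) (hc' : conjForm Ψ = Ψ)
    (hΨ : typeProj (biScale n) p p Ψ = Θ) : IsPSymplectic I M p := by
  have hI := h.isInvariant_invariantForm (M := M) (crd := crd) Ψ
  refine ⟨_, hI.isSmooth h, hI.im_eq_zero h hc', DForm.IsInvariant.eq_zero (crd := crd) h
    fun y => ?_, DForm.IsInvariant.isSmoothTransverse (crd := crd) h (fun y => ?_) hw hc hpos⟩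
  · rw [← hd]
    exact (hI y).d hj (isInvariantMean_eval c y) h
  · rw [← hΨ]
    exact (hI y).component hj h p p

end Invariant

/-! ### The universal covering of `I_{3,1} × ηβ₅` -/

section Covering

namespace I31Group

theorem cocycle_add_left (a b z : I31Group) : cocycle (a + b) z = cocycle a z + cocycle b z := by
  have h1 : (a + b).1 = a.1 + b.1 := rfl
  have h2 : (a + b).2.1 = a.2.1 + b.2.1 := rfl
  simp only [cocycle, h1, h2, map_add]
  ring

theorem cocycle_add_right (a z w : I31Group) : cocycle a (z + w) = cocycle a z + cocycle a w := by
  have h1 : (z + w).1 = z.1 + w.1 := rfl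
  have h2 : (z + w).2.1 = z.2.1 + w.2.1 := rfl
  simp only [cocycle, h1, h2]
  ring

theorem cocycle_real_smul_left (r : ℝ) (a z : I31Group) : cocycle (r • a) z = r • cocycle a z := by
  have h1 : (r • a).1 = r * a.1 := rfl
  have h2 : (r • a).2.1 = r * a.2.1 := rfl
  simp only [cocycle, h1, h2, map_mul, Complex.conj_ofReal, Complex.real_smul]
  ring

theorem cocycle_smul_right (r : ℂ) (a z : I31Group) : cocycle a (r • z) = r * cocycle a z := by
  have h1 : (r • z).1 = r * z.1 := rfl
  have h2 : (r • z).2.1 = r * z.2.1 := rfl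
  simp only [cocycle, h1, h2]
  ring

instance : FiniteDimensional ℂ I31Group := inferInstanceAs (FiniteDimensional ℂ (ℂ × ℂ × ℂ))

end I31Group

instance (n : ℕ) : FiniteDimensional ℂ (EtaBetaGroup n) :=
  inferInstanceAs (FiniteDimensional ℂ ((Fin n → ℂ) × (Fin n → ℂ) × ℂ))

/-- The product of the groups `I31Group` and the opposite of `EtaBetaGroup 2` has the group law
`y * v = y + v + c y v` with this real-bilinear map `c`. The opposite group appears since the
subgroup defining `ηβ₅` acts by right translations. -/
noncomputable def coverBilin : (I31Group × EtaBetaGroup 2) →ₗ[ℝ] (I31Group × EtaBetaGroup 2) →ₗ[ℝ]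
    (I31Group × EtaBetaGroup 2) :=
  LinearMap.mk₂ ℝ
    (fun y v => (((0, 0, I31Group.cocycle y.1 v.1) : ℂ × ℂ × ℂ),
      ((0, 0, v.2.1 ⬝ᵥ y.2.2.1) : (Fin 2 → ℂ) × (Fin 2 → ℂ) × ℂ)))
    (fun y y' v => Prod.ext (Prod.ext (add_zero _).symm (Prod.ext (add_zero _).symm
      (I31Group.cocycle_add_left _ _ _))) (Prod.ext (add_zero _).symm (Prod.ext (add_zero _).symm
        (dotProduct_add v.2.1 y.2.2.1 y'.2.2.1))))
    (fun r y v => Prod.ext (Prod.ext (smul_zero _).symm (Prod.ext (smul_zero _).symm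
      (I31Group.cocycle_real_smul_left _ _ _))) (Prod.ext (smul_zero _).symm
        (Prod.ext (smul_zero _).symm (dotProduct_smul (r : ℂ) v.2.1 y.2.2.1))))
    (fun y v v' => Prod.ext (Prod.ext (add_zero _).symm (Prod.ext (add_zero _).symm
      (I31Group.cocycle_add_right _ _ _))) (Prod.ext (add_zero _).symm (Prod.ext (add_zero _).symm
        (add_dotProduct v.2.1 v'.2.1 y.2.2.1))))
    (fun r y v => Prod.ext (Prod.ext (smul_zero _).symm (Prod.ext (smul_zero _).symm
      (I31Group.cocycle_smul_right _ _ _))) (Prod.ext (smul_zero _).symm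
        (Prod.ext (smul_zero _).symm (smul_dotProduct (r : ℂ) v.2.1 y.2.2.1))))

theorem coverBilin_apply (y v : I31Group × EtaBetaGroup 2) : coverBilin y v =
    (((0, 0, I31Group.cocycle y.1 v.1) : ℂ × ℂ × ℂ),
      ((0, 0, v.2.1 ⬝ᵥ y.2.2.1) : (Fin 2 → ℂ) × (Fin 2 → ℂ) × ℂ)) := rfl

theorem isTwoStep_coverBilin : IsTwoStep coverBilin := by
  constructor
  · intro a b v
    rw [coverBilin_apply, coverBilin_apply]
    refine Prod.ext (Prod.ext rfl (Prod.ext rfl ?_)) (Prod.ext rfl (Prod.ext rfl ?_))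
    · simp [I31Group.cocycle]
      rfl
    · simp
      rfl
  · intro y a b
    rw [coverBilin_apply, coverBilin_apply]
    refine Prod.ext (Prod.ext rfl (Prod.ext rfl ?_)) (Prod.ext rfl (Prod.ext rfl ?_))
    · simp [I31Group.cocycle]
      rfl
    · simp
      rfl

theorem coverBilin_smul_right (y : I31Group × EtaBetaGroup 2) (a : ℂ)
    (v : I31Group × EtaBetaGroup 2) : coverBilin y (a • v) = a • coverBilin y v :=
  Prod.ext (Prod.ext (smul_zero _).symm (Prod.ext (smul_zero _).symm
    (I31Group.cocycle_smul_right _ _ _))) (Prod.ext (smul_zero _).symm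
      (Prod.ext (smul_zero _).symm (smul_dotProduct a v.2.1 y.2.2.1)))

/-- The coordinates of the universal covering, in the order used for `structBilin`. -/
noncomputable def coverCrd : (I31Group × EtaBetaGroup 2) ≃ₗ[ℂ] (Fin 8 → ℂ) where
  toFun v := ![v.1.1, v.1.2.1, v.1.2.2, v.2.1 0, v.2.2.1 0, v.2.1 1, v.2.2.1 1, v.2.2.2]
  map_add' x y := by
    funext i
    fin_cases i <;> rfl
  map_smul' r x := by
    funext i
    fin_cases i <;> rfl
  invFun u := (((u 0, u 1, u 2) : ℂ × ℂ × ℂ),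
    ((![u 3, u 5], ![u 4, u 6], u 7) : (Fin 2 → ℂ) × (Fin 2 → ℂ) × ℂ))
  left_inv v := by
    refine Prod.ext rfl (Prod.ext ?_ (Prod.ext ?_ rfl)) <;>
    · funext i
      fin_cases i <;> rfl
  right_inv u := by
    funext i
    fin_cases i <;> rfl

theorem coverCrd_apply (v : I31Group × EtaBetaGroup 2) : coverCrd v =
    ![v.1.1, v.1.2.1, v.1.2.2, v.2.1 0, v.2.2.1 0, v.2.1 1, v.2.2.1 1, v.2.2.2] := rfl

theorem structBilin_sumElim (u v : Fin 8 → ℂ) :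
    structBilin (Sum.elim u fun i => starRingEnd ℂ (u i))
        (Sum.elim v fun i => starRingEnd ℂ (v i)) =
      (-(u 0 * v 1) +
        Complex.I / 2 * (starRingEnd ℂ (u 0) * v 0 + 2 * (starRingEnd ℂ (u 1) * v 1))) •
          biVec (.inl 2) +
      starRingEnd ℂ (-(u 0 * v 1) +
        Complex.I / 2 * (starRingEnd ℂ (u 0) * v 0 + 2 * (starRingEnd ℂ (u 1) * v 1))) •
          biVec (.inr 2) +
      (v 3 * u 4 + v 5 * u 6) • biVec (.inl 7) +
      starRingEnd ℂ (v 3 * u 4 + v 5 * u 6) • biVec (.inr 7) := by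
  rw [structBilin_apply]
  simp only [Fin.sum_univ_succ, Fin.sum_univ_zero, scIdx, scCoef, Matrix.cons_val_zero,
    Matrix.cons_val_succ, Sum.elim_inl, Sum.elim_inr, map_add, map_neg, map_mul, map_div₀,
    Complex.conj_I, Complex.conj_conj, map_ofNat (starRingEnd ℂ) 2]
  module

theorem coverCrd_coverBilin (x y : I31Group × EtaBetaGroup 2) :
    coverCrd (coverBilin x y) =
      ![0, 0, I31Group.cocycle x.1 y.1, 0, 0, 0, 0, y.2.1 0 * x.2.2.1 0 + y.2.1 1 * x.2.2.1 1] := by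
  rw [coverCrd_apply]
  have h : (coverBilin x y).2.2.2 = y.2.1 0 * x.2.2.1 0 + y.2.1 1 * x.2.2.1 1 :=
    Fin.sum_univ_two fun i : Fin 2 => y.2.1 i * x.2.2.1 i
  rw [h]
  rfl

theorem isComplexModel_coverBilin :
    IsComplexModel coverBilin (biEmb coverCrd) structBilin (biScale 8) := by
  refine ⟨fun x y => ?_, fun a x => biEmb_smul coverCrd a x⟩
  rw [biEmb_apply, biEmb_apply, biEmb_apply, structBilin_sumElim, coverCrd_coverBilin]
  have h : -(coverCrd x 0 * coverCrd y 1) + Complex.I / 2 * (starRingEnd ℂ (coverCrd x 0) *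
      coverCrd y 0 + 2 * (starRingEnd ℂ (coverCrd x 1) * coverCrd y 1)) =
        I31Group.cocycle x.1 y.1 := rfl
  have h' : coverCrd y 3 * coverCrd x 4 + coverCrd y 5 * coverCrd x 6 =
      y.2.1 0 * x.2.2.1 0 + y.2.1 1 * x.2.2.1 1 := rfl
  rw [h, h']
  funext i
  rcases i with i | i <;> fin_cases i <;> simp [biVec]

end Covering

/-! ### Lattices and compactness -/

section Lattice

theorem extChartAt_symm_eq_of_covering {E : Type*} [NormedAddCommGroup E] [NormedSpace ℂ E]
    {X : Type*} [TopologicalSpace X] {f : E → X} (hf : IsLocalHomeomorph f)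
    (hs : Function.Surjective f) (x : X) :
    letI := coveringChartedSpace hf hs
    ⇑(extChartAt 𝓘(ℂ, E) x).symm = f := by
  let _ := coveringChartedSpace hf hs
  exact hf.localInverseAt_symm _

/-- Complex numbers can be rounded to Gaussian integers. -/
theorem exists_gaussianInt_norm_add_le (z : ℂ) :
    ∃ w ∈ GaussianInt.toComplex.range, ‖w + z‖ ≤ 1 := by
  refine ⟨GaussianInt.toComplex ⟨-round z.re, -round z.im⟩, ⟨_, rfl⟩, ?_⟩
  have h1 := abs_sub_round z.re
  have h2 := abs_sub_round z.im
  refine (Complex.norm_le_abs_re_add_abs_im _).trans ?_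
  rw [Complex.add_re, Complex.add_im, GaussianInt.re_toComplex, GaussianInt.im_toComplex,
    Int.cast_neg, Int.cast_neg, neg_add_eq_sub, neg_add_eq_sub]
  linarith

theorem I_mem_gaussianInt : Complex.I ∈ GaussianInt.toComplex.range :=
  ⟨⟨0, 1⟩, by simp [GaussianInt.toComplex_def]⟩

instance (n : ℕ) : CompactSpace (EtaBeta n) := by
  have hK : IsCompact (Metric.closedBall (0 : (Fin n → ℂ) × (Fin n → ℂ) × ℂ) 1) :=
    isCompact_closedBall _ _
  have hc : Continuous (EtaBeta.proj n) := continuous_quotient_mk'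
  refine ⟨(hK.image (f := fun g : (Fin n → ℂ) × (Fin n → ℂ) × ℂ => EtaBeta.proj n g)
    hc).of_isClosed_subset isClosed_univ ?_⟩
  intro x _
  obtain ⟨g, rfl⟩ := (EtaBeta.isQuotientCoveringMap n).surjective x
  choose A hA hA' using fun j => exists_gaussianInt_norm_add_le (g.1 j)
  choose B hB hB' using fun j => exists_gaussianInt_norm_add_le (g.2.1 j)
  obtain ⟨w, hw, hw'⟩ := exists_gaussianInt_norm_add_le (g.1 ⬝ᵥ B + g.2.2)
  let γ : EtaBetaGroup n := ((A, B, w) : (Fin n → ℂ) × (Fin n → ℂ) × ℂ)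
  have hγ : γ ∈ EtaBetaGroup.gaussian n := ⟨hA, hB, hw⟩
  refine ⟨g * γ, ?_, QuotientGroup.mk_mul_of_mem g hγ⟩
  refine (mem_closedBall_zero_iff (E := (Fin n → ℂ) × (Fin n → ℂ) × ℂ)).2
    (max_le ?_ (max_le ?_ ?_))
  · refine (pi_norm_le_iff_of_nonneg zero_le_one).2 fun j => ?_
    change ‖g.1 j + A j‖ ≤ 1
    rw [add_comm]
    exact hA' j
  · refine (pi_norm_le_iff_of_nonneg zero_le_one).2 fun j => ?_
    change ‖g.2.1 j + B j‖ ≤ 1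
    rw [add_comm]
    exact hB' j
  · change ‖w + g.1 ⬝ᵥ B + g.2.2‖ ≤ 1
    rwa [add_assoc]

theorem conj_mem_gaussianInt {z : ℂ} (hz : z ∈ GaussianInt.toComplex.range) :
    starRingEnd ℂ z ∈ GaussianInt.toComplex.range := by
  obtain ⟨w, rfl⟩ := hz
  exact ⟨star w, GaussianInt.toComplex_star w⟩

namespace I31Group

theorem two_mul_cocycle_mem {a z : I31Group} (ha : a.1 ∈ GaussianInt.toComplex.range)
    (ha' : a.2.1 ∈ GaussianInt.toComplex.range) (hz : z.1 ∈ GaussianInt.toComplex.range)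
    (hz' : z.2.1 ∈ GaussianInt.toComplex.range) :
    2 * cocycle a z ∈ GaussianInt.toComplex.range := by
  have h : 2 * cocycle a z = -(a.1 * z.2.1 + a.1 * z.2.1) + Complex.I * (starRingEnd ℂ a.1 * z.1 +
      (starRingEnd ℂ a.2.1 * z.2.1 + starRingEnd ℂ a.2.1 * z.2.1)) := by
    rw [cocycle]
    ring
  have h1 := mul_mem ha hz'
  have h2 := mul_mem (conj_mem_gaussianInt ha') hz'
  rw [h]
  exact add_mem (neg_mem (add_mem h1 h1)) (mul_mem I_mem_gaussianInt
    (add_mem (mul_mem (conj_mem_gaussianInt ha) hz) (add_mem h2 h2)))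

/-- The lattice of the `a` with `a₁, a₂ ∈ ℤ[i]` and `2 a₃ ∈ ℤ[i]`; the denominator `2` is that of
the group law. -/
noncomputable def halfGaussian : Subgroup I31Group where
  carrier := {a | a.1 ∈ GaussianInt.toComplex.range ∧ a.2.1 ∈ GaussianInt.toComplex.range ∧
    2 * a.2.2 ∈ GaussianInt.toComplex.range}
  mul_mem' {a b} ha hb := by
    refine ⟨add_mem ha.1 hb.1, add_mem ha.2.1 hb.2.1, ?_⟩
    rw [mul_snd_snd, mul_add, mul_add]
    exact add_mem (add_mem ha.2.2 hb.2.2) (two_mul_cocycle_mem ha.1 ha.2.1 hb.1 hb.2.1)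
  one_mem' := ⟨zero_mem _, zero_mem _, by
    change (2 : ℂ) * 0 ∈ _
    rw [mul_zero]
    exact zero_mem _⟩
  inv_mem' {a} ha := by
    refine ⟨neg_mem ha.1, neg_mem ha.2.1, ?_⟩
    rw [inv_snd_snd, mul_add, mul_neg]
    exact add_mem (neg_mem ha.2.2) (two_mul_cocycle_mem ha.1 ha.2.1 ha.1 ha.2.1)

theorem discreteTopology_halfGaussian : DiscreteTopology halfGaussian := by
  apply discreteTopology_of_isOpen_singleton_one
  have hopen : IsOpen {g : ℂ × ℂ × ℂ | ‖g‖ < 1 / 2} :=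
    isOpen_lt continuous_norm continuous_const
  have hpre : IsOpen ((fun g : halfGaussian => (g.1 : ℂ × ℂ × ℂ)) ⁻¹' {g | ‖g‖ < 1 / 2}) :=
    hopen.preimage continuous_subtype_val
  convert! hpre using 1
  ext g
  constructor
  · rintro rfl
    change ‖(0 : ℂ × ℂ × ℂ)‖ < 1 / 2
    simp
  · intro h0
    obtain ⟨⟨x, y, z⟩, hx, hy, hz⟩ := g
    change ‖((x, y, z) : ℂ × ℂ × ℂ)‖ < 1 / 2 at h0
    rw [Prod.norm_mk, max_lt_iff, Prod.norm_mk, max_lt_iff] at h0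
    obtain ⟨h1, h2, h3⟩ := h0
    refine Subtype.ext (Prod.ext ?_ (Prod.ext ?_ ?_))
    · exact EtaBetaGroup.gaussianInt_eq_zero_of_norm_lt_one hx (h1.trans (by norm_num))
    · exact EtaBetaGroup.gaussianInt_eq_zero_of_norm_lt_one hy (h2.trans (by norm_num))
    · have h4 : 2 * z = 0 := EtaBetaGroup.gaussianInt_eq_zero_of_norm_lt_one hz (by
        rw [norm_mul, Complex.norm_ofNat]
        linarith)
      exact (mul_eq_zero.1 h4).resolve_left two_ne_zero

theorem compactSpace_halfGaussian : CompactSpace (I31 halfGaussian) := by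
  have hK : IsCompact (Metric.closedBall (0 : ℂ × ℂ × ℂ) 1) := isCompact_closedBall _ _
  have hc : Continuous (I31.proj halfGaussian) := continuous_quotient_mk'
  refine ⟨(hK.image (f := fun g : ℂ × ℂ × ℂ => I31.proj halfGaussian g)
    hc).of_isClosed_subset isClosed_univ ?_⟩
  intro x _
  obtain ⟨g, rfl⟩ := Quotient.exists_rep x
  obtain ⟨a, ha, ha'⟩ := exists_gaussianInt_norm_add_le g.1
  obtain ⟨b, hb, hb'⟩ := exists_gaussianInt_norm_add_le g.2.1
  obtain ⟨w, hw, hw'⟩ := exists_gaussianInt_norm_add_le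
    (g.2.2 + cocycle ((a, b, 0) : ℂ × ℂ × ℂ) g)
  let γ : I31Group := ((a, b, w) : ℂ × ℂ × ℂ)
  have hγ : γ ∈ halfGaussian := ⟨ha, hb, by
    change 2 * w ∈ _
    rw [two_mul]
    exact add_mem hw hw⟩
  refine ⟨γ * g, ?_, Quotient.sound ((MulAction.orbitRel_apply).2 ⟨⟨γ, hγ⟩, rfl⟩)⟩
  refine (mem_closedBall_zero_iff (E := ℂ × ℂ × ℂ)).2 (max_le ha' (max_le hb' ?_))
  change ‖w + g.2.2 + cocycle γ g‖ ≤ 1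
  rw [add_assoc]
  exact hw'

end I31Group

end Lattice

/-! ### The product manifold as a quotient of a nilpotent group -/

section Product

variable (Γ : Subgroup I31Group) [DiscreteTopology Γ]

/-- The universal covering of `I_{3,1} × ηβ₅`. -/
noncomputable def coverProj : I31Group × EtaBetaGroup 2 → I31 Γ × EtaBeta 2 :=
  Prod.map (I31.proj Γ) (EtaBeta.proj 2)

theorem isNilCover_coverProj : IsNilCover modelM coverBilin (coverProj Γ) where
  twoStep := isTwoStep_coverBilin
  smul_right := coverBilin_smul_right
  symm_eq x := by
    rw [extChartAt_prod]
    have h1 : ⇑(extChartAt 𝓘(ℂ, I31Group) x.1).symm = I31.proj Γ :=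
      extChartAt_symm_eq_of_covering _ _ x.1
    have h2 : ⇑(extChartAt 𝓘(ℂ, EtaBetaGroup 2) x.2).symm = EtaBeta.proj 2 :=
      extChartAt_symm_eq_of_covering _ _ x.2
    funext y
    exact Prod.ext (congrFun h1 y.1) (congrFun h2 y.2)
  deck y y' hy := by
    have h1 : I31.proj Γ y.1 = I31.proj Γ y'.1 := congrArg Prod.fst hy
    have h2 : EtaBeta.proj 2 y.2 = EtaBeta.proj 2 y'.2 := congrArg Prod.snd hy
    obtain ⟨γ, hγ⟩ := MulAction.orbitRel_apply.1 (Quotient.exact h1.symm)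
    have hδ : y.2⁻¹ * y'.2 ∈ EtaBetaGroup.gaussian 2 := QuotientGroup.eq.1 h2
    set δ := y.2⁻¹ * y'.2
    have key : ∀ z : I31Group × EtaBetaGroup 2, ((γ.1, δ) : I31Group × EtaBetaGroup 2) + z +
        coverBilin (γ.1, δ) z = (γ.1 * z.1, z.2 * δ) := by
      intro z
      refine Prod.ext (Prod.ext (add_zero _) (Prod.ext (add_zero _) rfl))
        (Prod.ext ((add_zero _).trans (add_comm _ _))
          (Prod.ext ((add_zero _).trans (add_comm _ _)) ?_))
      change δ.2.2 + z.2.2.2 + z.2.1 ⬝ᵥ δ.2.1 = δ.2.2 + z.2.1 ⬝ᵥ δ.2.1 + z.2.2.2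
      ring
    refine ⟨(γ.1, δ), ?_, fun z => ?_⟩
    · rw [key]
      refine Prod.ext hγ.symm ?_
      simp only [δ, mul_inv_cancel_left]
    · rw [key]
      refine Prod.ext ?_ (QuotientGroup.mk_mul_of_mem z.2 hδ)
      exact Quotient.sound (MulAction.orbitRel_apply.2 ⟨γ, rfl⟩)
  quotient :=
    ((MulAction.isOpenQuotientMap_quotientMk (Γ := Γ) (T := I31Group)).prodMap
      (QuotientGroup.isOpenQuotientMap_mk (N := EtaBetaGroup.gaussian 2))).isQuotientMap

instance : IsManifold modelM 1 (I31 Γ × EtaBeta 2) := by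
  have h1 : IsManifold 𝓘(ℂ, I31Group) 1 (I31 Γ) := .of_le (n := ω) le_top
  have h2 : IsManifold 𝓘(ℂ, EtaBetaGroup 2) 1 (EtaBeta 2) := .of_le (n := ω) le_top
  exact IsManifold.prod _ _

end Product

theorem mainTheorem8 :
    (∃ Γ : Subgroup I31Group, DiscreteTopology Γ ∧ CompactSpace (I31 Γ)) ∧
    ∀ (Γ : Subgroup I31Group) [DiscreteTopology Γ] [CompactSpace (I31 Γ)],
      IsPPluriclosed modelM (I31 Γ × EtaBeta 2) 7 ∧
      IsPPluriclosed modelM (I31 Γ × EtaBeta 2) 6 ∧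
      IsPSymplectic modelM (I31 Γ × EtaBeta 2) 7 ∧
      (∀ s : ℕ, 1 ≤ s → s ≤ 5 →
        ¬ IsPKahler modelM (I31 Γ × EtaBeta 2) s ∧
        ¬ IsWeaklyPKahler modelM (I31 Γ × EtaBeta 2) s ∧
        ¬ IsPSymplectic modelM (I31 Γ × EtaBeta 2) s ∧
        ¬ IsPPluriclosed modelM (I31 Γ × EtaBeta 2) s) ∧
      ¬ IsPKahler modelM (I31 Γ × EtaBeta 2) 6 ∧
      ¬ IsWeaklyPKahler modelM (I31 Γ × EtaBeta 2) 6 ∧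
      ¬ IsPSymplectic modelM (I31 Γ × EtaBeta 2) 6 ∧
      ¬ IsPKahler modelM (I31 Γ × EtaBeta 2) 7 ∧
      ¬ IsWeaklyPKahler modelM (I31 Γ × EtaBeta 2) 7 := by
  refine ⟨⟨I31Group.halfGaussian, I31Group.discreteTopology_halfGaussian,
    I31Group.compactSpace_halfGaussian⟩, ?_⟩
  intro Γ _ _
  have h := isNilCover_coverProj Γ
  have hj := isComplexModel_coverBilin
  refine ⟨h.isPPluriclosed_of_form hj hasWeight_formSeven conjForm_formSeven
      isPositiveForm_formSeven ceDel_ceDelBar_formSeven,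
    h.isPPluriclosed_of_form hj hasWeight_formSix conjForm_formSix isPositiveForm_formSix
      ceDel_ceDelBar_formSix,
    h.isPSymplectic_of_form hj hasWeight_formSeven conjForm_formSeven isPositiveForm_formSeven
      ceDiff_closedFormSeven conjForm_closedFormSeven typeProj_closedFormSeven,
    fun s hs hs' => ?_, h.not_isPKahler_six hj, h.not_isWeaklyPKahler_six hj,
    h.not_isPSymplectic_six hj, h.not_isPKahler_seven hj, h.not_isWeaklyPKahler_seven hj⟩
  obtain ⟨m, rfl⟩ : ∃ m, s = m + 1 := ⟨s - 1, by omega⟩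
  have hm : m ≤ 4 := by omega
  exact ⟨h.not_isPKahler_le hj hm, h.not_isWeaklyPKahler_le hj hm, h.not_isPSymplectic_le hj hm,
    h.not_isPPluriclosed_le hj hm⟩
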